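/- Let $(X,O_X)$ be a Noetherian scheme and consider the category of quasi-compact and quasi-separated schemes $f\colon Y\to X$ over $X$ (with $X$-morphisms). Let $\mathcal O_X$ be the functor of rings $Y\mapsto \Gamma(Y,O_Y)$ on this category; an $\mathcal O_X$-module is a (contravariant) functor of abelian groups $\mathbb M$ on it together with a $\Gamma(Y,O_Y)$-module structure on each $\mathbb M(Y)$ compatible with restriction. For a quasi-coherent $O_X$-module $F$ let $\mathcal F$ be the $\mathcal O_X$-module $\mathcal F(Y):=\Gamma(Y,f^*F)$. For a coherent $O_X$-module $G$ let $\mathcal G^*:=\mathbb{H}om_{\mathcal O_X}(\mathcal G,\mathcal O_X)$, that is, $\mathcal G^*(Y)=\mathrm{Hom}_{\mathcal O_Y}(\mathcal G|_Y,\mathcal O_Y)$, where $|_Y$ is the restriction to quasi-compact and quasi-separated $Y$-schemes. An $\mathcal O_X$-module isomorphic to some $\mathcal G^*$ with $G$ coherent is called an $\mathcal O_X$-module variety. Theorem. Let $X$ be a Noetherian scheme and $F$ a quasi-coherent $O_X$-module. Then $F$ is a flat $O_X$-module if and only if $\mathcal F$ is a direct limit of $\mathcal O_X$-module varieties, i.e.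 there is a direct system $\{\mathbb N_i\}_{i\in I}$ of $\mathcal O_X$-modules and $\mathcal O_X$-linear morphisms, indexed by a non-empty upward directed set $I$, with every $\mathbb N_i$ an $\mathcal O_X$-module variety, such that $\mathcal F\simeq \varinjlim_{i\in I}\mathbb N_i$ in the category of $\mathcal O_X$-modules. -/

import Mathlib

open CategoryTheory AlgebraicGeometry Opposite

universe v v' u w w'

noncomputable section

namespace PresheafOfModules

variable {C : Type w} [Category.{w'} C]

/-- The universe lift of a presheaf of modules: the values are lifted by `ULift`. -/
def lift {R : Cᵒᵖ ⥤ RingCat.{u}} (M : PresheafOfModules.{v} R) :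
    PresheafOfModules.{max v v'} R where
  obj X := ModuleCat.of _ (ULift.{v'} (M.obj X))
  map {X Y} f := ModuleCat.ofHom
      (Y := (ModuleCat.restrictScalars (R.map f).hom).obj
        (ModuleCat.of _ (ULift.{v'} (M.obj Y))))
    { toFun := fun x ↦ ULift.up (M.map f x.down)
      map_add' := fun x y ↦ congrArg ULift.up (map_add (M.map f).hom x.down y.down)
      map_smul' := fun r x ↦ congrArg ULift.up (M.map_smul f r x.down) }
  map_id X := by
    ext x
    refine congrArg ULift.up ?_
    rw [M.map_id]
    rfl
  map_comp f g := by
    ext x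
    refine congrArg ULift.up ?_
    exact M.map_comp_apply f g x.down

variable {R : Cᵒᵖ ⥤ CommRingCat.{u}}

/-- A morphism `M|_Y ⟶ N|_Y` between the restrictions of `M` and `N` to the category `C / Y`:
a linear map `M(Z) → N(Z)` for every `Z ⟶ Y` in `C` (an arrow `Y ⟶ Z` in `Cᵒᵖ`), compatible with
the restriction maps along morphisms `Z' ⟶ Z` over `Y`. -/
@[ext]
structure HomOver (M : PresheafOfModules.{v} (R ⋙ forget₂ CommRingCat RingCat))
    (N : PresheafOfModules.{v'} (R ⋙ forget₂ CommRingCat RingCat)) (Y : Cᵒᵖ) where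
  app {Z : Cᵒᵖ} (h : Y ⟶ Z) : M.obj Z →ₗ[R.obj Z] N.obj Z
  naturality {Z Z' : Cᵒᵖ} (h : Y ⟶ Z) (k : Z ⟶ Z') (m : M.obj Z) :
    app (h ≫ k) (M.map k m) = N.map k (app h m)

namespace HomOver

variable {M : PresheafOfModules.{v} (R ⋙ forget₂ CommRingCat RingCat)}
  {N : PresheafOfModules.{v'} (R ⋙ forget₂ CommRingCat RingCat)} {Y : Cᵒᵖ}

lemma app_injective :
    Function.Injective (fun (φ : HomOver M N Y) (Z : Cᵒᵖ) (h : Y ⟶ Z) ↦ φ.app h) := by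
  intro φ ψ e
  ext Z h m
  exact LinearMap.congr_fun (congrFun (congrFun e Z) h) m

instance : Zero (HomOver M N Y) where
  zero :=
    { app := fun _ ↦ 0
      naturality := fun _ k _ ↦ (map_zero (N.map k).hom).symm }

instance : Add (HomOver M N Y) where
  add φ ψ :=
    { app := fun h ↦ φ.app h + ψ.app h
      naturality := fun h k m ↦ 
        (congrArg₂ (· + ·) (φ.naturality h k m) (ψ.naturality h k m)).trans
          (map_add (N.map k).hom _ _).symm }

instance : Neg (HomOver M N Y) where
  neg φ :=
    { app := fun h ↦ -φ.app h
      naturality := fun h k m ↦ 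
        (congrArg (- ·) (φ.naturality h k m)).trans (map_neg (N.map k).hom _).symm }

instance : Sub (HomOver M N Y) where
  sub φ ψ :=
    { app := fun h ↦ φ.app h - ψ.app h
      naturality := fun h k m ↦ 
        (congrArg₂ (· - ·) (φ.naturality h k m) (ψ.naturality h k m)).trans
          (map_sub (N.map k).hom _ _).symm }

instance : SMul ℕ (HomOver M N Y) where
  smul n φ :=
    { app := fun h ↦ n • φ.app h
      naturality := fun h k m ↦ 
        (congrArg (n • ·) (φ.naturality h k m)).trans (map_nsmul (N.map k).hom _ _).symm }

instance : SMul ℤ (HomOver M N Y) where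
  smul n φ :=
    { app := fun h ↦ n • φ.app h
      naturality := fun h k m ↦ 
        (congrArg (n • ·) (φ.naturality h k m)).trans (map_zsmul (N.map k).hom _ _).symm }

instance : AddCommGroup (HomOver M N Y) :=
  app_injective.addCommGroup _ rfl (fun _ _ ↦ rfl) (fun _ ↦ rfl) (fun _ _ ↦ rfl)
    (fun _ _ ↦ rfl) (fun _ _ ↦ rfl)

/-- A section `r` of `R` over `Y` acts over `Z ⟶ Y` through its restriction to `Z`. -/
instance : SMul (R.obj Y) (HomOver M N Y) where
  smul r φ :=
    { app := fun h ↦ R.map h r • φ.app h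
      naturality := fun h k m ↦ by
        have e : R.map (h ≫ k) r = R.map k (R.map h r) := by rw [R.map_comp]; rfl
        exact (congrArg₂ (· • ·) e (φ.naturality h k m)).trans
          (N.map_smul k (R.map h r) (φ.app h m)).symm }

@[simp] lemma zero_app {Z : Cᵒᵖ} (h : Y ⟶ Z) : (0 : HomOver M N Y).app h = 0 := rfl

@[simp] lemma add_app (φ ψ : HomOver M N Y) {Z : Cᵒᵖ} (h : Y ⟶ Z) :
    (φ + ψ).app h = φ.app h + ψ.app h := rfl

@[simp] lemma smul_app (r : R.obj Y) (φ : HomOver M N Y) {Z : Cᵒᵖ} (h : Y ⟶ Z) :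
    (r • φ).app h = R.map h r • φ.app h := rfl

instance : Module (R.obj Y) (HomOver M N Y) where
  one_smul φ := by ext; simp
  mul_smul r s φ := by ext; simp [mul_smul]
  smul_zero r := by ext; simp
  smul_add r φ ψ := by ext; simp
  add_smul r s φ := by ext; simp [add_smul]
  zero_smul φ := by ext; simp

/-- Restriction of a morphism `M|_Y ⟶ N|_Y` along `Y' ⟶ Y`. -/
@[simps]
def restrict (φ : HomOver M N Y) {Y' : Cᵒᵖ} (g : Y ⟶ Y') : HomOver M N Y' where
  app h := φ.app (g ≫ h)
  naturality h k m := by rw [← Category.assoc, φ.naturality]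

end HomOver

/-- The internal hom `Y ↦ Hom(M|_Y, N|_Y)` of presheaves of modules. -/
def internalHom (M : PresheafOfModules.{v} (R ⋙ forget₂ CommRingCat RingCat))
    (N : PresheafOfModules.{v'} (R ⋙ forget₂ CommRingCat RingCat)) :
    PresheafOfModules.{max v v' w w'} (R ⋙ forget₂ CommRingCat RingCat) where
  obj Y := ModuleCat.of (R.obj Y) (HomOver M N Y)
  map {Y Y'} g := ModuleCat.ofHom
      (Y := (ModuleCat.restrictScalars ((R ⋙ forget₂ CommRingCat RingCat).map g).hom).obj
        (ModuleCat.of (R.obj Y') (HomOver M N Y')))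
    { toFun := fun φ ↦ φ.restrict g
      map_add' := fun φ ψ ↦ rfl
      map_smul' := fun r φ ↦ by
        refine HomOver.app_injective (funext fun Z ↦ funext fun h ↦ ?_)
        change R.map (g ≫ h) r • φ.app (g ≫ h) = R.map h (R.map g r) • φ.app (g ≫ h)
        rw [R.map_comp]
        rfl }
  map_id Y := by
    ext φ
    refine HomOver.app_injective (funext fun Z ↦ funext fun h ↦ ?_)
    change φ.app (𝟙 Y ≫ h) = φ.app h
    rw [Category.id_comp]
  map_comp f g := by
    ext φ
    refine HomOver.app_injective (funext fun Z ↦ funext fun h ↦ ?_)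
    change φ.app ((f ≫ g) ≫ h) = φ.app (f ≫ g ≫ h)
    rw [Category.assoc]

/-- The dual `M^* = Hom(M, R)`. -/
def dual (M : PresheafOfModules.{v} (R ⋙ forget₂ CommRingCat RingCat)) :
    PresheafOfModules.{max v u w w'} (R ⋙ forget₂ CommRingCat RingCat) :=
  M.internalHom (unit (R ⋙ forget₂ CommRingCat RingCat))

end PresheafOfModules

namespace AlgebraicGeometry.Scheme

/-- The category of quasi-compact and quasi-separated schemes over `X` (and `X`-morphisms). -/
abbrev QcqsOver (X : Scheme.{u}) : Type (u + 1) :=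
  ObjectProperty.FullSubcategory
    (fun Y : Over X ↦ CompactSpace Y.left ∧ QuasiSeparatedSpace Y.left)

/-- The functor of rings `𝒪_X` on quasi-compact and quasi-separated `X`-schemes,
`Y ↦ Γ(Y, O_Y)`. -/
def structureFunctor (X : Scheme.{u}) : X.QcqsOverᵒᵖ ⥤ CommRingCat.{u} :=
  (ObjectProperty.ι _ ⋙ Over.forget X).op ⋙ Scheme.Γ

namespace Modules

/-- The stalk `M_x` is a module over the local ring `O_{X,x}`. -/
instance stalkModule {X : Scheme.{u}} (M : X.Modules) (x : X) :
    Module (X.presheaf.stalk x) (TopCat.Presheaf.stalk (C := Ab.{u}) M.presheaf x) :=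
  letI N : _root_.PresheafOfModules.{u} (X.presheaf ⋙ forget₂ CommRingCat RingCat) := M.val
  inferInstanceAs (Module (X.presheaf.stalk x) (TopCat.Presheaf.stalk (C := Ab.{u}) N.presheaf x))

/-- `M` is a flat `O_X`-module: every stalk `M_x` is flat over `O_{X,x}`. -/
def IsFlat {X : Scheme.{u}} (M : X.Modules) : Prop :=
  ∀ x : X, Module.Flat (X.presheaf.stalk x) (TopCat.Presheaf.stalk (C := Ab.{u}) M.presheaf x)

/-- Coherent modules on a (locally) Noetherian scheme: quasi-coherent of finite type. -/
def IsCoherent {X : Scheme.{u}} (M : X.Modules) : Prop :=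
  M.IsQuasicoherent ∧ SheafOfModules.IsFiniteType M

variable {X Y Y' Y'' : Scheme.{u}}

/-- For an `X`-morphism `g : Y' ⟶ Y`, the canonical morphism `f^*F ⟶ g_* f'^*F` of `O_Y`-modules
(pull-back of sections along `g`): it corresponds by adjunction to the canonical morphism
`F ⟶ f'_* f'^*F = f_* g_* f'^*F`. -/
def transition (F : X.Modules) {f : Y ⟶ X} {f' : Y' ⟶ X} (g : Y' ⟶ Y) (w : g ≫ f = f') :
    (pullback f).obj F ⟶ (pushforward g).obj ((pullback f').obj F) :=
  ((pullbackPushforwardAdjunction f).homEquiv _ _).symm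
    ((pullbackPushforwardAdjunction f').unit.app F ≫
      (pushforwardCongr w.symm).hom.app _ ≫ (pushforwardComp g f).inv.app _)

lemma unit_transition (F : X.Modules) {f : Y ⟶ X} {f' : Y' ⟶ X} (g : Y' ⟶ Y) (w : g ≫ f = f') :
    (pullbackPushforwardAdjunction f).unit.app F ≫ (pushforward f).map (F.transition g w) =
    (pullbackPushforwardAdjunction f').unit.app F ≫
      (pushforwardCongr w.symm).hom.app _ ≫ (pushforwardComp g f).inv.app _ :=
  (Adjunction.homEquiv_unit ..).symm.trans (Equiv.apply_symm_apply _ _)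

lemma transition_app_unit (F : X.Modules) {f : Y ⟶ X} {f' : Y' ⟶ X} (g : Y' ⟶ Y)
    (w : g ≫ f = f') (U : X.Opens) (s : Γ(F, U)) :
    (F.transition g w).app (f ⁻¹ᵁ U) (((pullbackPushforwardAdjunction f).unit.app F).app U s) =
    ((pullback f').obj F).presheaf.map (eqToHom (by rw [← w]; rfl)).op
      (((pullbackPushforwardAdjunction f').unit.app F).app U s) :=
  congr($(unit_transition F g w).app U s)

lemma transition_ext {F : X.Modules} {f : Y ⟶ X} {G : Y.Modules} {a b : (pullback f).obj F ⟶ G}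
    (h : ∀ (U : X.Opens) (s : Γ(F, U)),
      a.app (f ⁻¹ᵁ U) (((pullbackPushforwardAdjunction f).unit.app F).app U s) =
        b.app (f ⁻¹ᵁ U) (((pullbackPushforwardAdjunction f).unit.app F).app U s)) : a = b := by
  apply ((pullbackPushforwardAdjunction f).homEquiv _ _).injective
  refine (Adjunction.homEquiv_unit ..).trans (Eq.trans ?_ (Adjunction.homEquiv_unit ..).symm)
  ext U s
  exact h U s

lemma transition_id (F : X.Modules) (f : Y ⟶ X) (w : 𝟙 Y ≫ f = f) :
    F.transition (𝟙 Y) w = (pushforwardId Y).inv.app _ := by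
  refine transition_ext fun U s ↦ (transition_app_unit ..).trans ?_
  exact congr($(((pullback f).obj F).presheaf.map_id _) _)

lemma transition_comp (F : X.Modules) {f : Y ⟶ X} {f' : Y' ⟶ X} {f'' : Y'' ⟶ X}
    (g : Y' ⟶ Y) (w : g ≫ f = f') (h : Y'' ⟶ Y') (w' : h ≫ f' = f'') (w'' : (h ≫ g) ≫ f = f'') :
    F.transition (h ≫ g) w'' =
      F.transition g w ≫ (pushforward g).map (F.transition h w') ≫
        (pushforwardComp h g).hom.app _ := by
  subst w
  refine transition_ext fun U s ↦ (transition_app_unit ..).trans ?_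
  change _ = (F.transition h w').app _ ((F.transition g rfl).app (f ⁻¹ᵁ U)
    (((pullbackPushforwardAdjunction f).unit.app F).app U s))
  rw [transition_app_unit]
  refine Eq.trans ?_ (congrArg ((F.transition h w').app _)
    (congr($(((pullback (g ≫ f)).obj F).presheaf.map_id _) _)).symm)
  exact (transition_app_unit F h w' U s).symm

instance sectionsModule (F : X.Modules) (Y : X.QcqsOverᵒᵖ) :
    Module (X.structureFunctor.obj Y) Γ((pullback Y.unop.obj.hom).obj F, ⊤) :=
  inferInstanceAs (Module Γ(Y.unop.obj.left, ⊤) Γ((pullback Y.unop.obj.hom).obj F, ⊤))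

/-- The functor `𝓕 : Y ↦ Γ(Y, f^*F)` on quasi-compact and quasi-separated `X`-schemes
`f : Y ⟶ X`, as an `𝒪_X`-module. -/
def toFunctor (F : X.Modules) :
    _root_.PresheafOfModules.{u} (X.structureFunctor ⋙ forget₂ CommRingCat RingCat) where
  obj Y := ModuleCat.of (X.structureFunctor.obj Y) Γ((pullback Y.unop.obj.hom).obj F, ⊤)
  map {Y Y'} g := ModuleCat.ofHom
      (Y := (ModuleCat.restrictScalars
          ((X.structureFunctor ⋙ forget₂ CommRingCat RingCat).map g).hom).obj
        (ModuleCat.of (X.structureFunctor.obj Y') Γ((pullback Y'.unop.obj.hom).obj F, ⊤)))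
    { toFun := fun s ↦ (F.transition g.unop.hom.left (Over.w g.unop.hom)).app ⊤ s
      map_add' := fun s t ↦ map_add _ s t
      map_smul' := fun r s ↦ Hom.app_smul _ r s }
  map_id Y := by
    ext s
    exact congr(($(transition_id F Y.unop.obj.hom (Over.w (𝟙 Y.unop.obj))).app ⊤) s)
  map_comp {Y Y' Y''} g h := by
    ext s
    exact congr(($(transition_comp F g.unop.hom.left (Over.w g.unop.hom) h.unop.hom.left
      (Over.w h.unop.hom) (Over.w (g ≫ h).unop.hom)).app ⊤) s)

end Modules

/-- An `𝒪_X`-module (with values in the universe in which internal homs live) is an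
`𝒪_X`-module variety if it is isomorphic to `𝒢^* = Hom(𝒢, 𝒪_X)` for a coherent `G`. -/
def IsModuleVariety {X : Scheme.{u}}
    (N : _root_.PresheafOfModules.{u + 1} (X.structureFunctor ⋙ forget₂ CommRingCat RingCat)) :
    Prop :=
  ∃ G : X.Modules, G.IsCoherent ∧ Nonempty (N ≅ G.toFunctor.dual)

/-- An `𝒪_X`-module `M` is a direct limit of `𝒪_X`-module varieties if it is the colimit, in the
category of `𝒪_X`-modules, of a direct system of `𝒪_X`-module varieties indexed by a (nonempty)
upward directed set. The values of `M` are lifted to the universe of the internal homs. -/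
def IsDirectLimitOfModuleVarieties {X : Scheme.{u}}
    (M : _root_.PresheafOfModules.{u} (X.structureFunctor ⋙ forget₂ CommRingCat RingCat)) :
    Prop :=
  ∃ (I : Type u) (_ : PartialOrder I) (_ : IsDirectedOrder I) (_ : Nonempty I)
    (D : I ⥤ _root_.PresheafOfModules.{u + 1}
      (X.structureFunctor ⋙ forget₂ CommRingCat RingCat))
    (c : Limits.Cocone D),
    (∀ i, IsModuleVariety (D.obj i)) ∧ Nonempty (Limits.IsColimit c) ∧
      Nonempty (c.pt ≅ _root_.PresheafOfModules.lift.{u, u + 1} M)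

end AlgebraicGeometry.Scheme

end

noncomputable section

lemma CategoryTheory.Adjunction.bijective_map_of_isIso_counit {C : Type*} [Category C] {D : Type*}
    [Category D] {F : C ⥤ D} {G : D ⥤ C} (adj : F ⊣ G) (A B : D) [IsIso (adj.counit.app A)] :
    Function.Bijective (G.map : (A ⟶ B) → (G.obj A ⟶ G.obj B)) := by
  have h : (G.map : (A ⟶ B) → (G.obj A ⟶ G.obj B)) =
      (adj.homEquiv _ _) ∘ (fun b ↦ adj.counit.app A ≫ b) := by
    ext b
    simp [adj.homEquiv_unit]
  rw [h]
  exact (adj.homEquiv _ _).bijective.comp ((asIso (adj.counit.app A)).homFromEquiv.symm.bijective)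

namespace AlgebraicGeometry.Scheme

/-- Restriction of functions, as a ring homomorphism. -/
def res (X : Scheme.{u}) {U V : X.Opens} (h : U ≤ V) : Γ(X, V) →+* Γ(X, U) :=
  (X.presheaf.map (homOfLE h).op).hom

section
variable {X Y : Scheme.{u}}

@[simp] lemma res_self {U : X.Opens} (h : U ≤ U) (r : Γ(X, U)) : X.res h r = r :=
  congr($(X.presheaf.map_id (.op U)) r)

@[simp] lemma res_res {U V W : X.Opens} (h : U ≤ V) (h' : V ≤ W) (r : Γ(X, W)) :
    X.res h (X.res h' r) = X.res (h.trans h') r :=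
  congr($(X.presheaf.map_comp (homOfLE h').op (homOfLE h).op) r).symm

end

namespace Modules
variable {X Y Y' Y'' : Scheme.{u}}

/-- Restriction of sections of a module. -/
def res (M : X.Modules) {U V : X.Opens} (h : U ≤ V) : Γ(M, V) →+ Γ(M, U) :=
  (M.presheaf.map (homOfLE h).op).hom

@[simp] lemma res_self (M : X.Modules) {U : X.Opens} (h : U ≤ U) (m : Γ(M, U)) : M.res h m = m :=
  congr($(M.presheaf.map_id (.op U)) m)

@[simp] lemma res_res (M : X.Modules) {U V W : X.Opens} (h : U ≤ V) (h' : V ≤ W) (m : Γ(M, W)) :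
    M.res h (M.res h' m) = M.res (h.trans h') m :=
  congr($(M.presheaf.map_comp (homOfLE h').op (homOfLE h).op) m).symm

lemma res_smul (M : X.Modules) {U V : X.Opens} (h : U ≤ V) (r : Γ(X, V)) (m : Γ(M, V)) :
    M.res h (r • m) = X.res h r • M.res h m :=
  map_smul M (homOfLE h) r m

lemma app_res {M N : X.Modules} (β : M ⟶ N) {U V : X.Opens} (h : U ≤ V) (m : Γ(M, V)) :
    β.app U (M.res h m) = N.res h (β.app V m) :=
  congr($(β.mapPresheaf.naturality (homOfLE h).op) m)

lemma pushforward_res (f : Y ⟶ X) (M : Y.Modules) {U V : X.Opens} (h : U ≤ V)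
    (m : Γ(M, f ⁻¹ᵁ V)) :
    ((pushforward f).obj M).res h m = M.res (f.preimage_mono h) m :=
  rfl

/-- The effect on sections of a morphism to a direct image. -/
def pushApp {M : X.Modules} {N : Y.Modules} {f : Y ⟶ X} (β : M ⟶ (pushforward f).obj N)
    (V : X.Opens) : Γ(M, V) →+ Γ(N, f ⁻¹ᵁ V) :=
  (β.app V).hom

lemma pushApp_res {M : X.Modules} {N : Y.Modules} {f : Y ⟶ X} (β : M ⟶ (pushforward f).obj N)
    {U V : X.Opens} (h : U ≤ V) (m : Γ(M, V)) :
    pushApp β U (M.res h m) = N.res (f.preimage_mono h) (pushApp β V m) :=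
  app_res β h m

lemma pushApp_smul {M : X.Modules} {N : Y.Modules} {f : Y ⟶ X} (β : M ⟶ (pushforward f).obj N)
    (V : X.Opens) (r : Γ(X, V)) (m : Γ(M, V)) :
    pushApp β V (r • m) = f.app V r • pushApp β V m :=
  Hom.app_smul β r m

/-- The unit `M ⟶ f_* f^* M`. -/
def toPush (M : X.Modules) (f : Y ⟶ X) : M ⟶ (pushforward f).obj ((pullback f).obj M) :=
  (pullbackPushforwardAdjunction f).unit.app M

/-- The identification of `(g ≫ f)_* K` with `f_* g_* K`. -/
def pushComp (g : Y' ⟶ Y) (f : Y ⟶ X) (K : Y'.Modules) :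
    (pushforward (g ≫ f)).obj K ≅ (pushforward f).obj ((pushforward g).obj K) :=
  ((pushforwardComp g f).app K).symm

/-- Pull-back of sections of `M` over `V` to sections of `f^*M` over `W`. -/
def pullSec (M : X.Modules) (f : Y ⟶ X) {V : X.Opens} {W : Y.Opens} (h : W ≤ f ⁻¹ᵁ V) :
    Γ(M, V) →ₛₗ[(f.appLE V W h).hom] Γ((pullback f).obj M, W) where
  toFun m := ((pullback f).obj M).res h (pushApp (M.toPush f) V m)
  map_add' _ _ := by rw [map_add, map_add]
  map_smul' r m := by rw [pushApp_smul, res_smul]; rfl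

lemma pullSec_apply (M : X.Modules) (f : Y ⟶ X) {V : X.Opens} {W : Y.Opens} (h : W ≤ f ⁻¹ᵁ V)
    (m : Γ(M, V)) : M.pullSec f h m =
      ((pullback f).obj M).res h (pushApp (M.toPush f) V m) :=
  rfl

@[simp] lemma res_pullSec (M : X.Modules) (f : Y ⟶ X) {V : X.Opens} {W W' : Y.Opens}
    (h : W ≤ f ⁻¹ᵁ V) (h' : W' ≤ W) (m : Γ(M, V)) :
    ((pullback f).obj M).res h' (M.pullSec f h m) = M.pullSec f (h'.trans h) m :=
  res_res _ _ _ _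

@[simp] lemma pullSec_res (M : X.Modules) (f : Y ⟶ X) {V V' : X.Opens} {W : Y.Opens} (h' : V' ≤ V)
    (h : W ≤ f ⁻¹ᵁ V') (m : Γ(M, V)) :
    M.pullSec f h (M.res h' m) = M.pullSec f (h.trans (f.preimage_mono h')) m := by
  rw [pullSec_apply, pushApp_res, res_res, pullSec_apply]

lemma transition_pullSec (F : X.Modules) {f : Y ⟶ X} {f' : Y' ⟶ X} (g : Y' ⟶ Y)
    (w : g ≫ f = f') {V : X.Opens} {W : Y.Opens} (h : W ≤ f ⁻¹ᵁ V) (m : Γ(F, V)) :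
    pushApp (F.transition g w) W (F.pullSec f h m) =
      F.pullSec f' (W := g ⁻¹ᵁ W) (by rw [← w]; exact g.preimage_mono h) m := by
  rw [pullSec_apply, pushApp_res]
  refine (congrArg _ (transition_app_unit F g w V m)).trans ?_
  exact res_res _ _ _ _

lemma bijective_moduleSpecΓ_map {R : CommRingCat.{u}} (A B : (Spec R).Modules)
    [A.IsQuasicoherent] :
    Function.Bijective ((moduleSpecΓFunctor (R := R)).map : (A ⟶ B) → _) :=
  haveI : IsIso ((tilde.adjunction (R := R)).counit.app A) :=
    Scheme.Modules.isIso_fromTildeΓ_of_isQuasicoherent A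
  (tilde.adjunction (R := R)).bijective_map_of_isIso_counit A B

/-- A homomorphism `M ⟶ j_* g_* K` with `j` the inclusion of an affine open `V`
is the same as a linear map on `Γ(M, V)`. -/
lemma bijective_homSpec (M : X.Modules) [M.IsQuasicoherent] {V : X.Opens} (hV : IsAffineOpen V)
    {S : CommRingCat.{u}} (φ : Γ(X, V) ⟶ S) (K : (Spec S).Modules) :
    Function.Bijective (fun (α : M ⟶ (pushforward (Spec.map φ ≫ hV.fromSpec)).obj K) ↦
      (moduleSpecΓFunctor.map (((restrictAdjunction hV.fromSpec).homEquiv _ _).symm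
        (α ≫ (pushComp (Spec.map φ) hV.fromSpec K).hom)))) := by
  refine (bijective_moduleSpecΓ_map (R := Γ(X, V)) _ _).comp
    (((restrictAdjunction hV.fromSpec).homEquiv _ _).symm.bijective.comp ?_)
  exact ((pushComp (Spec.map φ) hV.fromSpec K).homToEquiv).bijective

lemma restrictAdjunction_homEquiv_symm_app (j : Y ⟶ X) [IsOpenImmersion j] (M : X.Modules)
    (L : Y.Modules) (β : M ⟶ (pushforward j).obj L) (U : Y.Opens) :
    (((restrictAdjunction j).homEquiv M L).symm β).app U =
      β.app (j ''ᵁ U) ≫ L.presheaf.map (eqToHom (j.preimage_image_eq U).symm).op := by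
  rw [Adjunction.homEquiv_counit]
  rfl

lemma restrictAdjunction_homEquiv_symm_app_res (j : Y ⟶ X) [IsOpenImmersion j] (M : X.Modules)
    (L : Y.Modules) (β : M ⟶ (pushforward j).obj L) (U : Y.Opens) (V : X.Opens) (h : j ''ᵁ U ≤ V)
    (h' : U ≤ j ⁻¹ᵁ V) (m : Γ(M, V)) :
    (((restrictAdjunction j).homEquiv M L).symm β).app U (M.res h m) =
      L.res h' (pushApp β V m) := by
  rw [restrictAdjunction_homEquiv_symm_app]
  change L.res (j.preimage_image_eq U).ge (pushApp β (j ''ᵁ U) _) = _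
  rw [pushApp_res, res_res]

lemma pushApp_pushComp {M : X.Modules} {g : Y' ⟶ Y} {f : Y ⟶ X} {K : Y'.Modules}
    (α : M ⟶ (pushforward (g ≫ f)).obj K) (V : X.Opens) (m : Γ(M, V)) :
    pushApp (α ≫ (pushComp g f K).hom) V m = pushApp α V m :=
  rfl

lemma homSpec_apply (M : X.Modules) {V : X.Opens} (hV : IsAffineOpen V)
    {S : CommRingCat.{u}} (φ : Γ(X, V) ⟶ S) (K : (Spec S).Modules)
     (α : M ⟶ (pushforward (Spec.map φ ≫ hV.fromSpec)).obj K) (m : Γ(M, V)) :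
      (moduleSpecΓFunctor.map (((restrictAdjunction hV.fromSpec).homEquiv _ _).symm
        (α ≫ (pushComp (Spec.map φ) hV.fromSpec K).hom)))
        (M.res (by simp : hV.fromSpec ''ᵁ ⊤ ≤ V) m) =
        K.res (by simp) (pushApp α V m) := by
  have h1 := restrictAdjunction_homEquiv_symm_app_res hV.fromSpec M ((pushforward (Spec.map φ)).obj K)
     (α ≫ (pushComp (Spec.map φ) hV.fromSpec K).hom) ⊤ V (by simp) (by simp) m
  refine Eq.trans ?_ (h1.trans ?_)
  · rfl
  · refine (pushforward_res (Spec.map φ) K (U := ⊤) (V := hV.fromSpec ⁻¹ᵁ V) (by simp)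
      (pushApp (α ≫ (pushComp (Spec.map φ) hV.fromSpec K).hom) V m)).trans ?_
    rw [pushApp_pushComp]
    rfl
end Modules
end AlgebraicGeometry.Scheme

namespace AlgebraicGeometry.Scheme.Modules
variable {X Y Y' Y'' : Scheme.{u}}

lemma fromSpec_image_le {V : X.Opens} (hV : IsAffineOpen V) (U : (Spec Γ(X, V)).Opens) :
    hV.fromSpec ''ᵁ U ≤ V :=
  (hV.fromSpec.image_le_opensRange U).trans hV.opensRange_fromSpec.le

lemma le_fromSpec_preimage {V : X.Opens} (hV : IsAffineOpen V) (U : (Spec Γ(X, V)).Opens) :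
    U ≤ hV.fromSpec ⁻¹ᵁ V :=
  le_top.trans hV.fromSpec_preimage_self.ge

lemma fromSpec_appIso_inv {V : X.Opens} (hV : IsAffineOpen V) (U : (Spec Γ(X, V)).Opens)
    (r : Γ(X, V)) :
    (hV.fromSpec.appIso U).inv ((Spec Γ(X, V)).presheaf.map (homOfLE le_top).op
      ((Scheme.ΓSpecIso Γ(X, V)).inv r)) = X.res (fromSpec_image_le hV U) r := by
  have h := hV.fromSpec.appLE_appIso_inv (le_fromSpec_preimage hV U)
  rw [Scheme.Hom.appLE, hV.fromSpec_app_self] at h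
  exact congr($h r)

lemma smul_res_fromSpec (M : X.Modules) {V : X.Opens} (hV : IsAffineOpen V)
    (U : (Spec Γ(X, V)).Opens) (r : Γ(X, V)) (m : Γ(M, V)) :
    (r • (show Γ(M.restrict hV.fromSpec, U) from M.res (fromSpec_image_le hV U) m) :
      Γ(M.restrict hV.fromSpec, U)) = M.res (fromSpec_image_le hV U) (r • m) := by
  rw [res_smul, ← fromSpec_appIso_inv hV U r]
  rfl

lemma smul_pushforward_Spec {R S : CommRingCat.{u}} (φ : R ⟶ S) (K : (Spec S).Modules) (r : R)
    (x : Γ(K, ⊤)) :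
    (r • (show Γ((pushforward (Spec.map φ)).obj K, ⊤) from x) :
      Γ((pushforward (Spec.map φ)).obj K, ⊤)) = φ r • x := by
  rw [smul_Spec_def, smul_Spec_def]
  have h := congr((Spec S).presheaf.map (homOfLE (le_top : (⊤ : (Spec S).Opens) ≤ ⊤)).op
    ($(Scheme.ΓSpecIso_inv_naturality φ) r))
  have h' := congr($((Spec.map φ).naturality (homOfLE (le_top : (⊤ : (Spec R).Opens) ≤ ⊤)).op)
    ((Scheme.ΓSpecIso R).inv r))
  exact congrArg (fun s : Γ(Spec S, ⊤) ↦ s • x) (h'.trans h.symm)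

/-- The universal property of the pull-back of sections along a morphism of affine opens. -/
lemma existsUnique_restrict_pullback_hom (M : X.Modules) [M.IsQuasicoherent] (f : Y ⟶ X)
    {V : X.Opens} (hV : IsAffineOpen V) {W : Y.Opens} (hW : IsAffineOpen W) (h : W ≤ f ⁻¹ᵁ V)
    (K : (Spec Γ(Y, W)).Modules) (ψ : Γ(M, V) →ₛₗ[(f.appLE V W h).hom] Γ(K, ⊤)) :
    ∃! β : ((pullback f).obj M).restrict hW.fromSpec ⟶ K, ∀ m,
      β.app ⊤ (((pullback f).obj M).res (fromSpec_image_le hW ⊤) (M.pullSec f h m)) = ψ m := by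
  let φ := f.appLE V W h
  have hφ : hW.fromSpec ≫ f = Spec.map φ ≫ hV.fromSpec :=
    (IsAffineOpen.SpecMap_appLE_fromSpec f hV hW h).symm
  let P := (pullback f).obj M
  let e : (P.restrict hW.fromSpec ⟶ K) ≃ (M ⟶ (pushforward (Spec.map φ ≫ hV.fromSpec)).obj K) :=
    ((restrictAdjunction hW.fromSpec).homEquiv P K).trans
      (((pullbackPushforwardAdjunction f).homEquiv M _).trans
        ((pushComp hW.fromSpec f K).symm ≪≫ (pushforwardCongr hφ).app K).homToEquiv)
  have he (β) (m : Γ(M, V)) : K.res (by simp) (pushApp (e β) V m) =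
      β.app ⊤ (P.res (fromSpec_image_le hW ⊤) (M.pullSec f h m)) := by
    obtain ⟨γ, rfl⟩ := ((restrictAdjunction hW.fromSpec).homEquiv P K).symm.surjective β
    rw [pullSec_apply, res_res, restrictAdjunction_homEquiv_symm_app_res (h' := by
      exact (le_fromSpec_preimage hW ⊤).trans (hW.fromSpec.preimage_mono h))]
    have h1 : e (((restrictAdjunction hW.fromSpec).homEquiv P K).symm γ) =
        (M.toPush f ≫ (pushforward f).map γ) ≫ (pushComp hW.fromSpec f K).inv ≫
          (pushforwardCongr hφ).hom.app K := by
      simp only [e, Equiv.trans_apply, Equiv.apply_symm_apply]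
      rfl
    rw [h1]
    exact res_res K _ (congrArg (· ⁻¹ᵁ V) hφ).ge _
  have hle : V ≤ hV.fromSpec ''ᵁ ⊤ := by simp
  let ψ₀ : Γ(M.restrict hV.fromSpec, ⊤) →ₗ[Γ(X, V)] Γ((pushforward (Spec.map φ)).obj K, ⊤) :=
    { toFun n := ψ (M.res hle n)
      map_add' a b := (congrArg ψ (map_add (M.res hle) a b)).trans (map_add ψ _ _)
      map_smul' r n := by
        obtain ⟨m, rfl⟩ : ∃ m : Γ(M, V), M.res (fromSpec_image_le hV ⊤) m = n :=
          ⟨M.res hle n, (res_res ..).trans (res_self ..)⟩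
        refine Eq.trans ?_ (smul_pushforward_Spec φ K r _).symm
        refine (congrArg (ψ ∘ M.res hle) (smul_res_fromSpec M hV ⊤ r m)).trans ?_
        change ψ (M.res hle (M.res _ (r • m))) = _ • ψ (M.res hle (M.res _ m))
        rw [res_res, res_res, res_self, res_self, ψ.map_smulₛₗ] }
  let ψ' : moduleSpecΓFunctor.obj (M.restrict hV.fromSpec) ⟶
      moduleSpecΓFunctor.obj ((pushforward (Spec.map φ)).obj K) := ModuleCat.ofHom
        (X := Γ(M.restrict hV.fromSpec, ⊤)) (Y := Γ((pushforward (Spec.map φ)).obj K, ⊤)) ψ₀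
  have key := (bijective_homSpec M hV φ K).comp e.bijective
  have iff (β) : (∀ m, β.app ⊤ (P.res (fromSpec_image_le hW ⊤) (M.pullSec f h m)) = ψ m) ↔
      moduleSpecΓFunctor.map (((restrictAdjunction hV.fromSpec).homEquiv _ _).symm
        (e β ≫ (pushComp (Spec.map φ) hV.fromSpec K).hom)) = ψ' := by
    simp_rw [← he]
    constructor
    · intro H
      ext n
      obtain ⟨m, rfl⟩ : ∃ m : Γ(M, V), M.res (fromSpec_image_le hV ⊤) m = n :=
        ⟨M.res hle n, (res_res ..).trans (res_self ..)⟩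
      refine (homSpec_apply M hV φ K (e β) m).trans ((H m).trans ?_)
      exact congrArg ψ ((res_res ..).trans (res_self ..)).symm
    · intro H m
      refine (homSpec_apply M hV φ K (e β) m).symm.trans ?_
      refine (congr($H (M.res (fromSpec_image_le hV ⊤) m))).trans ?_
      exact congrArg ψ ((res_res ..).trans (res_self ..))
  obtain ⟨β, hβ, hβ'⟩ := key.existsUnique ψ'
  exact ⟨β, (iff β).2 hβ, fun β' h' ↦ hβ' _ ((iff β').1 h')⟩
end AlgebraicGeometry.Scheme.Modules

namespace AlgebraicGeometry.Scheme.Modules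
variable {X Y Y' Y'' : Scheme.{u}}

/-- The morphism `tilde T ⟶ K` attached to a linear map to the global sections of `K`. -/
def ofTilde {S : CommRingCat.{u}} {T : Type u} [AddCommGroup T] [Module S T]
    (K : (Spec S).Modules) (g : T →ₗ[S] Γ(K, ⊤)) : tilde (ModuleCat.of S T) ⟶ K :=
  ((tilde.adjunction (R := S)).homEquiv (ModuleCat.of S T) K).symm
    (ModuleCat.ofHom (Y := Γ(K, ⊤)) g)

/-- The elements of `T` as global sections of `tilde T`. -/
def toTilde (S : CommRingCat.{u}) (T : Type u) [AddCommGroup T] [Module S T] :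
    T ≃ₗ[S] Γ(tilde (ModuleCat.of S T), ⊤) :=
  (tilde.isoTop (ModuleCat.of S T)).toLinearEquiv

lemma ofTilde_toTilde {S : CommRingCat.{u}} {T : Type u} [AddCommGroup T] [Module S T]
    (K : (Spec S).Modules) (g : T →ₗ[S] Γ(K, ⊤)) (t : T) :
    (ofTilde K g).app ⊤ (toTilde S T t) = g t := by
  have h := ((tilde.adjunction (R := S)).homEquiv (ModuleCat.of S T) K).apply_symm_apply
    (ModuleCat.ofHom (Y := Γ(K, ⊤)) g)
  rw [Adjunction.homEquiv_unit] at h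
  exact congr($h t)

lemma tilde_hom_ext {S : CommRingCat.{u}} {T : Type u} [AddCommGroup T] [Module S T]
    {K : (Spec S).Modules} {a b : tilde (ModuleCat.of S T) ⟶ K}
    (h : ∀ t, a.app ⊤ (toTilde S T t) = b.app ⊤ (toTilde S T t)) : a = b := by
  apply ((tilde.adjunction (R := S)).homEquiv (ModuleCat.of S T) K).injective
  refine (Adjunction.homEquiv_unit ..).trans (Eq.trans ?_ (Adjunction.homEquiv_unit ..).symm)
  ext t
  exact h t

lemma app_smul_Spec {S : CommRingCat.{u}} {K L : (Spec S).Modules} (β : K ⟶ L)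
    (U : (Spec S).Opens) (s : S) (x : Γ(K, U)) : β.app U (s • x) = s • β.app U x :=
  Hom.app_smul β _ x

open TensorProduct in
lemma isBaseChange_pullSec (M : X.Modules) [M.IsQuasicoherent] (f : Y ⟶ X)
    {V : X.Opens} (hV : IsAffineOpen V) {W : Y.Opens} (hW : IsAffineOpen W) (h : W ≤ f ⁻¹ᵁ V)
    [Algebra Γ(X, V) Γ(Y, W)] [Module Γ(X, V) Γ((pullback f).obj M, W)]
    [IsScalarTower Γ(X, V) Γ(Y, W) Γ((pullback f).obj M, W)]
    (halg : algebraMap Γ(X, V) Γ(Y, W) = (f.appLE V W h).hom)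
    (u : Γ(M, V) →ₗ[Γ(X, V)] Γ((pullback f).obj M, W)) (hu : ∀ m, u m = M.pullSec f h m) :
    IsBaseChange Γ(Y, W) u := by
  let e : Γ(Y, W) ⊗[Γ(X, V)] Γ(M, V) →ₗ[Γ(Y, W)] Γ((pullback f).obj M, W) := u.liftBaseChange _
  let P := (pullback f).obj M
  let T := Γ(Y, W) ⊗[Γ(X, V)] Γ(M, V)
  let g : T →ₗ[Γ(Y, W)] Γ(P.restrict hW.fromSpec, ⊤) :=
    { toFun t := P.res (fromSpec_image_le hW ⊤) (e t)
      map_add' a b := (congrArg _ (map_add e a b)).trans (map_add _ _ _)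
      map_smul' s t := by
        rw [map_smulₛₗ]
        exact (smul_res_fromSpec P hW ⊤ s (e t)).symm }
  let ψ : Γ(M, V) →ₛₗ[(f.appLE V W h).hom] Γ(tilde (ModuleCat.of Γ(Y, W) T), ⊤) :=
    { toFun m := toTilde Γ(Y, W) T (1 ⊗ₜ m)
      map_add' a b := by rw [tmul_add, map_add]
      map_smul' r m := by
        rw [← halg, ← LinearEquiv.map_smul, ← smul_tmul, Algebra.smul_def, smul_tmul']
        rfl }
  obtain ⟨β, hβ, -⟩ := existsUnique_restrict_pullback_hom M f hV hW h _ ψ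
  have h1 : β ≫ ofTilde (P.restrict hW.fromSpec) g = 𝟙 _ := by
    let ψ' : Γ(M, V) →ₛₗ[(f.appLE V W h).hom] Γ(P.restrict hW.fromSpec, ⊤) :=
      { toFun m := P.res (fromSpec_image_le hW ⊤) (M.pullSec f h m)
        map_add' a b := by rw [map_add, map_add]; rfl
        map_smul' r m := by
          rw [map_smulₛₗ]
          exact (smul_res_fromSpec P hW ⊤ _ _).symm }
    refine (existsUnique_restrict_pullback_hom M f hV hW h _ ψ').unique (fun m ↦ ?_) fun m ↦ rfl
    refine (congrArg ((ofTilde (P.restrict hW.fromSpec) g).app ⊤) (hβ m)).trans ?_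
    refine (ofTilde_toTilde (P.restrict hW.fromSpec) g _).trans ?_
    change P.res _ (e (1 ⊗ₜ m)) = P.res _ _
    simp [e, hu]
  have h2 : ofTilde (P.restrict hW.fromSpec) g ≫ β = 𝟙 _ := by
    refine tilde_hom_ext fun t ↦ ?_
    change β.app ⊤ ((ofTilde (P.restrict hW.fromSpec) g).app ⊤ _) = toTilde _ _ t
    rw [ofTilde_toTilde]
    refine TensorProduct.induction_on t ?_ (fun s m ↦ ?_) fun x y hx hy ↦ ?_
    · rw [map_zero, map_zero, map_zero]
    · have : g (s ⊗ₜ m) = s • (show Γ(P.restrict hW.fromSpec, ⊤) from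
          P.res (fromSpec_image_le hW ⊤) (M.pullSec f h m)) := by
        rw [smul_res_fromSpec, ← hu]
        rfl
      rw [this, app_smul_Spec, hβ]
      refine ((toTilde Γ(Y, W) T).map_smul s (1 ⊗ₜ m)).symm.trans ?_
      rw [smul_tmul']
      simp
    · rw [map_add, map_add, hx, hy, map_add]
  have h3 : IsIso (ofTilde (P.restrict hW.fromSpec) g) := ⟨β, h2, h1⟩
  have h4 : Function.Bijective ((ofTilde (P.restrict hW.fromSpec) g).app ⊤) :=
    ConcreteCategory.bijective_of_isIso _
  have h5 := h4.comp (toTilde Γ(Y, W) T).bijective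
  have h6 : ∀ t, g t = P.res (fromSpec_image_le hW ⊤) (e t) := fun t ↦ rfl
  have h7 : Function.Bijective g := by
    convert h5 using 1
    ext t
    exact (ofTilde_toTilde (P.restrict hW.fromSpec) g t).symm
  have hle : W ≤ hW.fromSpec ''ᵁ ⊤ := by simp
  have h8 : Function.Bijective e := by
    constructor
    · intro a b hab
      exact h7.1 (congrArg (P.res (fromSpec_image_le hW ⊤)) hab)
    · intro p
      obtain ⟨t, ht⟩ := h7.2 (P.res (fromSpec_image_le hW ⊤) p)
      refine ⟨t, ?_⟩
      have := congrArg (P.res hle) ht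
      rw [h6] at this
      refine Eq.trans ?_ (this.trans ?_)
      · exact (res_self P le_rfl _).symm.trans (res_res ..).symm
      · exact (res_res ..).trans (res_self ..)
  exact IsBaseChange.of_equiv (LinearEquiv.ofBijective e h8) fun m ↦ by simp [e]

end AlgebraicGeometry.Scheme.Modules

namespace AlgebraicGeometry.Scheme.Modules
variable {X Y Y' Y'' : Scheme.{u}}

instance isIso_toPush_id (M : X.Modules) : IsIso (M.toPush (𝟙 X)) := by
  have : (pushforward (𝟙 X)).IsEquivalence := Functor.isEquivalence_of_iso (pushforwardId X).symm
  exact (inferInstance : IsIso ((pullbackPushforwardAdjunction (𝟙 X)).unit.app M))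

lemma bijective_pushApp_toPush_id (M : X.Modules) (W : X.Opens) :
    Function.Bijective (pushApp (M.toPush (𝟙 X)) W) :=
  ConcreteCategory.bijective_of_isIso ((M.toPush (𝟙 X)).app W)

lemma isBaseChange_res (M : X.Modules) [M.IsQuasicoherent]
    {V W : X.Opens} (hV : IsAffineOpen V) (hW : IsAffineOpen W) (h : W ≤ V)
    [Algebra Γ(X, V) Γ(X, W)] [Module Γ(X, V) Γ(M, W)]
    [IsScalarTower Γ(X, V) Γ(X, W) Γ(M, W)]
    (halg : algebraMap Γ(X, V) Γ(X, W) = X.res h)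
    (u : Γ(M, V) →ₗ[Γ(X, V)] Γ(M, W)) (hu : ∀ m, u m = M.res h m) :
    IsBaseChange Γ(X, W) u := by
  let P := (pullback (𝟙 X)).obj M
  let : Module Γ(X, V) Γ(P, W) := Module.compHom _ (algebraMap Γ(X, V) Γ(X, W))
  have : IsScalarTower Γ(X, V) Γ(X, W) Γ(P, W) :=
    ⟨fun a b x ↦ by rw [Algebra.smul_def, mul_smul]; rfl⟩
  let ε₀ : Γ(M, W) →+ Γ(P, W) := pushApp (M.toPush (𝟙 X)) W
  let ε₁ : Γ(M, W) →ₗ[Γ(X, W)] Γ(P, W) :=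
    { toFun := ε₀
      map_add' a b := map_add ε₀ a b
      map_smul' r m := (pushApp_smul (M.toPush (𝟙 X)) W r m).trans
        (congrArg (fun s : Γ(X, W) ↦ s • ε₀ m) (congr($(Scheme.Hom.id_app W) r))) }
  let ε := LinearEquiv.ofBijective ε₁ (bijective_pushApp_toPush_id M W)
  have hb := isBaseChange_pullSec M (𝟙 X) hV hW (W := W) h (by
      rw [halg]
      simp [Scheme.Hom.appLE]
      rfl) ((ε.restrictScalars Γ(X, V)).toLinearMap ∘ₗ u) (fun m ↦ by
        refine (congrArg ε₀ (hu m)).trans ?_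
        exact pushApp_res (M.toPush (𝟙 X)) h m)
  refine IsBaseChange.of_equiv (hb.equiv.trans ε.symm) fun m ↦ ?_
  rw [LinearEquiv.trans_apply, hb.equiv_tmul, one_smul]
  exact ε.symm_apply_apply _

section
variable (M : X.Modules) [M.IsQuasicoherent] {V : X.Opens} (hV : IsAffineOpen V)
include hV

lemma isLocalizedModule_res_basicOpen (b : Γ(X, V)) [Algebra Γ(X, V) Γ(X, X.basicOpen b)]
    [Module Γ(X, V) Γ(M, X.basicOpen b)]
    [IsScalarTower Γ(X, V) Γ(X, X.basicOpen b) Γ(M, X.basicOpen b)]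
    (halg : algebraMap Γ(X, V) Γ(X, X.basicOpen b) = X.res (X.basicOpen_le b))
    (u : Γ(M, V) →ₗ[Γ(X, V)] Γ(M, X.basicOpen b)) (hu : ∀ m, u m = M.res (X.basicOpen_le b) m) :
    IsLocalizedModule (.powers b) u := by
  have : IsLocalization (.powers b) Γ(X, X.basicOpen b) := by
    have h := hV.isLocalization_basicOpen b
    convert h
    refine Algebra.algebra_ext _ _ fun r ↦ ?_
    exact congr($halg r)
  exact (isLocalizedModule_iff_isBaseChange (.powers b) Γ(X, X.basicOpen b) u).2
    (isBaseChange_res M hV (hV.basicOpen b) _ halg u hu)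

lemma isLocalizedModule_aux (b : Γ(X, V)) :
    letI := (X.res (X.basicOpen_le b)).toAlgebra
    letI : Module Γ(X, V) Γ(M, X.basicOpen b) := Module.compHom _ (X.res (X.basicOpen_le b))
    let u : Γ(M, V) →ₗ[Γ(X, V)] Γ(M, X.basicOpen b) :=
      { toFun := M.res (X.basicOpen_le b)
        map_add' := map_add _
        map_smul' r m := res_smul M _ r m }
    IsLocalizedModule (.powers b) u := by
  let := (X.res (X.basicOpen_le b)).toAlgebra
  let : Module Γ(X, V) Γ(M, X.basicOpen b) := Module.compHom _ (X.res (X.basicOpen_le b))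
  have : IsScalarTower Γ(X, V) Γ(X, X.basicOpen b) Γ(M, X.basicOpen b) :=
    ⟨fun a b x ↦ by rw [Algebra.smul_def, mul_smul]; rfl⟩
  exact isLocalizedModule_res_basicOpen M hV b rfl _ fun _ ↦ rfl

lemma exists_res_eq_pow_smul (b : Γ(X, V)) (s : Γ(M, X.basicOpen b)) :
    ∃ (n : ℕ) (m : Γ(M, V)),
      M.res (X.basicOpen_le b) m = X.res (X.basicOpen_le b) b ^ n • s := by
  have H := isLocalizedModule_aux M hV b
  obtain ⟨⟨m, ⟨_, n, rfl⟩⟩, h⟩ := H.surj s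
  refine ⟨n, m, h.symm.trans ?_⟩
  rw [← map_pow]
  rfl

lemma exists_pow_smul_eq_zero (b : Γ(X, V)) (m : Γ(M, V)) (hm : M.res (X.basicOpen_le b) m = 0) :
    ∃ n : ℕ, b ^ n • m = 0 := by
  have H := isLocalizedModule_aux M hV b
  obtain ⟨⟨_, n, rfl⟩, h⟩ := H.exists_of_eq (x₁ := m) (x₂ := 0) (hm.trans (map_zero _).symm)
  exact ⟨n, h.trans (smul_zero _)⟩

end

/-- The germ of a section, in the stalk. -/
def germ (M : X.Modules) {V : X.Opens} {x : X} (hx : x ∈ V) :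
    Γ(M, V) →+ TopCat.Presheaf.stalk (C := Ab.{u}) M.presheaf x :=
  (TopCat.Presheaf.germ (C := Ab.{u}) M.presheaf V x hx).hom

lemma germ_smul (M : X.Modules) {V : X.Opens} {x : X} (hx : x ∈ V) (r : Γ(X, V)) (m : Γ(M, V)) :
    M.germ hx (r • m) = X.presheaf.germ V x hx r • M.germ hx m :=
  letI N : _root_.PresheafOfModules.{u} (X.presheaf ⋙ forget₂ CommRingCat RingCat) := M.val
  PresheafOfModules.germ_smul N x V hx r m

lemma germ_res (M : X.Modules) {V W : X.Opens} {x : X} (hx : x ∈ W) (h : W ≤ V) (m : Γ(M, V)) :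
    M.germ hx (M.res h m) = M.germ (h hx) m :=
  TopCat.Presheaf.germ_res_apply (C := Ab.{u}) M.presheaf (homOfLE h) x hx m

lemma exists_germ_eq (M : X.Modules) {x : X}
    (s : TopCat.Presheaf.stalk (C := Ab.{u}) M.presheaf x) :
    ∃ (V : X.Opens) (hx : x ∈ V) (m : Γ(M, V)), M.germ hx m = s :=
  TopCat.Presheaf.exists_germ_eq (C := Ab.{u}) M.presheaf s

lemma exists_res_eq_of_germ_eq (M : X.Modules) {V : X.Opens} {x : X} (hx : x ∈ V) (m n : Γ(M, V))
    (h : M.germ hx m = M.germ hx n) :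
    ∃ (W : X.Opens) (hW : W ≤ V), x ∈ W ∧ M.res hW m = M.res hW n := by
  obtain ⟨W, hxW, i, j, e⟩ :=
    TopCat.Presheaf.germ_eq (C := Ab.{u}) M.presheaf x hx hx m n h
  exact ⟨W, i.le, hxW, e⟩

section
variable (M : X.Modules) [M.IsQuasicoherent] {V : X.Opens} (hV : IsAffineOpen V)

lemma isLocalizedModule_germ {x : X} (hx : x ∈ V) [Algebra Γ(X, V) (X.presheaf.stalk x)]
    [Module Γ(X, V) (TopCat.Presheaf.stalk (C := Ab.{u}) M.presheaf x)]
    [IsScalarTower Γ(X, V) (X.presheaf.stalk x)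
      (TopCat.Presheaf.stalk (C := Ab.{u}) M.presheaf x)]
    (halg : algebraMap Γ(X, V) (X.presheaf.stalk x) = (X.presheaf.germ V x hx).hom)
    (u : Γ(M, V) →ₗ[Γ(X, V)] TopCat.Presheaf.stalk (C := Ab.{u}) M.presheaf x)
    (hu : ∀ m, u m = M.germ hx m) :
    IsLocalization.AtPrime (X.presheaf.stalk x) (hV.primeIdealOf ⟨x, hx⟩).asIdeal ∧
    IsLocalizedModule (hV.primeIdealOf ⟨x, hx⟩).asIdeal.primeCompl u := by
  have hloc : IsLocalization.AtPrime (X.presheaf.stalk x) (hV.primeIdealOf ⟨x, hx⟩).asIdeal := by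
    have h := hV.isLocalization_stalk ⟨x, hx⟩
    convert h
    refine Algebra.algebra_ext _ _ fun r ↦ ?_
    exact congr($halg r)
  have hmem (b : Γ(X, V)) :
      b ∈ (hV.primeIdealOf ⟨x, hx⟩).asIdeal.primeCompl ↔ x ∈ X.basicOpen b := by
    rw [← IsLocalization.AtPrime.isUnit_to_map_iff (X.presheaf.stalk x)
      (hV.primeIdealOf ⟨x, hx⟩).asIdeal b, halg]
    exact (X.mem_basicOpen b x hx).symm
  have hsmul (r : Γ(X, V)) (s : TopCat.Presheaf.stalk (C := Ab.{u}) M.presheaf x) :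
      r • s = X.presheaf.germ V x hx r • s := by
    rw [← one_smul (X.presheaf.stalk x) s, ← smul_assoc, Algebra.smul_def, halg, mul_one, one_smul]
  refine ⟨hloc, ?_⟩
  refine ⟨fun s ↦ ?_, fun s ↦ ?_, fun {m n} h ↦ ?_⟩
  · obtain ⟨t, ht⟩ := IsLocalization.map_units (X.presheaf.stalk x) s
    rw [Module.End.isUnit_iff]
    have : ⇑(algebraMap Γ(X, V) (Module.End Γ(X, V)
        (TopCat.Presheaf.stalk (C := Ab.{u}) M.presheaf x)) s) = fun a ↦ t • a := by
      ext a
      refine (hsmul s a).trans ?_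
      exact congrArg (fun r : X.presheaf.stalk x ↦ r • a) (ht.trans congr($halg s)).symm
    rw [this]
    exact MulAction.bijective t
  · obtain ⟨W, hx', m, rfl⟩ := M.exists_germ_eq s
    obtain ⟨b, hb, hxb⟩ := hV.exists_basicOpen_le (V := W) ⟨x, hx'⟩ hx
    obtain ⟨n, m', h⟩ := exists_res_eq_pow_smul M hV b (M.res hb m)
    refine ⟨⟨m', ⟨b ^ n, pow_mem ((hmem b).2 hxb) n⟩⟩, ?_⟩
    have := congrArg (M.germ hxb) h
    rw [germ_res, germ_smul, germ_res, ← map_pow] at this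
    refine Eq.trans (hsmul _ _) (Eq.trans ?_ (this.symm.trans (hu m').symm))
    refine congrArg (fun r : X.presheaf.stalk x ↦ r • M.germ _ m) ?_
    exact (X.presheaf.germ_res_apply (homOfLE (X.basicOpen_le b)) x hxb (b ^ n)).symm
  · rw [hu, hu] at h
    obtain ⟨W, hW, hx', e⟩ := M.exists_res_eq_of_germ_eq hx m n h
    obtain ⟨b, hb, hxb⟩ := hV.exists_basicOpen_le (V := W) ⟨x, hx'⟩ hx
    obtain ⟨k, hk⟩ := exists_pow_smul_eq_zero M hV b (m - n) (by
      have := congrArg (M.res hb) e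
      rw [res_res, res_res] at this
      rw [map_sub, this, sub_self])
    refine ⟨⟨b ^ k, pow_mem ((hmem b).2 hxb) k⟩, ?_⟩
    rw [smul_sub, sub_eq_zero] at hk
    exact hk

include hV in
lemma IsFlat.flat {M : X.Modules} [M.IsQuasicoherent] (H : M.IsFlat) :
    Module.Flat Γ(X, V) Γ(M, V) := by
  refine Module.flat_of_localized_maximal _ fun P hP ↦ ?_
  obtain ⟨x, hx, rfl⟩ : ∃ (x : X) (hx : x ∈ V), (hV.primeIdealOf ⟨x, hx⟩).asIdeal = P := by
    have hx : hV.fromSpec ⟨P, hP.isPrime⟩ ∈ V := hV.range_fromSpec.le ⟨_, rfl⟩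
    refine ⟨_, hx, ?_⟩
    rw [hV.fromSpec.isOpenEmbedding.injective (hV.fromSpec_primeIdealOf ⟨_, hx⟩)]
  let : Algebra Γ(X, V) (X.presheaf.stalk x) := (X.presheaf.germ V x hx).hom.toAlgebra
  let : Module Γ(X, V) (TopCat.Presheaf.stalk (C := Ab.{u}) M.presheaf x) :=
    Module.compHom _ (X.presheaf.germ V x hx).hom
  have : IsScalarTower Γ(X, V) (X.presheaf.stalk x)
      (TopCat.Presheaf.stalk (C := Ab.{u}) M.presheaf x) :=
    ⟨fun a b x ↦ by rw [Algebra.smul_def, mul_smul]; rfl⟩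
  let u : Γ(M, V) →ₗ[Γ(X, V)] TopCat.Presheaf.stalk (C := Ab.{u}) M.presheaf x :=
    { toFun := M.germ hx
      map_add' := map_add _
      map_smul' r m := germ_smul M hx r m }
  obtain ⟨h1, h2⟩ := isLocalizedModule_germ M hV hx rfl u (fun _ ↦ rfl)
  have := (Module.flat_iff_of_isLocalization (X.presheaf.stalk x)
    (hV.primeIdealOf ⟨x, hx⟩).asIdeal.primeCompl
    (TopCat.Presheaf.stalk (C := Ab.{u}) M.presheaf x)).1 (H x)
  exact Module.Flat.of_linearEquiv
    (IsLocalizedModule.iso (hV.primeIdealOf ⟨x, hx⟩).asIdeal.primeCompl u)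

lemma isFlat_of_flat {M : X.Modules} [M.IsQuasicoherent]
    (H : ∀ V : X.Opens, IsAffineOpen V → Module.Flat Γ(X, V) Γ(M, V)) : M.IsFlat := by
  intro x
  obtain ⟨V, hV, hx, -⟩ := exists_isAffineOpen_mem_and_subset (X := X) (U := ⊤) (x := x) trivial
  let : Algebra Γ(X, V) (X.presheaf.stalk x) := (X.presheaf.germ V x hx).hom.toAlgebra
  let : Module Γ(X, V) (TopCat.Presheaf.stalk (C := Ab.{u}) M.presheaf x) :=
    Module.compHom _ (X.presheaf.germ V x hx).hom
  have : IsScalarTower Γ(X, V) (X.presheaf.stalk x)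
      (TopCat.Presheaf.stalk (C := Ab.{u}) M.presheaf x) :=
    ⟨fun a b x ↦ by rw [Algebra.smul_def, mul_smul]; rfl⟩
  let u : Γ(M, V) →ₗ[Γ(X, V)] TopCat.Presheaf.stalk (C := Ab.{u}) M.presheaf x :=
    { toFun := M.germ hx
      map_add' := map_add _
      map_smul' r m := germ_smul M hx r m }
  obtain ⟨h1, h2⟩ := isLocalizedModule_germ M hV hx rfl u (fun _ ↦ rfl)
  have := H V hV
  exact Module.Flat.of_isLocalizedModule (X.presheaf.stalk x)
    (hV.primeIdealOf ⟨x, hx⟩).asIdeal.primeCompl u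

end

end AlgebraicGeometry.Scheme.Modules

namespace PresheafOfModules
open Limits
variable {C : Type w} [Category.{w'} C] {R : Cᵒᵖ ⥤ RingCat.{u}} {I : Type v} [Category.{v} I]
  [IsFiltered I] {D : I ⥤ PresheafOfModules.{v + 1} R} {c : Cocone D}

/-- The filtered colimits of presheaves of modules are computed pointwise. -/
def isColimitEvaluation (hc : IsColimit c) (Y : Cᵒᵖ) :
    IsColimit ((toPresheaf R ⋙ (CategoryTheory.evaluation Cᵒᵖ Ab).obj Y).mapCocone
      (c.whisker (AsSmall.equiv.{v, v, v + 1} (C := I)).inverse)) :=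
  isColimitOfPreserves _ (hc.whiskerEquivalence (AsSmall.equiv (C := I)).symm)

instance isFiltered_asSmall : IsFiltered (AsSmall.{v + 1} I) :=
  IsFiltered.of_equivalence AsSmall.equiv

lemma exists_app_eq_of_isColimit (hc : IsColimit c) (Y : Cᵒᵖ) (x : c.pt.obj Y) :
    ∃ (i : I) (a : (D.obj i).obj Y), (c.ι.app i).app Y a = x := by
  obtain ⟨i, a, h⟩ := Concrete.isColimit_exists_rep _ (isColimitEvaluation hc Y) x
  exact ⟨_, a, h⟩

lemma exists_map_eq_zero_of_isColimit (hc : IsColimit c) (Y : Cᵒᵖ) {i : I}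
    (a : (D.obj i).obj Y) (ha : (c.ι.app i).app Y a = 0) :
    ∃ (j : I) (f : i ⟶ j), (D.map f).app Y a = 0 := by
  obtain ⟨j, f, g, h⟩ := Concrete.isColimit_exists_of_rep_eq (i := AsSmall.up.obj i)
    (j := AsSmall.up.obj i) _ (isColimitEvaluation hc Y) a 0
    (ha.trans (map_zero ((c.ι.app i).app Y).hom).symm)
  exact ⟨_, AsSmall.down.map f, h.trans (map_zero ((D.map (AsSmall.down.map g)).app Y).hom)⟩

lemma injective_map_of_isColimit (hc : IsColimit c) {Y Y' : Cᵒᵖ} (g : Y ⟶ Y')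
    (h : ∀ i, Function.Injective ((D.obj i).map g)) : Function.Injective (c.pt.map g) := by
  rw [injective_iff_map_eq_zero (c.pt.map g).hom]
  intro x hx
  obtain ⟨i, a, rfl⟩ := exists_app_eq_of_isColimit hc Y x
  obtain ⟨j, f, hj⟩ := exists_map_eq_zero_of_isColimit hc Y' ((D.obj i).map g a)
    ((naturality_apply (c.ι.app i) g a).trans hx)
  have h0 : (D.map f).app Y a = 0 := by
    refine h j (Eq.trans ?_ (map_zero ((D.obj j).map g).hom).symm)
    exact (naturality_apply (D.map f) g a).symm.trans hj
  rw [← c.w f]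
  exact (congrArg ((c.ι.app j).app Y) h0).trans (map_zero ((c.ι.app j).app Y).hom)

lemma injective_map_of_iso {M N : PresheafOfModules.{v} R} (e : M ≅ N) {Y Y' : Cᵒᵖ} (g : Y ⟶ Y')
    (h : Function.Injective (M.map g)) : Function.Injective (N.map g) := by
  have he (Y) (x : N.obj Y) : e.hom.app Y (e.inv.app Y x) = x := congr(($(e.inv_hom_id).app Y) x)
  intro x y hxy
  rw [← he Y x, ← he Y y]
  congr 1
  apply h
  refine (naturality_apply e.inv g x).symm.trans (Eq.trans ?_ (naturality_apply e.inv g y))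
  exact congrArg _ hxy

end PresheafOfModules

open TensorProduct in
/-- Flatness of `N` can be checked on injections of algebras containing the ideals of the base as
direct summands. -/
lemma Module.Flat.of_forall_ideal {R : Type u} [CommRing R] {N : Type v} [AddCommGroup N]
    [Module R N]
    (H : ∀ I : Ideal R, ∃ (A A' : Type u) (_ : AddCommGroup A) (_ : AddCommGroup A')
      (_ : Module R A) (_ : Module R A') (i : I →ₗ[R] A) (r : A →ₗ[R] I) (j : R →ₗ[R] A')
      (ρ : A →ₗ[R] A'), r ∘ₗ i = .id ∧ ρ ∘ₗ i = j ∘ₗ I.subtype ∧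
        Function.Injective (ρ.rTensor N)) : Module.Flat R N := by
  rw [Module.Flat.iff_rTensor_injective]
  intro I _
  obtain ⟨A, A', _, _, _, _, i, r, j, ρ, h1, h2, h3⟩ := H I
  have h4 : Function.Injective (i.rTensor N) := by
    refine Function.LeftInverse.injective (g := r.rTensor N) fun x ↦ ?_
    rw [← LinearMap.comp_apply, ← LinearMap.rTensor_comp, h1, LinearMap.rTensor_id,
      LinearMap.id_apply]
  have h5 : Function.Injective (j.rTensor N ∘ I.subtype.rTensor N) := by
    rw [← LinearMap.coe_comp, ← LinearMap.rTensor_comp, ← h2, LinearMap.rTensor_comp,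
      LinearMap.coe_comp]
    exact h3.comp h4
  exact h5.of_comp

namespace AlgebraicGeometry.Scheme

section
variable {X : Scheme.{u}} {ι : Type w} {V : X.Opens} (W : ι → X.Opens) (hW : ∀ i, W i ≤ V)
  (hV : V ≤ ⨆ i, W i)
include hV

lemma eq_of_res_eq (s t : Γ(X, V)) (h : ∀ i, X.res (hW i) s = X.res (hW i) t) : s = t :=
  X.sheaf.eq_of_locally_eq' W V (fun i ↦ homOfLE (hW i)) hV s t h

lemma exists_res_eq (s : ∀ i, Γ(X, W i))
    (h : ∀ i j, X.res (inf_le_left : W i ⊓ W j ≤ W i) (s i) = X.res inf_le_right (s j)) :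
    ∃ t : Γ(X, V), ∀ i, X.res (hW i) t = s i := by
  obtain ⟨t, ht, -⟩ := X.sheaf.existsUnique_gluing' W V (fun i ↦ homOfLE (hW i)) hV s h
  exact ⟨t, ht⟩

lemma Modules.eq_of_res_eq (M : X.Modules) (s t : Γ(M, V))
    (h : ∀ i, M.res (hW i) s = M.res (hW i) t) : s = t :=
  TopCat.Sheaf.eq_of_locally_eq' ⟨M.presheaf, M.isSheaf⟩ W V (fun i ↦ homOfLE (hW i)) hV s t h

lemma Modules.exists_res_eq (M : X.Modules) (s : ∀ i, Γ(M, W i))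
    (h : ∀ i j, M.res (inf_le_left : W i ⊓ W j ≤ W i) (s i) = M.res inf_le_right (s j)) :
    ∃ t : Γ(M, V), ∀ i, M.res (hW i) t = s i := by
  obtain ⟨t, ht, -⟩ := TopCat.Sheaf.existsUnique_gluing' ⟨M.presheaf, M.isSheaf⟩ W V
    (fun i ↦ homOfLE (hW i)) hV s h
  exact ⟨t, ht⟩
end

/-- The object of `QcqsOver X` given by a morphism to `X`. -/
def QcqsOver.of {X Y : Scheme.{u}} (f : Y ⟶ X) [CompactSpace Y] [QuasiSeparatedSpace Y] :
    X.QcqsOver :=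
  ⟨Over.mk f, ‹_›, ‹_›⟩

/-- The morphism of `QcqsOver X` given by a morphism over `X`. -/
def QcqsOver.ofHom {X : Scheme.{u}} {Y Z : X.QcqsOver} (g : Y.obj.left ⟶ Z.obj.left)
    (w : g ≫ Z.obj.hom = Y.obj.hom) : Y ⟶ Z :=
  ObjectProperty.homMk (Over.homMk g w)

namespace Modules
variable {X Y Y' Y'' : Scheme.{u}}

lemma toFunctor_map_pullSec (F : X.Modules) {Y Z : X.QcqsOver} (g : Y ⟶ Z) {V : X.Opens}
    (h : ⊤ ≤ Z.obj.hom ⁻¹ᵁ V) (h' : ⊤ ≤ Y.obj.hom ⁻¹ᵁ V) (m : Γ(F, V)) :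
    F.toFunctor.map g.op (F.pullSec Z.obj.hom h m) = F.pullSec Y.obj.hom h' m :=
  transition_pullSec F g.hom.left (Over.w g.hom) h m

lemma span_range_pullSec (M : X.Modules) [M.IsQuasicoherent] (f : Y ⟶ X)
    {V : X.Opens} (hV : IsAffineOpen V) {W : Y.Opens} (hW : IsAffineOpen W) (h : W ≤ f ⁻¹ᵁ V) :
    Submodule.span Γ(Y, W) (Set.range (M.pullSec f h)) = ⊤ := by
  let : Algebra Γ(X, V) Γ(Y, W) := (f.appLE V W h).hom.toAlgebra
  let : Module Γ(X, V) Γ((pullback f).obj M, W) := Module.compHom _ (f.appLE V W h).hom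
  have : IsScalarTower Γ(X, V) Γ(Y, W) Γ((pullback f).obj M, W) :=
    ⟨fun a b x ↦ by rw [Algebra.smul_def, mul_smul]; rfl⟩
  let u : Γ(M, V) →ₗ[Γ(X, V)] Γ((pullback f).obj M, W) :=
    { toFun := M.pullSec f h
      map_add' := map_add _
      map_smul' := map_smulₛₗ (M.pullSec f h) }
  have hb := isBaseChange_pullSec M f hV hW h rfl u fun _ ↦ rfl
  rw [eq_top_iff]
  intro x _
  exact hb.inductionOn (motive := (· ∈ Submodule.span Γ(Y, W) (Set.range (M.pullSec f h)))) x
    (zero_mem _) (fun m ↦ Submodule.subset_span ⟨m, rfl⟩)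
    (fun s x hx ↦ Submodule.smul_mem _ _ hx) fun x y hx hy ↦ add_mem hx hy

lemma exists_affine_cover (f : Y ⟶ X) (𝒱 : Set X.Opens) (y : Y) (h : ∃ V ∈ 𝒱, f y ∈ V) :
    ∃ (W : Y.Opens), y ∈ W ∧ IsAffineOpen W ∧ ∃ V ∈ 𝒱, W ≤ f ⁻¹ᵁ V := by
  obtain ⟨V, hV, hy⟩ := h
  obtain ⟨W, hW, hyW, hle⟩ := exists_isAffineOpen_mem_and_subset (U := f ⁻¹ᵁ V) hy
  exact ⟨W, hyW, hW, V, hV, hle⟩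

/-- An affine open of `Y`, as an object of `QcqsOver X`. -/
def affineOver (Y : X.QcqsOver) {W : Y.obj.left.Opens} (hW : IsAffineOpen W) : X.QcqsOver :=
  haveI : IsAffine W := hW
  .of (W.ι ≫ Y.obj.hom)

/-- The inclusion of an affine open of `Y`. -/
def affineOverι (Y : X.QcqsOver) {W : Y.obj.left.Opens} (hW : IsAffineOpen W) :
    affineOver Y hW ⟶ Y :=
  QcqsOver.ofHom W.ι rfl

lemma eq_of_structureFunctor_map_eq {Y : X.QcqsOver} (s t : X.structureFunctor.obj (op Y))
    (h : ∀ y : Y.obj.left, ∃ (W : Y.obj.left.Opens) (hW : IsAffineOpen W), y ∈ W ∧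
      X.structureFunctor.map (affineOverι Y hW).op s =
        X.structureFunctor.map (affineOverι Y hW).op t) : s = t := by
  choose W hW hy h using h
  refine Scheme.eq_of_res_eq (V := ⊤) W (fun _ ↦ le_top)
    (fun y _ ↦ TopologicalSpace.Opens.mem_iSup.2 ⟨y, hy y⟩) s t fun y ↦ ?_
  have := congrArg (Y.obj.left.res (by simp : W y ≤ (W y).ι ''ᵁ ⊤)) (h y)
  exact (Scheme.res_res _ le_top s).symm.trans (this.trans (Scheme.res_res _ le_top t))

lemma homOver_ext {G : X.Modules} [G.IsQuasicoherent] {Y : X.QcqsOver} (𝒱 : Set X.Opens)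
    (h𝒱 : ∀ V ∈ 𝒱, IsAffineOpen V) (hY : ∀ y, ∃ V ∈ 𝒱, Y.obj.hom y ∈ V)
    {φ ψ : PresheafOfModules.HomOver G.toFunctor (PresheafOfModules.unit _) (op Y)}
    (H : ∀ (Z : X.QcqsOver) (_ : IsAffine Z.obj.left) (h : Z ⟶ Y) (V) (_ : V ∈ 𝒱)
      (hZ : ⊤ ≤ Z.obj.hom ⁻¹ᵁ V) (m : Γ(G, V)),
      φ.app h.op (G.pullSec Z.obj.hom hZ m) = ψ.app h.op (G.pullSec Z.obj.hom hZ m)) : φ = ψ := by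
  have key (Z : X.QcqsOver) (_ : IsAffine Z.obj.left) (h : Z ⟶ Y) (V) (hV : V ∈ 𝒱)
      (hZ : ⊤ ≤ Z.obj.hom ⁻¹ᵁ V) : φ.app h.op = ψ.app h.op := by
    have := span_range_pullSec G Z.obj.hom (h𝒱 V hV) (isAffineOpen_top Z.obj.left) hZ
    refine LinearMap.ext_on_range this fun m ↦ H Z ‹_› h V hV hZ m
  refine PresheafOfModules.HomOver.app_injective (funext fun Z ↦ funext fun h ↦ ?_)
  refine LinearMap.ext fun s ↦ ?_
  have hcov (z : Z.unop.obj.left) := exists_affine_cover Z.unop.obj.hom 𝒱 z (by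
    have := hY (h.unop.hom.left z)
    rwa [← Scheme.Hom.comp_apply, Over.w] at this)
  choose W hzW hW V hV hWV using hcov
  refine eq_of_structureFunctor_map_eq (Y := Z.unop) _ _ fun z ↦ ⟨W z, hW z, hzW z, ?_⟩
  have h1 := φ.naturality h (affineOverι Z.unop (hW z)).op s
  have h2 := ψ.naturality h (affineOverι Z.unop (hW z)).op s
  refine h1.symm.trans (Eq.trans ?_ h2)
  refine LinearMap.congr_fun (key (affineOver Z.unop (hW z)) (hW z) ((affineOverι Z.unop (hW z)) ≫ h.unop) (V z) (hV z) ?_) _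
  change ⊤ ≤ ((W z).ι ≫ Z.unop.obj.hom) ⁻¹ᵁ V z
  rw [Scheme.Hom.comp_preimage, ← Scheme.Opens.ι_preimage_self]
  exact (W z).ι.preimage_mono (hWV z)

lemma dual_map_injective {G : X.Modules} [G.IsQuasicoherent] {Y Y' : X.QcqsOver} (g : Y' ⟶ Y)
    {V : X.Opens} (hV : IsAffineOpen V) (hY : ⊤ ≤ Y.obj.hom ⁻¹ᵁ V)
    (hg : Function.Injective (X.structureFunctor.map g.op)) :
    Function.Injective (G.toFunctor.dual.map g.op) := by
  intro φ ψ e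
  refine homOver_ext {V} (by simpa) (fun y ↦ ⟨V, rfl, hY trivial⟩) fun Z _ h V' hV' hZ m ↦ ?_
  obtain rfl : V' = V := hV'
  have h0 : ⊤ ≤ Y'.obj.hom ⁻¹ᵁ V' := by
    rw [← Over.w g.hom]
    exact g.hom.left.preimage_mono hY
  have h1 : φ.app (𝟙 _) (G.pullSec Y.obj.hom hY m) = ψ.app (𝟙 _) (G.pullSec Y.obj.hom hY m) := by
    apply hg
    refine (φ.naturality (𝟙 _) g.op _).symm.trans (Eq.trans ?_ (ψ.naturality (𝟙 _) g.op _))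
    rw [toFunctor_map_pullSec G g hY h0 m]
    have := congr(PresheafOfModules.HomOver.app $e (𝟙 _) (G.pullSec Y'.obj.hom h0 m))
    change φ.app (g.op ≫ 𝟙 _) _ = ψ.app (g.op ≫ 𝟙 _) _ at this
    rwa [Category.comp_id] at this
  rw [← toFunctor_map_pullSec G h hY hZ m, ← Category.id_comp h.op]
  exact (φ.naturality (𝟙 _) h.op _).trans (Eq.trans (congrArg _ h1) (ψ.naturality (𝟙 _) h.op _).symm)

lemma specMap_fromSpec_appLE {V : X.Opens} (hV : IsAffineOpen V) {S : CommRingCat.{u}}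
    (φ : Γ(X, V) ⟶ S) (h : ⊤ ≤ (Spec.map φ ≫ hV.fromSpec) ⁻¹ᵁ V) :
    (Spec.map φ ≫ hV.fromSpec).appLE V ⊤ h = φ ≫ (Scheme.ΓSpecIso S).inv := by
  rw [Scheme.Hom.comp_appLE, hV.fromSpec_app_self, Category.assoc]
  refine Eq.trans ?_ (Scheme.ΓSpecIso_inv_naturality φ).symm
  congr 1

open TensorProduct in
lemma exists_tensorEquiv (M : X.Modules) [M.IsQuasicoherent] (f : Y ⟶ X)
    {V : X.Opens} (hV : IsAffineOpen V) {W : Y.Opens} (hW : IsAffineOpen W) (h : W ≤ f ⁻¹ᵁ V)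
    {T : Type u} [CommRing T] [Algebra Γ(X, V) T] (ε : T ≃+* Γ(Y, W))
    (hε : ∀ r, ε (algebraMap Γ(X, V) T r) = f.appLE V W h r) :
    ∃ e : T ⊗[Γ(X, V)] Γ(M, V) ≃+ Γ((pullback f).obj M, W), ∀ t m,
      e (t ⊗ₜ m) = ε t • M.pullSec f h m := by
  let : Algebra Γ(X, V) Γ(Y, W) := (f.appLE V W h).hom.toAlgebra
  let : Module Γ(X, V) Γ((pullback f).obj M, W) := Module.compHom _ (f.appLE V W h).hom
  have : IsScalarTower Γ(X, V) Γ(Y, W) Γ((pullback f).obj M, W) :=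
    ⟨fun a b x ↦ by rw [Algebra.smul_def, mul_smul]; rfl⟩
  let u : Γ(M, V) →ₗ[Γ(X, V)] Γ((pullback f).obj M, W) :=
    { toFun := M.pullSec f h
      map_add' := map_add _
      map_smul' := map_smulₛₗ (M.pullSec f h) }
  have hb := isBaseChange_pullSec M f hV hW h rfl u fun _ ↦ rfl
  let ε' : T ≃ₐ[Γ(X, V)] Γ(Y, W) := AlgEquiv.ofRingEquiv (f := ε) hε
  refine ⟨(ε'.toLinearEquiv.rTensor Γ(M, V)).toAddEquiv.trans hb.equiv.toAddEquiv, fun t m ↦ ?_⟩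
  exact hb.equiv_tmul _ _

section
variable {V : X.Opens} (hV : IsAffineOpen V) (T : Type u) [CommRing T] [Algebra Γ(X, V) T]
  (T' : Type u) [CommRing T'] [Algebra Γ(X, V) T']

/-- The spectrum of a `Γ(X, V)`-algebra, as an object of `QcqsOver X`. -/
def specOver : X.QcqsOver :=
  .of (Spec.map (CommRingCat.ofHom (algebraMap Γ(X, V) T)) ≫ hV.fromSpec)

lemma top_le_specOver_preimage : ⊤ ≤ (specOver hV T).obj.hom ⁻¹ᵁ V :=
  ((Spec.map (CommRingCat.ofHom (algebraMap Γ(X, V) T))).preimage_mono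
    hV.fromSpec_preimage_self.ge :)

variable {T T'} in
/-- The morphism of spectra given by an algebra homomorphism. -/
def specOverMap (ρ : T →ₐ[Γ(X, V)] T') : specOver hV T' ⟶ specOver hV T :=
  QcqsOver.ofHom (Spec.map (CommRingCat.ofHom ρ.toRingHom)) (by
    change _ ≫ Spec.map _ ≫ _ = Spec.map _ ≫ _
    rw [← Spec.map_comp_assoc, ← CommRingCat.ofHom_comp]
    congr 3
    exact ρ.comp_algebraMap)

variable {T T'} in
lemma structureFunctor_map_specOverMap (ρ : T →ₐ[Γ(X, V)] T') (t : T) :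
    X.structureFunctor.map (specOverMap hV ρ).op ((Scheme.ΓSpecIso (.of T)).inv t) =
      (Scheme.ΓSpecIso (.of T')).inv (ρ t) :=
  congr($(Scheme.ΓSpecIso_inv_naturality (CommRingCat.ofHom ρ.toRingHom)) t).symm

variable {T T'} in
lemma injective_structureFunctor_map_specOverMap (ρ : T →ₐ[Γ(X, V)] T')
    (hρ : Function.Injective ρ) :
    Function.Injective (X.structureFunctor.map (specOverMap hV ρ).op) := by
  have h1 : Function.Bijective (Scheme.ΓSpecIso (.of T)).inv := ConcreteCategory.bijective_of_isIso _
  have h2 : Function.Bijective (Scheme.ΓSpecIso (.of T')).inv :=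
    ConcreteCategory.bijective_of_isIso _
  intro x y h
  obtain ⟨x, rfl⟩ := h1.2 x
  obtain ⟨y, rfl⟩ := h1.2 y
  rw [structureFunctor_map_specOverMap, structureFunctor_map_specOverMap] at h
  rw [hρ (h2.1 h)]

lemma exists_tensorEquiv_specOver (F : X.Modules) [F.IsQuasicoherent] :
    ∃ e : TensorProduct Γ(X, V) T Γ(F, V) ≃+ F.toFunctor.obj (op (specOver hV T)), ∀ t m,
      e (.tmul _ t m) = (show X.structureFunctor.obj (op (specOver hV T)) from
        (Scheme.ΓSpecIso (.of T)).inv t) • (show F.toFunctor.obj (op (specOver hV T)) from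
          F.pullSec _ (top_le_specOver_preimage hV T) m) :=
  exists_tensorEquiv F (specOver hV T).obj.hom hV
    (isAffineOpen_top (Spec (.of T))) (top_le_specOver_preimage hV T)
    (Scheme.ΓSpecIso (.of T)).symm.commRingCatIsoToRingEquiv
    fun r ↦ congr($(specMap_fromSpec_appLE hV
      (CommRingCat.ofHom (algebraMap Γ(X, V) T)) (top_le_specOver_preimage hV T)) r).symm

variable {T T'} in
lemma injective_rTensor_of_injective_toFunctor_map {F : X.Modules} [F.IsQuasicoherent]
    (ρ : T →ₐ[Γ(X, V)] T')
    (H : Function.Injective (F.toFunctor.map (specOverMap hV ρ).op)) :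
    Function.Injective (ρ.toLinearMap.rTensor Γ(F, V)) := by
  obtain ⟨e, he⟩ := exists_tensorEquiv_specOver hV T F
  obtain ⟨e', he'⟩ := exists_tensorEquiv_specOver hV T' F
  have h3 (x) : e' (ρ.toLinearMap.rTensor _ x) = F.toFunctor.map (specOverMap hV ρ).op (e x) := by
    induction x with
    | zero =>
      rw [map_zero, map_zero, map_zero]
      exact (map_zero (F.toFunctor.map (specOverMap hV ρ).op).hom).symm
    | tmul t m =>
      rw [LinearMap.rTensor_tmul, he, he']
      refine Eq.trans ?_ (F.toFunctor.map_smul (specOverMap hV ρ).op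
        ((Scheme.ΓSpecIso (.of T)).inv t)
        (F.pullSec _ (top_le_specOver_preimage hV _) m)).symm
      exact congrArg₂ (fun (s : X.structureFunctor.obj (op (specOver hV T')))
        (x : F.toFunctor.obj (op (specOver hV T'))) ↦ s • x)
        (structureFunctor_map_specOverMap hV ρ t).symm
        (toFunctor_map_pullSec F (specOverMap hV ρ) _ _ m).symm
    | add x y hx hy =>
      rw [map_add, map_add, map_add, hx, hy]
      exact (map_add (F.toFunctor.map (specOverMap hV ρ).op).hom _ _).symm
  refine Function.Injective.of_comp (f := e') ?_
  have h4 : e' ∘ ρ.toLinearMap.rTensor Γ(F, V) =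
      F.toFunctor.map (specOverMap hV ρ).op ∘ e := funext h3
  rw [h4]
  exact H.comp e.injective

include hV in
lemma flat_of_injective_toFunctor_map {F : X.Modules} [F.IsQuasicoherent]
    (H : ∀ {Y Y' : X.QcqsOver} (g : Y' ⟶ Y) (_ : ⊤ ≤ Y.obj.hom ⁻¹ᵁ V),
      Function.Injective (X.structureFunctor.map g.op) →
        Function.Injective (F.toFunctor.map g.op)) : Module.Flat Γ(X, V) Γ(F, V) := by
  refine Module.Flat.of_forall_ideal fun I ↦ ?_
  let ρ : TrivSqZeroExt Γ(X, V) I →ₐ[Γ(X, V)] TrivSqZeroExt Γ(X, V) Γ(X, V) :=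
    TrivSqZeroExt.map I.subtype
  have hρ : Function.Injective ρ := fun x y h ↦ by
    have h1 := congrArg TrivSqZeroExt.fst h
    have h2 := congrArg TrivSqZeroExt.snd h
    simp only [ρ, TrivSqZeroExt.fst_map, TrivSqZeroExt.snd_map] at h1 h2
    exact TrivSqZeroExt.ext h1 (Subtype.ext h2)
  refine ⟨TrivSqZeroExt Γ(X, V) I, TrivSqZeroExt Γ(X, V) Γ(X, V), _, _, _, _,
    TrivSqZeroExt.inrHom _ _, TrivSqZeroExt.sndHom _ _, TrivSqZeroExt.inrHom _ _,
    ρ.toLinearMap, ?_, ?_, injective_rTensor_of_injective_toFunctor_map hV ρ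
      (H _ (top_le_specOver_preimage hV _)
        (injective_structureFunctor_map_specOverMap hV ρ hρ))⟩
  · ext; rfl
  · ext <;> simp [ρ]

end

/-- A quasi-coherent module whose functor is a direct limit of module varieties is flat. -/
theorem isFlat_of_isDirectLimitOfModuleVarieties {F : X.Modules} [F.IsQuasicoherent]
    (H : IsDirectLimitOfModuleVarieties F.toFunctor) : F.IsFlat := by
  obtain ⟨I, _, _, _, D, c, hD, ⟨hc⟩, ⟨e⟩⟩ := H
  refine isFlat_of_flat fun V hV ↦ flat_of_injective_toFunctor_map hV fun {Y Y'} g hY hg ↦ ?_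
  have h1 : Function.Injective (c.pt.map g.op) :=
    PresheafOfModules.injective_map_of_isColimit hc g.op fun i ↦ by
      obtain ⟨G, hG, ⟨e'⟩⟩ := hD i
      have := hG.1
      exact PresheafOfModules.injective_map_of_iso e'.symm g.op (dual_map_injective g hV hY hg)
  have h2 := PresheafOfModules.injective_map_of_iso e g.op h1
  intro x y hxy
  exact congrArg ULift.down (@h2 (ULift.up x) (ULift.up y) (congrArg ULift.up hxy))

end Modules
end AlgebraicGeometry.Scheme

namespace AlgebraicGeometry.Scheme.Modules
variable {X Y Y' Y'' : Scheme.{u}}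

/-- The sections of the restriction of `M` along `hV.fromSpec`. -/
lemma exists_finite_presentation_tilde (R : CommRingCat.{u}) [IsNoetherianRing R] (N : ModuleCat.{u} R)
    [Module.Finite R N] : ∃ P : SheafOfModules.Presentation (tilde N), P.IsFinite := by
  obtain ⟨s, hs⟩ := Module.Finite.fg_top (R := R) (M := N)
  obtain ⟨t, ht⟩ := IsNoetherian.noetherian
    (LinearMap.ker (Finsupp.linearCombination R (Subtype.val : {x : N // x ∈ s} → N)))
  refine ⟨presentationTilde N s hs t ht, ⟨⟨?_⟩, ⟨?_⟩⟩⟩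
  · exact inferInstanceAs (Finite {x : N // x ∈ s})
  · exact inferInstanceAs (Finite {x // x ∈ t})

/-- The inverse image under `overEquiv` of the structure sheaf. -/
def overEquivUnitIso (V : X.Opens) :
    SheafOfModules.unit (X.ringCatSheaf.over V) ≅
      (overEquiv V).inverse.obj (SheafOfModules.unit (V : Scheme.{u}).ringCatSheaf) :=
  (overEquiv V).unitIso.app _ ≪≫ (overEquiv V).inverse.mapIso
    ((overFunctorEquiv V).app (SheafOfModules.unit X.ringCatSheaf) ≪≫ restrictUnitIso V.ι)

lemma exists_finite_presentation_map {C : Type*} [Category C] {J : GrothendieckTopology C}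
    {R : Sheaf J RingCat.{u}} [HasSheafify J AddCommGrpCat.{u}]
    [J.WEqualsLocallyBijective AddCommGrpCat.{u}] {C' : Type*} [Category C']
    {J' : GrothendieckTopology C'} {S : Sheaf J' RingCat.{u}} [HasSheafify J' AddCommGrpCat.{u}]
    [J'.WEqualsLocallyBijective AddCommGrpCat.{u}] {M : SheafOfModules.{u} R}
    {N : SheafOfModules.{u} S} (F : SheafOfModules.{u} R ⥤ SheafOfModules.{u} S)
    (hF : Limits.PreservesColimitsOfSize.{u, u} F)
    (η : SheafOfModules.unit S ≅ F.obj (SheafOfModules.unit R)) (e : F.obj M ≅ N)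
    (h : ∃ P : M.Presentation, P.IsFinite) : ∃ P : N.Presentation, P.IsFinite := by
  obtain ⟨P, hP⟩ := h
  have : (P.map F η).IsFinite :=
    ⟨⟨hP.isFiniteType_generators.finite⟩, ⟨hP.isFiniteType_relations.finite⟩⟩
  exact ⟨(P.map F η).ofIsIso e.hom, inferInstance⟩

lemma exists_finite_presentation_iso {C : Type*} [Category C] {J : GrothendieckTopology C}
    {R : Sheaf J RingCat.{u}} [HasSheafify J AddCommGrpCat.{u}]
    [J.WEqualsLocallyBijective AddCommGrpCat.{u}] {M N : SheafOfModules.{u} R} (e : M ≅ N)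
    (h : ∃ P : M.Presentation, P.IsFinite) : ∃ P : N.Presentation, P.IsFinite := by
  obtain ⟨P, hP⟩ := h
  exact ⟨P.ofIsIso e.hom, inferInstance⟩

lemma preservesColimits_restrictFunctor (f : Y ⟶ X) [IsOpenImmersion f] :
    Limits.PreservesColimitsOfSize.{u, u} (restrictFunctor f) := inferInstance

lemma preservesColimits_overEquiv_inverse (V : X.Opens) :
    Limits.PreservesColimitsOfSize.{u, u} (overEquiv V).inverse := inferInstance

lemma exists_finite_presentation_over (M : X.Modules) {V : X.Opens} (hV : IsAffineOpen V)
    (h : ∃ P : SheafOfModules.Presentation (M.restrict hV.fromSpec), P.IsFinite) :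
    ∃ P : SheafOfModules.Presentation (SheafOfModules.over M V), P.IsFinite := by
  have e : hV.isoSpec.hom ≫ hV.fromSpec = V.ι := by
    rw [← hV.isoSpec_inv_ι, Iso.hom_inv_id_assoc]
  let i1 : (restrictFunctor hV.isoSpec.hom).obj (M.restrict hV.fromSpec) ≅ M.restrict V.ι :=
    (restrictFunctorComp _ _).symm.app M ≪≫ (restrictFunctorCongr e).app M
  let i2 : (overEquiv V).inverse.obj (M.restrict V.ι) ≅ SheafOfModules.over M V :=
    (overEquiv V).inverse.mapIso ((overFunctorEquiv V).app M).symm ≪≫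
      ((overEquiv V).unitIso.app _).symm
  refine exists_finite_presentation_map (R := (V : Scheme.{u}).ringCatSheaf)
    (overEquiv V).inverse (preservesColimits_overEquiv_inverse V) (overEquivUnitIso V) i2 ?_
  exact exists_finite_presentation_map (R := (Spec Γ(X, V)).ringCatSheaf)
    (S := (V : Scheme.{u}).ringCatSheaf) (restrictFunctor hV.isoSpec.hom)
    (preservesColimits_restrictFunctor _) (restrictUnitIso _).symm i1 h

lemma isCoherent_of_presentation (M : X.Modules)
    (h : ∀ V : X.Opens, IsAffineOpen V →
      ∃ P : SheafOfModules.Presentation (SheafOfModules.over M V), P.IsFinite) : M.IsCoherent := by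
  choose P hP using h
  let q : SheafOfModules.QuasicoherentData.{u} (R := X.ringCatSheaf) M :=
    { I := X.affineOpens
      X V := V.1
      coversTop := by
        rw [Opens.coversTop_iff]
        exact iSup_affineOpens_eq_top X
      presentation V := P V.1 V.2 }
  have h : SheafOfModules.IsFinitePresentation (R := X.ringCatSheaf) M :=
    { exists_quasicoherentData := ⟨q, { isFinite_presentation := fun V ↦ hP V.1 V.2 }⟩ }
  exact ⟨SheafOfModules.instIsQuasicoherentOfIsFinitePresentation (R := X.ringCatSheaf) M,
    SheafOfModules.instIsFiniteTypeOfIsFinitePresentation (R := X.ringCatSheaf) M⟩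

lemma smul_restrict_fromSpec (M : X.Modules) {V : X.Opens} (hV : IsAffineOpen V)
    (U : (Spec Γ(X, V)).Opens) (r : Γ(X, V)) (m : Γ(M, hV.fromSpec ''ᵁ U)) :
    (r • (show Γ(M.restrict hV.fromSpec, U) from m) : Γ(M.restrict hV.fromSpec, U)) =
      X.res (fromSpec_image_le hV U) r • m := by
  rw [← fromSpec_appIso_inv hV U r]
  rfl

lemma isIso_fromTildeΓ_restrict_fromSpec (M : X.Modules) {V : X.Opens} (hV : IsAffineOpen V)
    (h1 : ∀ (b : Γ(X, V)) (s : Γ(M, X.basicOpen b)), ∃ (n : ℕ) (m : Γ(M, V)),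
      M.res (X.basicOpen_le b) m = X.res (X.basicOpen_le b) b ^ n • s)
    (h2 : ∀ (b : Γ(X, V)) (m : Γ(M, V)), M.res (X.basicOpen_le b) m = 0 → ∃ n : ℕ, b ^ n • m = 0) :
    IsIso (M.restrict hV.fromSpec).fromTildeΓ := by
  rw [isIso_fromTildeΓ_iff_isLocalizing]
  intro b
  let N := M.restrict hV.fromSpec
  let D : (Spec Γ(X, V)).Opens := PrimeSpectrum.basicOpen b
  let u : Γ(N, ⊤) →ₗ[Γ(X, V)] Γ(N, D) :=
    ((modulesSpecToSheaf.obj N).obj.map (homOfLE (le_top : D ≤ ⊤)).op).hom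
  change IsLocalizedModule (.powers b) u
  have hD : hV.fromSpec ''ᵁ D = X.basicOpen b := hV.fromSpec_image_basicOpen b
  have hT : hV.fromSpec ''ᵁ ⊤ = V := by simp
  have hu (x : Γ(N, ⊤)) : u x = M.res (hV.fromSpec.image_mono le_top) x := rfl
  have hsurj (y : Γ(M, hV.fromSpec ''ᵁ D)) : ∃ (n : ℕ) (m : Γ(M, V)),
      X.res (fromSpec_image_le hV D) (b ^ n) • y = M.res (fromSpec_image_le hV D) m := by
    obtain ⟨n, m, h⟩ := h1 b (M.res hD.ge y)
    refine ⟨n, m, ?_⟩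
    have := congrArg (M.res hD.le) h
    rw [res_res, res_smul, res_res, res_self, ← map_pow, Scheme.res_res] at this
    exact this.symm
  have hinj (x : Γ(M, hV.fromSpec ''ᵁ ⊤)) (h : M.res (hV.fromSpec.image_mono (U := D) le_top) x = 0) :
      ∃ n : ℕ, X.res (fromSpec_image_le hV ⊤) (b ^ n) • x = 0 := by
    obtain ⟨n, hn⟩ := h2 b (M.res hT.ge x) (by
      have := congrArg (M.res hD.ge) h
      rw [res_res, map_zero] at this
      rw [res_res]
      exact this)
    refine ⟨n, ?_⟩
    have := congrArg (M.res hT.le) hn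
    rwa [res_smul, res_res, res_self, map_zero] at this
  refine ⟨?_, fun y ↦ ?_, fun {x y} h ↦ ?_⟩
  · rintro ⟨_, n, rfl⟩
    rw [map_pow]
    exact (N.isUnit_algebraMap_end_of_le_basicOpen b le_rfl).pow n
  · obtain ⟨n, m, h⟩ := hsurj y
    refine ⟨⟨M.res hT.le m, ⟨b ^ n, n, rfl⟩⟩, ?_⟩
    refine (smul_restrict_fromSpec M hV D (b ^ n) y).trans (h.trans ?_)
    exact (res_res M (hV.fromSpec.image_mono le_top) hT.le m).symm
  · obtain ⟨n, hn⟩ := hinj (x - y) ((map_sub _ _ _).trans (sub_eq_zero.2 h))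
    refine ⟨⟨b ^ n, n, rfl⟩, ?_⟩
    change b ^ n • x = b ^ n • y
    rw [← sub_eq_zero, ← smul_sub]
    exact (smul_restrict_fromSpec M hV ⊤ (b ^ n) (x - y)).trans hn

/-- A module on a locally Noetherian scheme whose sections on affine opens localize well and are
finitely generated is coherent. -/
theorem isCoherent_of_forall_isAffineOpen [IsLocallyNoetherian X] (M : X.Modules)
    (h1 : ∀ (V : X.Opens) (_ : IsAffineOpen V) (b : Γ(X, V)) (s : Γ(M, X.basicOpen b)),
      ∃ (n : ℕ) (m : Γ(M, V)), M.res (X.basicOpen_le b) m = X.res (X.basicOpen_le b) b ^ n • s)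
    (h2 : ∀ (V : X.Opens) (_ : IsAffineOpen V) (b : Γ(X, V)) (m : Γ(M, V)),
      M.res (X.basicOpen_le b) m = 0 → ∃ n : ℕ, b ^ n • m = 0)
    (h3 : ∀ V : X.Opens, IsAffineOpen V → Module.Finite Γ(X, V) Γ(M, V)) : M.IsCoherent := by
  refine isCoherent_of_presentation M fun V hV ↦ exists_finite_presentation_over M hV ?_
  have := isIso_fromTildeΓ_restrict_fromSpec M hV (h1 V hV) (h2 V hV)
  have : IsNoetherianRing Γ(X, V) := IsLocallyNoetherian.component_noetherian ⟨V, hV⟩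
  let N : ModuleCat Γ(X, V) := (modulesSpecToSheaf.obj (M.restrict hV.fromSpec)).presheaf.obj (.op ⊤)
  have : Module.Finite Γ(X, V) N := by
    have hT : hV.fromSpec ''ᵁ ⊤ = V := by simp
    have := h3 V hV
    let e : Γ(M, V) →ₗ[Γ(X, V)] N :=
      { toFun m := M.res hT.le m
        map_add' := map_add _
        map_smul' r m := by
          rw [res_smul]
          exact (smul_restrict_fromSpec M hV ⊤ r (M.res hT.le m)).symm }
    refine Module.Finite.of_surjective e fun x ↦ ⟨M.res hT.ge x, ?_⟩
    exact (res_res M hT.le hT.ge x).trans (res_self ..)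
  obtain ⟨P, hP⟩ := exists_finite_presentation_tilde _ N
  let e := asIso (M.restrict hV.fromSpec).fromTildeΓ
  exact exists_finite_presentation_iso (R := (Spec Γ(X, V)).ringCatSheaf) e ⟨P, hP⟩

end AlgebraicGeometry.Scheme.Modules

namespace AlgebraicGeometry.Scheme

section
variable {X Y Y' Y'' : Scheme.{u}}

/-- Pull-back of functions along a morphism of schemes. -/
def pull (g : Y' ⟶ Y) {W : Y.Opens} {W' : Y'.Opens} (h : W' ≤ g ⁻¹ᵁ W) : Γ(Y, W) →+* Γ(Y', W') :=
  (g.appLE W W' h).hom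

@[simp] lemma pull_res (g : Y' ⟶ Y) {W V : Y.Opens} {W' : Y'.Opens} (h : W' ≤ g ⁻¹ᵁ W)
    (k : W ≤ V) (s : Γ(Y, V)) :
    pull g h (Y.res k s) = pull g (h.trans (g.preimage_mono k)) s :=
  congr($(g.map_appLE h (homOfLE k).op) s)

@[simp] lemma res_pull (g : Y' ⟶ Y) {W : Y.Opens} {W' V' : Y'.Opens} (h : W' ≤ g ⁻¹ᵁ W)
    (k : V' ≤ W') (s : Γ(Y, W)) : Y'.res k (pull g h s) = pull g (k.trans h) s :=
  congr($(g.appLE_map h (homOfLE k).op) s)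

lemma pull_pull (g : Y' ⟶ Y) (f : Y ⟶ X) {f' : Y' ⟶ X} (w : g ≫ f = f') {V : X.Opens}
    {W : Y.Opens} {W' : Y'.Opens} (h : W ≤ f ⁻¹ᵁ V) (h' : W' ≤ g ⁻¹ᵁ W) (s : Γ(X, V)) :
    pull g h' (pull f h s) =
      pull f' (h'.trans ((g.preimage_mono h).trans (by rw [← w]; rfl))) s := by
  subst w
  exact congr($(Scheme.Hom.appLE_comp_appLE g f V W W' h h') s)

@[simp] lemma pull_id {W W' : Y.Opens} (h : W' ≤ 𝟙 Y ⁻¹ᵁ W) (s : Γ(Y, W)) :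
    pull (𝟙 Y) h s = Y.res h s := by
  simp [pull, res]
  rfl

lemma pull_app (f : Y ⟶ X) (V : X.Opens) (s : Γ(X, V)) :
    f.app V s = pull f le_rfl s := by
  simp [pull, Scheme.Hom.app_eq_appLE]

end

namespace Modules
variable {X Y Y' Y'' : Scheme.{u}}

/-- Construct a morphism of modules from its effect on sections. -/
def homMk {M N : X.Modules} (φ : ∀ V : X.Opens, Γ(M, V) →ₗ[Γ(X, V)] Γ(N, V))
    (hφ : ∀ (U V : X.Opens) (h : U ≤ V) (m : Γ(M, V)), φ U (M.res h m) = N.res h (φ V m)) :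
    M ⟶ N where
  val :=
    { app V := ModuleCat.ofHom (φ V.unop)
      naturality {V U} i := by
        ext m
        exact hφ U.unop V.unop i.unop.le m }

/-- The structure sheaf as a module. -/
abbrev structureModule (X : Scheme.{u}) : X.Modules := SheafOfModules.unit X.ringCatSheaf

/-- A homomorphism from `M` to the direct image of the structure sheaf. -/
@[ext]
structure PushHom (M : X.Modules) (f : Y ⟶ X) where
  app (V : X.Opens) : Γ(M, V) →ₛₗ[(f.app V).hom] Γ(Y, f ⁻¹ᵁ V)
  app_res' (U V : X.Opens) (h : U ≤ V) (m : Γ(M, V)) :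
    app U (M.res h m) = Y.res (f.preimage_mono h) (app V m)

namespace PushHom
variable {M : X.Modules} {f : Y ⟶ X}

lemma app_res (a : PushHom M f) {U V : X.Opens} (h : U ≤ V) (m : Γ(M, V)) :
    a.app U (M.res h m) = Y.res (f.preimage_mono h) (a.app V m) :=
  a.app_res' U V h m

lemma app_injective : Function.Injective (fun (a : PushHom M f) V (m : Γ(M, V)) ↦ a.app V m) := by
  intro a b h
  ext V m
  exact congrFun (congrFun h V) m

instance : Zero (PushHom M f) where
  zero := { app := fun _ ↦ 0, app_res' := fun _ _ _ _ ↦ (map_zero _).symm }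

instance : Add (PushHom M f) where
  add a b :=
    { app := fun V ↦ a.app V + b.app V
      app_res' := fun _ _ h m ↦ (congrArg₂ (· + ·) (a.app_res h m) (b.app_res h m)).trans
        (map_add _ _ _).symm }

instance : Neg (PushHom M f) where
  neg a :=
    { app := fun V ↦ -a.app V
      app_res' := fun _ _ h m ↦ (congrArg (- ·) (a.app_res h m)).trans (map_neg _ _).symm }

instance : Sub (PushHom M f) where
  sub a b :=
    { app := fun V ↦ a.app V - b.app V
      app_res' := fun _ _ h m ↦ (congrArg₂ (· - ·) (a.app_res h m) (b.app_res h m)).trans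
        (map_sub _ _ _).symm }

instance : SMul ℕ (PushHom M f) where
  smul n a :=
    { app := fun V ↦ n • a.app V
      app_res' := fun _ _ h m ↦ (congrArg (n • ·) (a.app_res h m)).trans (map_nsmul _ _ _).symm }

instance : SMul ℤ (PushHom M f) where
  smul n a :=
    { app := fun V ↦ n • a.app V
      app_res' := fun _ _ h m ↦ (congrArg (n • ·) (a.app_res h m)).trans (map_zsmul _ _ _).symm }

instance : AddCommGroup (PushHom M f) :=
  app_injective.addCommGroup _ rfl (fun _ _ ↦ rfl) (fun _ ↦ rfl) (fun _ _ ↦ rfl)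
    (fun _ _ ↦ rfl) (fun _ _ ↦ rfl)

instance : SMul Γ(Y, ⊤) (PushHom M f) where
  smul r a :=
    { app := fun V ↦
        { toFun m := Y.res le_top r * a.app V m
          map_add' m n := by rw [map_add, mul_add]
          map_smul' s m := by rw [map_smulₛₗ, smul_eq_mul, smul_eq_mul, mul_left_comm] }
      app_res' := fun U V h m ↦ by
        change Y.res le_top r * a.app U (M.res h m) = Y.res _ (Y.res le_top r * a.app V m)
        rw [map_mul, Scheme.res_res, a.app_res] }

@[simp] lemma zero_app (V : X.Opens) (m : Γ(M, V)) : (0 : PushHom M f).app V m = 0 := rfl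
@[simp] lemma add_app (a b : PushHom M f) (V : X.Opens) (m : Γ(M, V)) :
    (a + b).app V m = a.app V m + b.app V m := rfl
@[simp] lemma smul_app (r : Γ(Y, ⊤)) (a : PushHom M f) (V : X.Opens) (m : Γ(M, V)) :
    (r • a).app V m = Y.res le_top r * a.app V m := rfl

instance : Module Γ(Y, ⊤) (PushHom M f) where
  one_smul a := by ext; simp
  mul_smul r s a := by ext; simp [mul_assoc]
  smul_zero r := by ext; simp
  smul_add r a b := by ext; simp [mul_add]
  add_smul r s a := by ext; simp [add_mul]
  zero_smul a := by ext; simp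

/-- Composition with the pull-back of functions along a morphism `g` of schemes over `X`. -/
def restrict (a : PushHom M f) (g : Y' ⟶ Y) {f' : Y' ⟶ X} (w : g ≫ f = f') : PushHom M f' where
  app V :=
    { toFun m := pull g (W := f ⁻¹ᵁ V) (by rw [← w]; rfl) (a.app V m)
      map_add' m n := by rw [map_add, map_add]
      map_smul' r m := by
        rw [map_smulₛₗ, smul_eq_mul, map_mul, smul_eq_mul, pull_app, pull_pull g f w]
        exact congrArg (· * _) (pull_app f' V r).symm }
  app_res' U V h m := by
    change pull g _ (a.app U (M.res h m)) = Y'.res _ (pull g _ (a.app V m))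
    rw [a.app_res, pull_res, res_pull]

lemma restrict_app (a : PushHom M f) (g : Y' ⟶ Y) {f' : Y' ⟶ X} (w : g ≫ f = f') (V : X.Opens)
    (m : Γ(M, V)) : (a.restrict g w).app V m =
      pull g (W := f ⁻¹ᵁ V) (by rw [← w]; rfl) (a.app V m) :=
  rfl

lemma restrict_add (a b : PushHom M f) (g : Y' ⟶ Y) {f' : Y' ⟶ X} (w : g ≫ f = f') :
    (a + b).restrict g w = a.restrict g w + b.restrict g w := by
  ext V m
  simp [restrict_app]

lemma restrict_smul (r : Γ(Y, ⊤)) (a : PushHom M f) (g : Y' ⟶ Y) {f' : Y' ⟶ X} (w : g ≫ f = f') :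
    (r • a).restrict g w = pull g (W' := ⊤) le_top r • a.restrict g w := by
  ext V m
  simp only [restrict_app, smul_app, map_mul, pull_res]
  exact congrArg (· * _) (res_pull _ _ _ _).symm

/-- Precomposition with a homomorphism of modules. -/
def precomp {N : X.Modules} (α : N ⟶ M) (a : PushHom M f) : PushHom N f where
  app V :=
    { toFun n := a.app V (α.app V n)
      map_add' m n := by rw [map_add, map_add]
      map_smul' r m := by rw [Hom.app_smul, map_smulₛₗ] }
  app_res' U V h m := by
    change a.app U (α.app U _) = Y.res _ (a.app V (α.app V m))
    rw [Modules.app_res, a.app_res]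

end PushHom

instance pushHomModule (M : X.Modules) (Y : X.QcqsOverᵒᵖ) :
    Module (X.structureFunctor.obj Y) (PushHom M Y.unop.obj.hom) :=
  inferInstanceAs (Module Γ(Y.unop.obj.left, ⊤) (PushHom M Y.unop.obj.hom))

lemma structureFunctor_map_eq_pull {Y Y' : X.QcqsOverᵒᵖ} (g : Y ⟶ Y')
    (s : Γ(Y.unop.obj.left, ⊤)) :
    X.structureFunctor.map g s = pull g.unop.hom.left (W' := ⊤) le_top s :=
  pull_app g.unop.hom.left ⊤ s

/-- The functor `Y ↦ Hom(M, f_* O_Y)` on quasi-compact and quasi-separated `X`-schemes. -/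
def dualFunctor (M : X.Modules) :
    _root_.PresheafOfModules.{u} (X.structureFunctor ⋙ forget₂ CommRingCat RingCat) where
  obj Y := ModuleCat.of (X.structureFunctor.obj Y) (PushHom M Y.unop.obj.hom)
  map {Y Y'} g := ModuleCat.ofHom
      (Y := (ModuleCat.restrictScalars
          ((X.structureFunctor ⋙ forget₂ CommRingCat RingCat).map g).hom).obj
        (ModuleCat.of (X.structureFunctor.obj Y') (PushHom M Y'.unop.obj.hom)))
    { toFun := fun a ↦ a.restrict g.unop.hom.left (Over.w g.unop.hom)
      map_add' := fun a b ↦ PushHom.restrict_add a b _ _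
      map_smul' := fun r a ↦ by
        refine (PushHom.restrict_smul r a _ _).trans ?_
        exact congrArg (fun t : Γ(Y'.unop.obj.left, ⊤) ↦
          t • a.restrict g.unop.hom.left (Over.w g.unop.hom))
          (structureFunctor_map_eq_pull g r).symm }
  map_id Y := by
    refine ModuleCat.hom_ext (LinearMap.ext fun a ↦ ?_)
    refine PushHom.app_injective (funext fun V ↦ funext fun m ↦ ?_)
    exact (pull_id _ _).trans (Scheme.res_self _ _)
  map_comp g h := by
    refine ModuleCat.hom_ext (LinearMap.ext fun a ↦ ?_)
    refine PushHom.app_injective (funext fun V ↦ funext fun m ↦ ?_)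
    exact (pull_pull h.unop.hom.left g.unop.hom.left rfl _ _ _).symm

/-- The effect of a homomorphism of modules on the functors of homomorphisms. -/
def dualFunctorMap {M N : X.Modules} (α : N ⟶ M) : M.dualFunctor ⟶ N.dualFunctor where
  app _ := ModuleCat.ofHom
    { toFun := fun a ↦ a.precomp α
      map_add' := fun _ _ ↦ rfl
      map_smul' := fun _ _ ↦ rfl }
  naturality _ := rfl

end Modules
end AlgebraicGeometry.Scheme

namespace PresheafOfModules

variable {C : Type w} [Category.{w'} C] {R : Cᵒᵖ ⥤ RingCat.{u}}

lemma nonempty_iso_of_bijective {M N : PresheafOfModules.{v} R} (α : M ⟶ N)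
    (h : ∀ Y, Function.Bijective (α.app Y)) : Nonempty (M ≅ N) :=
  ⟨isoMk (fun Y ↦ (LinearEquiv.ofBijective (α.app Y).hom (h Y)).toModuleIso)
    fun _ _ f ↦ α.naturality f⟩

end PresheafOfModules

namespace AlgebraicGeometry.Scheme

section
variable {X Y : Scheme.{u}}

lemma pull_ι (U : Y.Opens) {W : Y.Opens} {W' : U.toScheme.Opens} (h : W' ≤ U.ι ⁻¹ᵁ W)
    (s : Γ(Y, W)) : pull U.ι h s =
      Y.res (V := W) (U := U.ι ''ᵁ W')
        ((U.ι.image_mono h).trans (U.ι.image_preimage_eq_opensRange_inf W ▸ inf_le_right)) s := by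
  simp [pull, res]
  rfl

end

/-- A quasi-compact open subscheme, as an object of `QcqsOver X`. -/
def openOver {X : Scheme.{u}} (Y : X.QcqsOver) {U : Y.obj.left.Opens}
    (hU : IsCompact (U : Set Y.obj.left)) : X.QcqsOver :=
  haveI : CompactSpace U := isCompact_iff_compactSpace.1 hU
  haveI : QuasiSeparatedSpace Y.obj.left := Y.property.2
  haveI : QuasiSeparatedSpace U := .of_isOpenEmbedding U.ι.isOpenEmbedding
  .of (U.ι ≫ Y.obj.hom)

/-- The inclusion of a quasi-compact open subscheme. -/
def openOverι {X : Scheme.{u}} (Y : X.QcqsOver) {U : Y.obj.left.Opens}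
    (hU : IsCompact (U : Set Y.obj.left)) : openOver Y hU ⟶ Y :=
  QcqsOver.ofHom U.ι rfl

lemma isCompact_preimage_of_isNoetherian {X : Scheme.{u}} [IsNoetherian X] (Y : X.QcqsOver)
    (V : X.Opens) : IsCompact ((Y.obj.hom ⁻¹ᵁ V : Y.obj.left.Opens) : Set Y.obj.left) := by
  have := Y.property.1
  have : QuasiCompact Y.obj.hom := inferInstance
  exact Y.obj.hom.isCompact_preimage (TopologicalSpace.NoetherianSpace.isCompact (V : Set X))

namespace Modules
variable {X Y Y' Y'' : Scheme.{u}}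

namespace PushHom
variable {M : X.Modules} {f : Y ⟶ X}

/-- The homomorphism to the direct image. -/
def toPushforward (a : PushHom M f) : M ⟶ (pushforward f).obj (structureModule Y) :=
  homMk (N := (pushforward f).obj (structureModule Y))
    (fun V ↦ { toFun := a.app V, map_add' := map_add _, map_smul' := map_smulₛₗ (a.app V) })
    a.app_res'

/-- The homomorphism from the pull-back to the structure sheaf. -/
def toHom (a : PushHom M f) : (pullback f).obj M ⟶ structureModule Y :=
  ((pullbackPushforwardAdjunction f).homEquiv _ _).symm a.toPushforward

lemma toHom_unit (a : PushHom M f) (V : X.Opens) (m : Γ(M, V)) :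
    a.toHom.app (f ⁻¹ᵁ V) (((pullbackPushforwardAdjunction f).unit.app M).app V m) =
      a.app V m :=
  congr(($((Adjunction.homEquiv_unit ..).symm.trans (Equiv.apply_symm_apply
    ((pullbackPushforwardAdjunction f).homEquiv _ _) a.toPushforward))).app V m)

lemma toHom_pullSec (a : PushHom M f) {V : X.Opens} {W : Y.Opens} (h : W ≤ f ⁻¹ᵁ V) (m : Γ(M, V)) :
    a.toHom.app W (M.pullSec f h m) = Y.res h (a.app V m) := by
  refine (Modules.app_res a.toHom h _).trans ?_
  exact congrArg (Y.res h) (a.toHom_unit V m)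

/-- Pull-back of functions along `g` as a morphism of modules. -/
def _root_.AlgebraicGeometry.Scheme.Modules.structurePush (g : Y' ⟶ Y) :
    structureModule Y ⟶ (pushforward g).obj (structureModule Y') :=
  homMk (N := (pushforward g).obj (structureModule Y'))
    (fun V ↦ { toFun := g.app V, map_add' := map_add _, map_smul' := map_mul (g.app V).hom })
    (fun _ _ h s ↦ congr($(g.naturality (homOfLE h).op) s))

lemma transition_toHom (a : PushHom M f) (g : Y' ⟶ Y) {f' : Y' ⟶ X} (w : g ≫ f = f') :
    M.transition g w ≫ (pushforward g).map (a.restrict g w).toHom =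
      a.toHom ≫ structurePush g := by
  refine transition_ext fun U s ↦ ?_
  have e : M.pullSec f le_rfl s = pushApp (M.toPush f) U s :=
    res_self ((pullback f).obj M) _ _
  change (a.restrict g w).toHom.app _ (pushApp (M.transition g w) (f ⁻¹ᵁ U)
    (pushApp (M.toPush f) U s)) = g.app _ (a.toHom.app (f ⁻¹ᵁ U) (pushApp (M.toPush f) U s))
  rw [← e, transition_pullSec, toHom_pullSec, toHom_pullSec, restrict_app, res_pull,
    Scheme.res_self, pull_app]

lemma restrict_restrict (a : PushHom M f) (g : Y' ⟶ Y) {f' : Y' ⟶ X} (w : g ≫ f = f')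
    (g' : Y'' ⟶ Y') {f'' : Y'' ⟶ X} (w' : g' ≫ f' = f'') (w'' : (g' ≫ g) ≫ f = f'') :
    (a.restrict g w).restrict g' w' = a.restrict (g' ≫ g) w'' := by
  ext V m
  exact pull_pull g' g rfl _ _ _

/-- The element of the dual functor. -/
def toDual {Y : X.QcqsOver} (a : PushHom M Y.obj.hom) :
    PresheafOfModules.HomOver M.toFunctor (PresheafOfModules.unit _) (op Y) where
  app {Z} h :=
    { toFun s := ((a.restrict h.unop.hom.left (Over.w h.unop.hom)).toHom.app ⊤).hom s
      map_add' := map_add _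
      map_smul' r s := Hom.app_smul _ r s }
  naturality {Z Z'} h k m := by
    have := congr(($(transition_toHom (a.restrict h.unop.hom.left (Over.w h.unop.hom))
      k.unop.hom.left (Over.w k.unop.hom))).app ⊤ m)
    refine Eq.trans ?_ this
    rw [restrict_restrict _ _ _ _ _ (Over.w (h ≫ k).unop.hom)]
    rfl

lemma toDual_app_pullSec {Y : X.QcqsOver} (a : PushHom M Y.obj.hom) {Z : X.QcqsOver} (h : Z ⟶ Y)
    {V : X.Opens} (hZ : ⊤ ≤ Z.obj.hom ⁻¹ᵁ V) (m : Γ(M, V)) :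
    a.toDual.app h.op (M.pullSec Z.obj.hom hZ m) =
      pull h.hom.left (W := Y.obj.hom ⁻¹ᵁ V) (W' := ⊤) (by
        rw [← Scheme.Hom.comp_preimage, Over.w]; exact hZ) (a.app V m) := by
  refine (toHom_pullSec (a.restrict h.hom.left (Over.w h.hom)) hZ m).trans ?_
  rw [restrict_app, res_pull]

end PushHom

section
variable {M : X.Modules} {Y : X.QcqsOver}
    (φ : PresheafOfModules.HomOver M.toFunctor (PresheafOfModules.unit _) (op Y))

/-- The value over a scheme over `Y` of an element of the dual functor. -/
def secApp {Z : X.QcqsOver} (h : Z ⟶ Y) :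
    Γ((pullback Z.obj.hom).obj M, ⊤) →ₗ[Γ(Z.obj.left, ⊤)] Γ(Z.obj.left, ⊤) :=
  φ.app h.op

lemma secApp_comp {Z Z' : X.QcqsOver} (h : Z ⟶ Y) (k : Z' ⟶ Z) {V : X.Opens}
    (hZ : ⊤ ≤ Z.obj.hom ⁻¹ᵁ V) (hZ' : ⊤ ≤ Z'.obj.hom ⁻¹ᵁ V) (m : Γ(M, V)) :
    secApp φ (k ≫ h) (M.pullSec Z'.obj.hom hZ' m) =
      pull k.hom.left (W' := ⊤) le_top (secApp φ h (M.pullSec Z.obj.hom hZ m)) := by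
  refine (congrArg (φ.app (k ≫ h).op) (toFunctor_map_pullSec M k hZ hZ' m)).symm.trans ?_
  refine (φ.naturality h.op k.op (M.pullSec _ hZ m)).trans ?_
  exact structureFunctor_map_eq_pull k.op _

variable [IsNoetherian X]

lemma top_le_openOver_preimage (V : X.Opens) :
    ⊤ ≤ (openOver Y (isCompact_preimage_of_isNoetherian Y V)).obj.hom ⁻¹ᵁ V := by
  change ⊤ ≤ ((Y.obj.hom ⁻¹ᵁ V).ι ≫ Y.obj.hom) ⁻¹ᵁ V
  rw [Scheme.Hom.comp_preimage, Scheme.Opens.ι_preimage_self]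

/-- The function on the preimage of `V` given by an element of the dual functor and a section. -/
def dualApp (V : X.Opens) (m : Γ(M, V)) : Γ(Y.obj.left, Y.obj.hom ⁻¹ᵁ V) :=
  Y.obj.left.res (V := (Y.obj.hom ⁻¹ᵁ V).ι ''ᵁ ⊤) (by simp)
    (secApp φ (openOverι Y (isCompact_preimage_of_isNoetherian Y V))
      (M.pullSec _ (top_le_openOver_preimage V) m))

lemma secApp_pullSec {Z : X.QcqsOver} (h : Z ⟶ Y)
    {V : X.Opens} (hZ : ⊤ ≤ Z.obj.hom ⁻¹ᵁ V) (m : Γ(M, V)) :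
    secApp φ h (M.pullSec Z.obj.hom hZ m) =
      pull h.hom.left (W := Y.obj.hom ⁻¹ᵁ V) (W' := ⊤) (by
        rw [← Scheme.Hom.comp_preimage, Over.w]; exact hZ) (dualApp φ V m) := by
  have h0 : ⊤ ≤ h.hom.left ⁻¹ᵁ (Y.obj.hom ⁻¹ᵁ V) := by
    rw [← Scheme.Hom.comp_preimage, Over.w]; exact hZ
  have h1 : Set.range h.hom.left ⊆ Set.range (Y.obj.hom ⁻¹ᵁ V).ι := by
    rintro _ ⟨z, rfl⟩
    simpa using h0 (show z ∈ ⊤ from trivial)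
  let k' : Z.obj.left ⟶ (Y.obj.hom ⁻¹ᵁ V).toScheme :=
    IsOpenImmersion.lift (Y.obj.hom ⁻¹ᵁ V).ι h.hom.left h1
  have hk' : k' ≫ (Y.obj.hom ⁻¹ᵁ V).ι = h.hom.left := IsOpenImmersion.lift_fac _ _ _
  let k : Z ⟶ openOver Y (isCompact_preimage_of_isNoetherian Y V) := QcqsOver.ofHom k' (by
    change k' ≫ (Y.obj.hom ⁻¹ᵁ V).ι ≫ Y.obj.hom = _
    rw [← Category.assoc, hk', Over.w])
  have hk : k ≫ openOverι Y _ = h := by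
    ext
    exact hk'
  have h2 := secApp_comp φ (openOverι Y _) k (top_le_openOver_preimage V) hZ m
  rw [hk] at h2
  rw [h2, ← pull_pull k' (Y.obj.hom ⁻¹ᵁ V).ι hk' (W := ⊤) (by simp) le_top]
  refine congrArg (pull k' _) ?_
  have e (s : Γ(Y.obj.left, (Y.obj.hom ⁻¹ᵁ V).ι ''ᵁ ⊤)) :
      s = pull (Y.obj.hom ⁻¹ᵁ V).ι (W' := ⊤) (by simp) (Y.obj.left.res
        (U := Y.obj.hom ⁻¹ᵁ V) (by simp) s) := by
    rw [pull_ι, Scheme.res_res, Scheme.res_self]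
  exact e _

lemma dualApp_eq (V : X.Opens) (m : Γ(M, V)) (s : Γ(Y.obj.left, Y.obj.hom ⁻¹ᵁ V))
    (h : secApp φ (openOverι Y (isCompact_preimage_of_isNoetherian Y V))
      (M.pullSec _ (top_le_openOver_preimage V) m) =
        pull (Y.obj.hom ⁻¹ᵁ V).ι (W' := ⊤) (by simp) s) : dualApp φ V m = s := by
  rw [dualApp, h, pull_ι, Scheme.res_res, Scheme.res_self]

lemma secApp_openOverι (V : X.Opens) (m : Γ(M, V)) :
    secApp φ (openOverι Y (isCompact_preimage_of_isNoetherian Y V))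
      (M.pullSec _ (top_le_openOver_preimage V) m) =
        pull (Y.obj.hom ⁻¹ᵁ V).ι (W' := ⊤) (by simp) (dualApp φ V m) :=
  secApp_pullSec φ _ _ m

lemma dualApp_add (V : X.Opens) (m n : Γ(M, V)) :
    dualApp φ V (m + n) = dualApp φ V m + dualApp φ V n := by
  refine dualApp_eq φ V _ _ ?_
  rw [map_add, map_add, secApp_openOverι, secApp_openOverι]
  exact (map_add _ _ _).symm

lemma dualApp_smul (V : X.Opens) (r : Γ(X, V)) (m : Γ(M, V)) :
    dualApp φ V (r • m) = Y.obj.hom.app V r * dualApp φ V m := by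
  refine dualApp_eq φ V _ _ ?_
  rw [map_smulₛₗ, LinearMap.map_smul, secApp_openOverι, map_mul, pull_app,
    pull_pull _ _ rfl]
  rfl

lemma dualApp_res {U V : X.Opens} (h : U ≤ V) (m : Γ(M, V)) :
    dualApp φ U (M.res h m) = Y.obj.left.res (Y.obj.hom.preimage_mono h) (dualApp φ V m) := by
  refine dualApp_eq φ U _ _ ?_
  rw [pullSec_res, pull_res]
  exact secApp_pullSec φ _ _ _

/-- The homomorphism given by an element of the dual functor. -/
def ofDual : PushHom M Y.obj.hom where
  app V :=
    { toFun := dualApp φ V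
      map_add' := dualApp_add φ V
      map_smul' := dualApp_smul φ V }
  app_res' _ _ h m := dualApp_res φ h m

lemma toDual_ofDual [M.IsQuasicoherent] : (ofDual φ).toDual = φ := by
  refine homOver_ext {V | IsAffineOpen V} (fun _ h ↦ h) (fun y ↦ ?_) fun Z _ h V _ hZ m ↦ ?_
  · obtain ⟨V, hV, hy, -⟩ := exists_isAffineOpen_mem_and_subset (U := ⊤)
      (show Y.obj.hom y ∈ ⊤ from trivial)
    exact ⟨V, hV, hy⟩
  · exact (PushHom.toDual_app_pullSec _ _ _ _).trans (secApp_pullSec φ h hZ m).symm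

lemma ofDual_toDual (a : PushHom M Y.obj.hom) : ofDual a.toDual = a := by
  ext V m
  refine dualApp_eq _ V _ _ ?_
  exact PushHom.toDual_app_pullSec _ _ _ _
end

lemma ofDual_add [IsNoetherian X] {M : X.Modules} {Y : X.QcqsOver}
    (φ ψ : PresheafOfModules.HomOver M.toFunctor (PresheafOfModules.unit _) (op Y)) :
    ofDual (φ + ψ) = ofDual φ + ofDual ψ := by
  ext V m
  exact map_add (Y.obj.left.res _) _ _

lemma ofDual_smul [IsNoetherian X] {M : X.Modules} {Y : X.QcqsOver} (r : Γ(Y.obj.left, ⊤))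
    (φ : PresheafOfModules.HomOver M.toFunctor (PresheafOfModules.unit _) (op Y)) :
    ofDual ((show X.structureFunctor.obj (op Y) from r) • φ) = r • ofDual φ := by
  ext V m
  refine dualApp_eq _ V _ _ ?_
  rw [PushHom.smul_app, map_mul, pull_res]
  refine Eq.trans ?_ (congrArg₂ (· * ·) (structureFunctor_map_eq_pull
    (openOverι Y (isCompact_preimage_of_isNoetherian Y V)).op r) (secApp_openOverι φ V m))
  rfl

lemma ofDual_restrict [IsNoetherian X] {M : X.Modules} {Y Y' : X.QcqsOver} (g : Y' ⟶ Y)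
    (φ : PresheafOfModules.HomOver M.toFunctor (PresheafOfModules.unit _) (op Y)) :
    ofDual (φ.restrict g.op) = (ofDual φ).restrict g.hom.left (Over.w g.hom) := by
  ext V m
  refine dualApp_eq _ V _ _ ?_
  rw [PushHom.restrict_app, pull_pull _ _ rfl]
  exact secApp_pullSec φ (openOverι Y' _ ≫ g) _ m

/-- The canonical morphism from the dual to the functor of homomorphisms. -/
def dualToDualFunctor (M : X.Modules) [IsNoetherian X] :
    M.toFunctor.dual ⟶ _root_.PresheafOfModules.lift.{u, u + 1} M.dualFunctor where
  app Y := ModuleCat.ofHom (Y := ULift.{u + 1} (M.dualFunctor.obj Y))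
    { toFun φ := ULift.up (ofDual (Y := Y.unop) φ)
      map_add' φ ψ := congrArg ULift.up (ofDual_add (Y := Y.unop) φ ψ)
      map_smul' r φ := congrArg ULift.up (ofDual_smul (Y := Y.unop) r φ) }
  naturality {Y Y'} g := by
    refine ModuleCat.hom_ext (LinearMap.ext fun φ ↦ ?_)
    exact congrArg ULift.up (ofDual_restrict g.unop φ)

lemma bijective_ofDual [IsNoetherian X] (M : X.Modules) [M.IsQuasicoherent] (Y : X.QcqsOver) :
    Function.Bijective (fun φ : PresheafOfModules.HomOver M.toFunctor
      (PresheafOfModules.unit _) (op Y) ↦ ofDual φ) :=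
  Function.bijective_iff_has_inverse.2 ⟨PushHom.toDual, fun φ ↦ toDual_ofDual φ,
    fun a ↦ ofDual_toDual a⟩

lemma nonempty_dual_iso [IsNoetherian X] (M : X.Modules) [M.IsQuasicoherent] :
    Nonempty (M.toFunctor.dual ≅ _root_.PresheafOfModules.lift.{u, u + 1} M.dualFunctor) :=
  PresheafOfModules.nonempty_iso_of_bijective M.dualToDualFunctor fun Y ↦
    (Equiv.ulift.symm.bijective.comp (bijective_ofDual M Y.unop) :)

end Modules
end AlgebraicGeometry.Scheme

namespace TensorProduct
open scoped TensorProduct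
variable {R B A A' N N' : Type*} [CommRing R] [CommRing B] [AddCommGroup A] [Module R A]
  [AddCommGroup A'] [Module R A'] [AddCommGroup N] [Module R N] [AddCommGroup N'] [Module B N']
  {ρ : R →+* B}

/-- The additive map `a ⊗ n ↦ φ a • u n`. -/
def contr (φ : A →ₛₗ[ρ] B) (u : N →ₛₗ[ρ] N') : A ⊗[R] N →+ N' :=
  liftAddHom
    { toFun a :=
        { toFun n := φ a • u n
          map_zero' := by rw [map_zero, smul_zero]
          map_add' m n := by rw [map_add, smul_add] }
      map_zero' := by ext; simp
      map_add' a b := by ext; simp [add_smul] }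
    (fun r a n ↦ by
      change φ (r • a) • u n = φ a • u (r • n)
      rw [map_smulₛₗ, map_smulₛₗ, smul_eq_mul, mul_comm, mul_smul])

@[simp] lemma contr_tmul (φ : A →ₛₗ[ρ] B) (u : N →ₛₗ[ρ] N') (a : A) (n : N) :
    contr φ u (a ⊗ₜ n) = φ a • u n :=
  rfl

lemma contr_rTensor (φ : A →ₛₗ[ρ] B) (u : N →ₛₗ[ρ] N') (g : A' →ₗ[R] A) (φ' : A' →ₛₗ[ρ] B)
    (h : ∀ a, φ' a = φ (g a)) (x : A' ⊗[R] N) :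
    contr φ u (g.rTensor N x) = contr φ' u x := by
  induction x with
  | zero => simp
  | add x y hx hy => rw [map_add, map_add, map_add, hx, hy]
  | tmul a n => simp [h]

/-- Two tensors lie over each other if a common contraction tells so. -/
lemma contr_eq_map_contr {R₂ B₂ A₂ N₂ N₂' : Type*} [CommRing R₂] [CommRing B₂] [AddCommGroup A₂]
    [Module R₂ A₂] [AddCommGroup N₂] [Module R₂ N₂] [AddCommGroup N₂'] [Module B₂ N₂']
    {ρ₂ : R₂ →+* B₂} (φ : A →ₛₗ[ρ] B) (u : N →ₛₗ[ρ] N') (φ₂ : A₂ →ₛₗ[ρ₂] B₂)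
    (u₂ : N₂ →ₛₗ[ρ₂] N₂') (T : A ⊗[R] N →+ A₂ ⊗[R₂] N₂) (v : N' →+ N₂')
    (h : ∀ a n, contr φ₂ u₂ (T (a ⊗ₜ n)) = v (φ a • u n)) (x : A ⊗[R] N) :
    contr φ₂ u₂ (T x) = v (contr φ u x) := by
  induction x with
  | zero => simp
  | add x y hx hy => rw [map_add, map_add, map_add, map_add, hx, hy]
  | tmul a n => exact h a n

/-- The additive map `a ⊗ n ↦ φ a ⊗ u n` for semilinear maps. -/
def mapSemi {R₂ A₂ N₂ : Type*} [CommRing R₂] [AddCommGroup A₂]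
    [Module R₂ A₂] [AddCommGroup N₂] [Module R₂ N₂] {σ : R →+* R₂}
    (φ : A →ₛₗ[σ] A₂) (u : N →ₛₗ[σ] N₂) : A ⊗[R] N →+ A₂ ⊗[R₂] N₂ :=
  liftAddHom
    { toFun a :=
        { toFun n := φ a ⊗ₜ u n
          map_zero' := by rw [map_zero, tmul_zero]
          map_add' m n := by rw [map_add, tmul_add] }
      map_zero' := by ext; simp
      map_add' a b := by ext; simp [add_tmul] }
    (fun r a n ↦ by
      change φ (r • a) ⊗ₜ[R₂] u n = φ a ⊗ₜ u (r • n)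
      rw [map_smulₛₗ, map_smulₛₗ, smul_tmul])

/-- A semilinear map that exhibits `N'` as the base change of `N`. -/
def IsBaseChangeAlong (u : N →ₛₗ[ρ] N') : Prop :=
  ∀ [Algebra R B] [Module R N'] [IsScalarTower R B N'], algebraMap R B = ρ →
    ∀ u' : N →ₗ[R] N', (∀ n, u' n = u n) → IsBaseChange B u'

lemma rTensor_eq_zero_of_isBaseChange [Algebra R B] [Module R N'] [IsScalarTower R B N']
    {u : N →ₗ[R] N'} (hu : IsBaseChange B u) (φ : A →ₗ[R] B) (f : A ⊗[R] N →+ N')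
    (hf : ∀ a n, f (a ⊗ₜ n) = φ a • u n) (x : A ⊗[R] N) (hx : f x = 0) :
    φ.rTensor N x = 0 := by
  refine hu.equiv.injective ((map_zero hu.equiv).symm ▸ hx ▸ ?_)
  clear hx
  induction x with
  | zero => simp
  | add x y hx hy => simp only [map_add, hx, hy]
  | tmul a n => simp [hf, hu.equiv_tmul]

lemma exists_rTensor_eq [Module.Flat R N] {ι : Type*} [Finite ι] {B : ι → Type*}
    [∀ k, AddCommGroup (B k)] [∀ k, Module R (B k)] (φ : ∀ k, A →ₗ[R] B k) (g : A' →ₗ[R] A)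
    (hg : ∀ a, (∀ k, φ k a = 0) → a ∈ LinearMap.range g) (x : A ⊗[R] N)
    (hx : ∀ k, (φ k).rTensor N x = 0) : ∃ y, g.rTensor N y = x := by
  classical
  have := Fintype.ofFinite ι
  let Φ : A →ₗ[R] ∀ k, B k := LinearMap.pi φ
  have h1 : Φ.rTensor N x = 0 := by
    refine (piLeft R N B).injective (funext fun k ↦ ?_)
    have (x : A ⊗[R] N) : piLeft R N B (Φ.rTensor N x) k = (φ k).rTensor N x := by
      induction x with
      | zero => simp
      | add x y hx hy => simp only [map_add, Pi.add_apply, hx, hy]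
      | tmul a n => simp [Φ]
    rw [this, hx, map_zero]
    rfl
  have h2 : Function.Exact (LinearMap.ker Φ).subtype Φ := LinearMap.exact_subtype_ker_map Φ
  obtain ⟨y, rfl⟩ := (Module.Flat.rTensor_exact N h2 x).1 h1
  have h3 : LinearMap.ker Φ ≤ LinearMap.range g := fun a ha ↦ hg a fun k ↦ congrFun ha k
  obtain ⟨z, hz⟩ := LinearMap.rTensor_surjective N g.surjective_rangeRestrict
    ((Submodule.inclusion h3).rTensor N y)
  refine ⟨z, ?_⟩
  have h4 : g.rTensor N z = (LinearMap.range g).subtype.rTensor N (g.rangeRestrict.rTensor N z) := by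
    rw [← LinearMap.rTensor_comp_apply]
    rfl
  rw [h4, hz, ← LinearMap.rTensor_comp_apply]
  rfl

lemma exists_rTensor_eq_of_contr_eq_zero [Module.Flat R N] {ι : Type*} [Finite ι] {B : ι → Type*}
    [∀ k, CommRing (B k)] {N' : ι → Type*} [∀ k, AddCommGroup (N' k)] [∀ k, Module (B k) (N' k)]
    {ρ : ∀ k, R →+* B k} (φ : ∀ k, A →ₛₗ[ρ k] B k) (u : ∀ k, N →ₛₗ[ρ k] N' k)
    (hu : ∀ k, IsBaseChangeAlong (u k)) (g : A' →ₗ[R] A)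
    (hg : ∀ a, (∀ k, φ k a = 0) → a ∈ LinearMap.range g) (x : A ⊗[R] N)
    (hx : ∀ k, contr (φ k) (u k) x = 0) : ∃ y, g.rTensor N y = x := by
  let _ (k) : Algebra R (B k) := (ρ k).toAlgebra
  refine exists_rTensor_eq (B := B) (fun k ↦ { φ k with }) g hg x fun k ↦ ?_
  let _ : Module R (N' k) := Module.compHom _ (ρ k)
  have : IsScalarTower R (B k) (N' k) :=
    ⟨fun a b x ↦ SemigroupAction.mul_smul (ρ k a) b x⟩
  let u' : N →ₗ[R] N' k := { toFun := u k, map_add' := map_add _, map_smul' := map_smulₛₗ (u k) }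
  exact rTensor_eq_zero_of_isBaseChange (hu k rfl u' fun _ ↦ rfl) _ (contr (φ k) (u k))
    (fun a n ↦ rfl) x (hx k)

end TensorProduct

namespace AlgebraicGeometry.Scheme

lemma exists_finite_affine_cover {Y : Scheme.{u}} {C : Y.Opens} (hC : IsCompact (C : Set Y)) :
    ∃ s : Finset Y.Opens, (∀ W ∈ s, IsAffineOpen W ∧ W ≤ C) ∧ C ≤ ⨆ W : s, W.1 := by
  classical
  obtain ⟨s, hs, h⟩ := isCompact_and_isOpen_iff_finite_and_eq_biUnion_affineOpens.1 ⟨hC, C.isOpen⟩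
  refine ⟨hs.toFinset.image (·.1), fun W hW ↦ ?_, fun x hx ↦ ?_⟩
  · obtain ⟨W, hW', rfl⟩ := Finset.mem_image.1 hW
    refine ⟨W.2, fun x hx ↦ ?_⟩
    have : x ∈ (C : Set Y) := h ▸ Set.mem_biUnion (hs.mem_toFinset.1 hW') hx
    exact this
  · have : x ∈ (C : Set Y) := hx
    rw [h] at this
    obtain ⟨W, hW, hxW⟩ := Set.mem_iUnion₂.1 this
    exact TopologicalSpace.Opens.mem_iSup.2
      ⟨⟨W.1, Finset.mem_image.2 ⟨W, hs.mem_toFinset.2 hW, rfl⟩⟩, hxW⟩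

open TensorProduct in
lemma exists_rTensor_eq_of_isCompact {R A A' N : Type*} [CommRing R] [AddCommGroup A] [Module R A]
    [AddCommGroup A'] [Module R A'] [AddCommGroup N] [Module R N] [Module.Flat R N]
    {Y : Scheme.{u}} {O : Y.Opens} {L : Y.Modules} {ρ : ∀ W, W ≤ O → R →+* Γ(Y, W)}
    (hρ : ∀ W W' (h : W ≤ O) (h' : W' ≤ W) r, Y.res h' (ρ W h r) = ρ W' (h'.trans h) r)
    (u : ∀ W (h : W ≤ O), N →ₛₗ[ρ W h] Γ(L, W))
    (hu : ∀ W W' (h : W ≤ O) (h' : W' ≤ W) n, L.res h' (u W h n) = u W' (h'.trans h) n)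
    (hbc : ∀ W (h : W ≤ O), IsAffineOpen W → IsBaseChangeAlong (u W h))
    {ι : Type*} [Finite ι] (C : ι → Y.Opens) (hC : ∀ k, C k ≤ O)
    (hCc : ∀ k, IsCompact (C k : Set Y)) (φ : ∀ k, A →ₛₗ[ρ (C k) (hC k)] Γ(Y, C k))
    (g : A' →ₗ[R] A) (hg : ∀ a, (∀ k, φ k a = 0) → a ∈ LinearMap.range g) (x : A ⊗[R] N)
    (hx : ∀ k, contr (φ k) (u (C k) (hC k)) x = 0) : ∃ y, g.rTensor N y = x := by
  choose s hs hCs using fun k ↦ exists_finite_affine_cover (hCc k)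
  let φ' (k : Σ k, s k) : A →ₛₗ[ρ k.2.1 ((hs k.1 _ k.2.2).2.trans (hC k.1))] Γ(Y, k.2.1) :=
    { toFun a := Y.res (hs k.1 _ k.2.2).2 (φ k.1 a)
      map_add' a b := by rw [map_add, map_add]
      map_smul' r a := by rw [map_smulₛₗ, smul_eq_mul, map_mul, hρ, smul_eq_mul] }
  refine exists_rTensor_eq_of_contr_eq_zero (ι := Σ k, s k) (B := fun k ↦ Γ(Y, k.2.1)) φ'
    (fun k ↦ u k.2.1 _) (fun k ↦ hbc _ _ (hs k.1 _ k.2.2).1) g (fun a ha ↦ hg a fun k ↦ ?_) x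
    fun k ↦ ?_
  · exact Scheme.eq_of_res_eq (fun W : s k ↦ W.1) (fun W ↦ (hs k _ W.2).2) (hCs k) _ _ fun W ↦
      (ha ⟨k, W⟩).trans (map_zero _).symm
  · have := contr_eq_map_contr (φ k.1) (u (C k.1) (hC k.1)) (φ' k) (u k.2.1 _) (.id _)
      (L.res (hs k.1 _ k.2.2).2) (fun a n ↦ ?_) x
    · rw [hx, map_zero] at this
      exact this
    · rw [Modules.res_smul, hu]
      rfl

namespace Modules
variable {X Y : Scheme.{u}}

open TensorProduct

/-- Restriction of sections as a semilinear map. -/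
def resₛₗ (M : X.Modules) {U V : X.Opens} (h : U ≤ V) : Γ(M, V) →ₛₗ[X.res h] Γ(M, U) where
  toFun := M.res h
  map_add' := map_add _
  map_smul' := M.res_smul h

@[simp] lemma resₛₗ_apply (M : X.Modules) {U V : X.Opens} (h : U ≤ V) (m : Γ(M, V)) :
    M.resₛₗ h m = M.res h m :=
  rfl

/-- Pull-back of sections as a semilinear map over the pull-back of functions. -/
def pullₛₗ (M : X.Modules) (f : Y ⟶ X) {V : X.Opens} {W : Y.Opens} (h : W ≤ f ⁻¹ᵁ V) :
    Γ(M, V) →ₛₗ[pull f h] Γ((pullback f).obj M, W) :=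
  M.pullSec f h

@[simp] lemma pullₛₗ_apply (M : X.Modules) (f : Y ⟶ X) {V : X.Opens} {W : Y.Opens}
    (h : W ≤ f ⁻¹ᵁ V) (m : Γ(M, V)) : M.pullₛₗ f h m = M.pullSec f h m :=
  rfl

lemma isBaseChangeAlong_resₛₗ (M : X.Modules) [M.IsQuasicoherent] {V W : X.Opens}
    (hV : IsAffineOpen V) (hW : IsAffineOpen W) (h : W ≤ V) :
    IsBaseChangeAlong (M.resₛₗ h) := fun hρ u hu ↦
  isBaseChange_res M hV hW h hρ u hu

lemma isBaseChangeAlong_pullₛₗ (M : X.Modules) [M.IsQuasicoherent] (f : Y ⟶ X) {V : X.Opens}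
    (hV : IsAffineOpen V) {W : Y.Opens} (hW : IsAffineOpen W) (h : W ≤ f ⁻¹ᵁ V) :
    IsBaseChangeAlong (M.pullₛₗ f h) := fun hρ u hu ↦
  isBaseChange_pullSec M f hV hW h hρ u hu

variable {F : X.Modules} [F.IsQuasicoherent] (hF : F.IsFlat) {V : X.Opens} (hV : IsAffineOpen V)
  {A A' : Type u} [AddCommGroup A] [Module Γ(X, V) A] [AddCommGroup A'] [Module Γ(X, V) A']
  {ι : Type*} [Finite ι]

include hF hV

lemma exists_rTensor_eq_of_contr_res (C : ι → X.Opens) (hC : ∀ k, C k ≤ V)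
    (hCc : ∀ k, IsCompact (C k : Set X)) (φ : ∀ k, A →ₛₗ[X.res (hC k)] Γ(X, C k))
    (g : A' →ₗ[Γ(X, V)] A) (hg : ∀ a, (∀ k, φ k a = 0) → a ∈ LinearMap.range g)
    (x : A ⊗[Γ(X, V)] Γ(F, V)) (hx : ∀ k, contr (φ k) (F.resₛₗ (hC k)) x = 0) :
    ∃ y, g.rTensor _ y = x := by
  have := IsFlat.flat hV hF
  exact exists_rTensor_eq_of_isCompact (O := V) (ρ := fun W h ↦ X.res h)
    (fun _ _ _ _ _ ↦ Scheme.res_res _ _ _) (fun W h ↦ F.resₛₗ h)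
    (fun _ _ _ _ _ ↦ res_res _ _ _ _) (fun W h hW ↦ isBaseChangeAlong_resₛₗ F hV hW h)
    C hC hCc φ g hg x hx

lemma exists_rTensor_eq_of_contr_pullSec (f : Y ⟶ X) (C : ι → Y.Opens) (hC : ∀ k, C k ≤ f ⁻¹ᵁ V)
    (hCc : ∀ k, IsCompact (C k : Set Y)) (φ : ∀ k, A →ₛₗ[pull f (hC k)] Γ(Y, C k))
    (g : A' →ₗ[Γ(X, V)] A) (hg : ∀ a, (∀ k, φ k a = 0) → a ∈ LinearMap.range g)
    (x : A ⊗[Γ(X, V)] Γ(F, V)) (hx : ∀ k, contr (φ k) (F.pullₛₗ f (hC k)) x = 0) :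
    ∃ y, g.rTensor _ y = x := by
  have := IsFlat.flat hV hF
  exact exists_rTensor_eq_of_isCompact (O := f ⁻¹ᵁ V) (ρ := fun W h ↦ pull f h)
    (fun _ _ _ _ _ ↦ res_pull _ _ _ _) (fun W h ↦ F.pullₛₗ f h)
    (fun _ _ _ _ _ ↦ res_pullSec _ _ _ _ _) (fun W h hW ↦ isBaseChangeAlong_pullₛₗ F f hV hW h)
    C hC hCc φ g hg x hx

end Modules
end AlgebraicGeometry.Scheme

namespace AlgebraicGeometry.Scheme
variable {X Y : Scheme.{u}} {P : Type u}

/-- Families of functions on the intersections of an open subset with the members of a family of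
open subsets. -/
def SecFam (U : P → X.Opens) (V : X.Opens) : Type u :=
  ∀ p, Γ(X, U p ⊓ V)

namespace SecFam
variable {U : P → X.Opens} {V V' V'' : X.Opens}

instance : AddCommGroup (SecFam U V) :=
  inferInstanceAs (AddCommGroup (∀ p, Γ(X, U p ⊓ V)))

instance : Module Γ(X, V) (SecFam U V) :=
  Module.compHom (∀ p, Γ(X, U p ⊓ V))
    (RingHom.pi fun p ↦ X.res (inf_le_right : U p ⊓ V ≤ V))

/-- The family with given components. -/
def mk (e : ∀ p, Γ(X, U p ⊓ V)) : SecFam U V := e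

@[simp] lemma mk_apply (e : ∀ p, Γ(X, U p ⊓ V)) (p : P) : mk e p = e p := rfl

@[ext] lemma ext {e e' : SecFam U V} (h : ∀ p, e p = e' p) : e = e' := funext h

@[simp] lemma add_apply (e e' : SecFam U V) (p : P) : (e + e') p = e p + e' p := rfl
@[simp] lemma zero_apply (p : P) : (0 : SecFam U V) p = 0 := rfl
@[simp] lemma smul_apply (r : Γ(X, V)) (e : SecFam U V) (p : P) :
    (r • e) p = X.res inf_le_right r * e p := rfl

/-- The components of a family. -/
def proj (p : P) : SecFam U V →ₛₗ[X.res (inf_le_right : U p ⊓ V ≤ V)] Γ(X, U p ⊓ V) where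
  toFun e := e p
  map_add' _ _ := rfl
  map_smul' _ _ := rfl

@[simp] lemma proj_apply (p : P) (e : SecFam U V) : proj p e = e p := rfl

/-- Restriction of families. -/
def res (h : V' ≤ V) : SecFam U V →ₛₗ[X.res h] SecFam U V' where
  toFun e := mk fun p ↦ X.res (inf_le_inf_left (U p) h) (e p)
  map_add' e e' := by ext p; simp
  map_smul' r e := by ext p; simp

@[simp] lemma res_apply (h : V' ≤ V) (e : SecFam U V) (p : P) :
    res h e p = X.res (inf_le_inf_left (U p) h) (e p) := rfl

@[simp] lemma res_res (h : V'' ≤ V') (h' : V' ≤ V) (e : SecFam U V) :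
    res h (res h' e) = res (h.trans h') e := by
  ext p
  simp

@[simp] lemma res_self (h : V ≤ V) (e : SecFam U V) : res h e = e := by
  ext p
  simp

open Classical in
/-- Truncation of families. -/
def trunc (K : Finset P) : SecFam U V →ₗ[Γ(X, V)] SecFam U V where
  toFun e := mk fun p ↦ if p ∈ K then e p else 0
  map_add' e e' := by ext p; by_cases h : p ∈ K <;> simp [h]
  map_smul' r e := by ext p; by_cases h : p ∈ K <;> simp [h]

lemma trunc_apply_of_mem {K : Finset P} {p : P} (hp : p ∈ K) (e : SecFam U V) :
    trunc K e p = e p := if_pos hp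

lemma trunc_apply_of_notMem {K : Finset P} {p : P} (hp : p ∉ K) (e : SecFam U V) :
    trunc K e p = 0 := if_neg hp

lemma res_trunc (K : Finset P) (h : V' ≤ V) (e : SecFam U V) :
    res h (trunc K e) = trunc K (res h e) := by
  ext p
  by_cases hp : p ∈ K <;> simp [hp, trunc_apply_of_mem, trunc_apply_of_notMem]

lemma trunc_trunc {K L : Finset P} (h : K ⊆ L) (e : SecFam U V) :
    trunc K (trunc L e) = trunc K e := by
  ext p
  by_cases hp : p ∈ K
  · simp [trunc_apply_of_mem, hp, h hp]
  · simp [trunc_apply_of_notMem, hp]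

lemma trunc_eq_self {K : Finset P} {e : SecFam U V} (h : ∀ p ∉ K, e p = 0) : trunc K e = e := by
  ext p
  by_cases hp : p ∈ K
  · simp [trunc_apply_of_mem, hp]
  · simp [trunc_apply_of_notMem, hp, h p hp]

lemma exists_pow_smul_eq_zero {K : Finset P} (b : Γ(X, V))
    (hc : ∀ p ∈ K, IsCompact ((U p ⊓ V : X.Opens) : Set X)) (e : SecFam U V) (he : ∀ p ∉ K, e p = 0)
    (h : res (X.basicOpen_le b) e = 0) : ∃ n : ℕ, b ^ n • e = 0 := by
  have key (p : P) (hp : p ∈ K) : ∃ n : ℕ, X.res inf_le_right b ^ n * e p = 0 := by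
    refine exists_pow_mul_eq_zero_of_res_basicOpen_eq_zero_of_isCompact X (hc p hp) _ _ ?_
    have h1 : X.basicOpen (X.res (inf_le_right : U p ⊓ V ≤ V) b) ≤ U p ⊓ X.basicOpen b :=
      (X.basicOpen_res b (homOfLE (inf_le_right : U p ⊓ V ≤ V)).op).le.trans
        (inf_le_inf_right _ inf_le_left)
    refine (X.res_res h1 (inf_le_inf_left _ (X.basicOpen_le b)) (e p)).symm.trans ?_
    exact (congrArg (X.res h1) (congrFun h p)).trans (map_zero _)
  choose! n hn using key
  refine ⟨∑ p ∈ K, n p, ?_⟩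
  ext p
  by_cases hp : p ∈ K
  · obtain ⟨k, hk⟩ := Nat.exists_eq_add_of_le (Finset.single_le_sum (f := n) (fun _ _ ↦ Nat.zero_le _) hp)
    rw [smul_apply, map_pow, hk, pow_add, mul_right_comm, hn p hp, zero_mul, zero_apply]
  · rw [smul_apply, he p hp, mul_zero, zero_apply]

lemma exists_res_eq_pow_smul {K : Finset P} (b : Γ(X, V))
    (hc : ∀ p ∈ K, IsCompact ((U p ⊓ V : X.Opens) : Set X))
    (hq : ∀ p ∈ K, IsQuasiSeparated ((U p ⊓ V : X.Opens) : Set X))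
    (e : SecFam U (X.basicOpen b)) (he : ∀ p ∉ K, e p = 0) :
    ∃ (n : ℕ) (m : SecFam U V), (∀ p ∉ K, m p = 0) ∧
      res (X.basicOpen_le b) m = X.res (X.basicOpen_le b) b ^ n • e := by
  have key (p : P) (hp : p ∈ K) : ∃ (n : ℕ) (m : Γ(X, U p ⊓ V)),
      X.res (inf_le_inf_left _ (X.basicOpen_le b)) m = X.res (inf_le_right.trans (X.basicOpen_le b)) b ^ n * e p := by
    have h1 : X.basicOpen (X.res (inf_le_right : U p ⊓ V ≤ V) b) = U p ⊓ X.basicOpen b := by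
      refine (X.basicOpen_res b (homOfLE (inf_le_right : U p ⊓ V ≤ V)).op).trans ?_
      rw [inf_assoc, inf_eq_right.2 (X.basicOpen_le b)]
    obtain ⟨n, m, hm⟩ := exists_eq_pow_mul_of_isCompact_of_isQuasiSeparated X (U p ⊓ V) (hc p hp)
      (hq p hp) (X.res inf_le_right b) (X.res h1.le (e p))
    refine ⟨n, m, ?_⟩
    replace hm : X.res (X.basicOpen_le _) m = X.res (X.basicOpen_le _) (X.res inf_le_right b) ^ n *
      X.res h1.le (e p) := hm
    simpa using congrArg (X.res h1.ge) hm
  choose! n m hm using key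
  refine ⟨∑ p ∈ K, n p, trunc K (mk fun p ↦ X.res inf_le_right b ^ (∑ p ∈ K, n p - n p) * m p),
    fun p hp ↦ trunc_apply_of_notMem hp _, ?_⟩
  ext p
  by_cases hp : p ∈ K
  · rw [res_apply, trunc_apply_of_mem hp, mk_apply, map_mul, hm p hp, smul_apply, map_pow, map_pow, ← mul_assoc,
      Scheme.res_res, Scheme.res_res, ← pow_add, Nat.sub_add_cancel
      (Finset.single_le_sum (f := n) (fun _ _ ↦ Nat.zero_le _) hp)]
  · rw [res_apply, trunc_apply_of_notMem hp, smul_apply, he p hp, mul_zero, map_zero]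

end SecFam

/-- A sheaf of submodules of the sheaf of families of functions, of coherent type, supported
on finitely many indices. -/
@[ext]
structure SubFam (U : P → X.Opens) where
  supp : Finset P
  sec (V : X.Opens) : Submodule Γ(X, V) (SecFam U V)
  eq_zero : ∀ {V} {e}, e ∈ sec V → ∀ p ∉ supp, e p = 0
  res_mem : ∀ {V V' : X.Opens} (h : V' ≤ V) {e}, e ∈ sec V → SecFam.res h e ∈ sec V'
  mem_of_res_mem : ∀ {V : X.Opens} (e : SecFam U V),
    (∀ x ∈ V, ∃ (V' : X.Opens) (h : V' ≤ V), x ∈ V' ∧ SecFam.res h e ∈ sec V') → e ∈ sec V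
  exists_pow_smul_mem : ∀ {V : X.Opens} (_ : IsAffineOpen V) (b : Γ(X, V)) (e : SecFam U V),
    (∀ p ∉ supp, e p = 0) → SecFam.res (X.basicOpen_le b) e ∈ sec (X.basicOpen b) →
      ∃ n : ℕ, b ^ n • e ∈ sec V
  fg : ∀ {V : X.Opens}, IsAffineOpen V → (sec V).FG

namespace SubFam
variable {U : P → X.Opens} (S : SubFam U)

/-- The restriction maps. -/
def res {V V' : X.Opens} (h : V' ≤ V) : S.sec V →ₛₗ[X.res h] S.sec V' where
  toFun e := ⟨SecFam.res h e.1, S.res_mem h e.2⟩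
  map_add' _ _ := Subtype.ext (map_add _ _ _)
  map_smul' r e := Subtype.ext (map_smulₛₗ (SecFam.res h) r e.1)

@[simp] lemma coe_res {V V' : X.Opens} (h : V' ≤ V) (e : S.sec V) :
    (S.res h e).1 = SecFam.res h e.1 := rfl

instance secModule (V : X.Opensᵒᵖ) : Module (X.ringCatSheaf.obj.obj V) (S.sec V.unop) :=
  inferInstanceAs (Module Γ(X, V.unop) (S.sec V.unop))

/-- The presheaf of modules. -/
def presheaf : X.PresheafOfModules where
  obj V := ModuleCat.of (X.ringCatSheaf.obj.obj V) (S.sec V.unop)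
  map {V V'} i := ModuleCat.ofHom
      (Y := (ModuleCat.restrictScalars (X.ringCatSheaf.obj.map i).hom).obj
        (ModuleCat.of (X.ringCatSheaf.obj.obj V') (S.sec V'.unop)))
      { toFun := S.res i.unop.le
        map_add' := map_add _
        map_smul' := map_smulₛₗ (S.res i.unop.le) }
  map_id V := by
    refine ModuleCat.hom_ext (LinearMap.ext fun e ↦ ?_)
    exact Subtype.ext (SecFam.res_self _ _)
  map_comp i j := by
    refine ModuleCat.hom_ext (LinearMap.ext fun e ↦ ?_)
    exact Subtype.ext (SecFam.res_res _ _ _).symm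

lemma existsUnique_res_eq {ι : Type u} (W : ι → X.Opens) (e : ∀ i, S.sec (W i))
    (h : ∀ i j, S.res (inf_le_left : W i ⊓ W j ≤ W i) (e i) = S.res inf_le_right (e j)) :
    ∃! t : S.sec (⨆ i, W i), ∀ i, S.res (le_iSup W i) t = e i := by
  have hcov (p : P) : U p ⊓ (⨆ i, W i) ≤ ⨆ i, U p ⊓ W i := inf_iSup_eq (U p) W |>.le
  have key (p : P) := Scheme.exists_res_eq (X := X) (V := U p ⊓ ⨆ i, W i)
    (fun i ↦ U p ⊓ W i) (fun i ↦ inf_le_inf_left _ (le_iSup W i)) (hcov p) (fun i ↦ (e i).1 p)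
    (fun i j ↦ by
      have h1 := congrFun (congrArg Subtype.val (h i j)) p
      have h2 : (U p ⊓ W i) ⊓ (U p ⊓ W j) ≤ U p ⊓ (W i ⊓ W j) :=
        le_inf (inf_le_left.trans inf_le_left) (inf_le_inf inf_le_right inf_le_right)
      have h3 := congrArg (X.res h2) h1
      simpa using h3)
  choose t ht using key
  have ht' (i) : SecFam.res (le_iSup W i) t = (e i).1 := SecFam.ext fun p ↦ ht p i
  refine ⟨⟨t, S.mem_of_res_mem t fun x hx ↦ ?_⟩, fun i ↦ Subtype.ext (ht' i), fun t' h' ↦ ?_⟩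
  · obtain ⟨i, hi⟩ := TopologicalSpace.Opens.mem_iSup.1 hx
    exact ⟨W i, le_iSup W i, hi, ht' i ▸ (e i).2⟩
  · refine Subtype.ext (SecFam.ext fun p ↦ ?_)
    refine Scheme.eq_of_res_eq (fun i ↦ U p ⊓ W i) (fun i ↦ inf_le_inf_left _ (le_iSup W i))
      (hcov p) _ _ fun i ↦ ?_
    rw [ht p i]
    exact congrFun (congrArg Subtype.val (h' i)) p

/-- The sheaf of modules. -/
def sheaf : X.Modules where
  val := S.presheaf
  isSheaf := (TopCat.Presheaf.isSheaf_iff_isSheafUniqueGluing S.presheaf.presheaf).2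
    fun _ W e h ↦ S.existsUnique_res_eq W e h

/-- Sections of the sheaf. -/
def toSheaf (V : X.Opens) : S.sec V ≃ₗ[Γ(X, V)] Γ(S.sheaf, V) := .refl _ _

theorem isCoherent_sheaf [IsNoetherian X] : S.sheaf.IsCoherent := by
  have hc (W : X.Opens) : IsCompact (W : Set X) :=
    TopologicalSpace.NoetherianSpace.isCompact (W : Set X)
  refine Modules.isCoherent_of_forall_isAffineOpen _ (fun V hV b s ↦ ?_) (fun V hV b m hm ↦ ?_)
    fun V hV ↦ ?_
  · obtain ⟨s, rfl⟩ := (S.toSheaf _).surjective s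
    obtain ⟨n, m, hm0, hm⟩ := SecFam.exists_res_eq_pow_smul (K := S.supp) b (fun p _ ↦ hc _)
      (fun p _ ↦ .of_quasiSeparatedSpace _) s.1 (S.eq_zero s.2)
    obtain ⟨k, hk⟩ := S.exists_pow_smul_mem hV b m hm0 (hm ▸ (S.sec _).smul_mem _ s.2)
    refine ⟨k + n, S.toSheaf V ⟨_, hk⟩, ?_⟩
    refine congrArg (S.toSheaf _) (Subtype.ext ?_ :
      S.res (X.basicOpen_le b) ⟨b ^ k • m, hk⟩ = X.res (X.basicOpen_le b) b ^ (k + n) • s)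
    rw [coe_res, map_smulₛₗ, hm, map_pow, pow_add, mul_smul]
    rfl
  · obtain ⟨m, rfl⟩ := (S.toSheaf _).surjective m
    obtain ⟨n, hn⟩ := SecFam.exists_pow_smul_eq_zero b (fun p _ ↦ hc _) m.1 (S.eq_zero m.2)
      (congrArg Subtype.val hm)
    exact ⟨n, congrArg (S.toSheaf _) (Subtype.ext hn : b ^ n • m = 0)⟩
  · have : Module.Finite Γ(X, V) (S.sec V) := Module.Finite.iff_fg.2 (S.fg hV)
    exact Module.Finite.equiv (S.toSheaf V)

end SubFam
end AlgebraicGeometry.Scheme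

namespace AlgebraicGeometry.Scheme.SubFam
open TensorProduct
variable {X Y : Scheme.{u}} {P : Type u} {U : P → X.Opens} (S T : SubFam U)

/-- The components of sections. -/
def proj {V : X.Opens} (p : P) : S.sec V →ₛₗ[X.res (inf_le_right : U p ⊓ V ≤ V)] Γ(X, U p ⊓ V) :=
  (SecFam.proj p).comp (S.sec V).subtype

instance : PartialOrder (SubFam U) where
  le S T := S.supp ⊆ T.supp ∧ ∀ V, ∀ e ∈ T.sec V, SecFam.trunc S.supp e ∈ S.sec V
  le_refl S := ⟨subset_rfl, fun _ e he ↦ by rwa [SecFam.trunc_eq_self (S.eq_zero he)]⟩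
  le_trans S T R h h' := ⟨h.1.trans h'.1, fun V e he ↦ by
    rw [← SecFam.trunc_trunc h.1]
    exact h.2 V _ (h'.2 V e he)⟩
  le_antisymm S T h h' := by
    have hs := h.1.antisymm h'.1
    refine SubFam.ext hs (funext fun V ↦ le_antisymm (fun e he ↦ ?_) fun e he ↦ ?_)
    · have := h'.2 V e he
      rwa [SecFam.trunc_eq_self (hs ▸ S.eq_zero he)] at this
    · have := h.2 V e he
      rwa [SecFam.trunc_eq_self (hs ▸ T.eq_zero he)] at this

variable {S T} in
/-- The truncation map. -/
def truncMap (h : S ≤ T) (V : X.Opens) : T.sec V →ₗ[Γ(X, V)] S.sec V where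
  toFun e := ⟨SecFam.trunc S.supp e.1, h.2 V _ e.2⟩
  map_add' _ _ := Subtype.ext (map_add _ _ _)
  map_smul' _ _ := Subtype.ext (map_smul _ _ _)

variable {S T} in
/-- The truncation map of sheaves. -/
def truncHom (h : S ≤ T) : T.sheaf ⟶ S.sheaf :=
  Modules.homMk (M := T.sheaf) (N := S.sheaf) (fun V ↦ truncMap h V) fun _ _ h' e ↦
    Subtype.ext (SecFam.res_trunc S.supp h' (T.toSheaf _ |>.symm e).1).symm

lemma truncHom_refl (h : S ≤ S) : truncHom h = 𝟙 S.sheaf := by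
  refine Modules.hom_ext _ _ fun V ↦ ?_
  ext e
  obtain ⟨e, rfl⟩ := (S.toSheaf V).surjective e
  exact congrArg (S.toSheaf V) (Subtype.ext (SecFam.trunc_eq_self (S.eq_zero e.2)))

variable {S T} in
lemma truncHom_comp {R : SubFam U} (h : S ≤ T) (h' : T ≤ R) (h'' : S ≤ R) :
    truncHom h' ≫ truncHom h = truncHom h'' := by
  refine Modules.hom_ext _ _ fun V ↦ ?_
  ext e
  obtain ⟨e, rfl⟩ := (R.toSheaf V).surjective e
  exact congrArg (S.toSheaf V) (Subtype.ext (SecFam.trunc_trunc h.1 _))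

/-- A family of submodules of a coherent one. -/
def ofLE [IsNoetherian X] (K : Finset P) (sec : ∀ V : X.Opens, Submodule Γ(X, V) (SecFam U V))
    (hK : ∀ {V} {e}, e ∈ sec V → ∀ p ∉ K, e p = 0)
    (hres : ∀ {V V' : X.Opens} (h : V' ≤ V) {e}, e ∈ sec V → SecFam.res h e ∈ sec V')
    (hloc : ∀ {V : X.Opens} (e : SecFam U V),
      (∀ x ∈ V, ∃ (V' : X.Opens) (h : V' ≤ V), x ∈ V' ∧ SecFam.res h e ∈ sec V') → e ∈ sec V)
    (hext : ∀ {V : X.Opens} (_ : IsAffineOpen V) (b : Γ(X, V)) (e : SecFam U V),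
      (∀ p ∉ K, e p = 0) → SecFam.res (X.basicOpen_le b) e ∈ sec (X.basicOpen b) →
        ∃ n : ℕ, b ^ n • e ∈ sec V)
    (hfin : ∀ {V : X.Opens}, IsAffineOpen V → ∃ (M : Type u) (_ : AddCommGroup M)
      (_ : Module Γ(X, V) M) (_ : Module.Finite Γ(X, V) M) (j : sec V →ₗ[Γ(X, V)] M),
      Function.Injective j) : SubFam U where
  supp := K
  sec := sec
  eq_zero := hK
  res_mem := hres
  mem_of_res_mem := hloc
  exists_pow_smul_mem := hext
  fg {V} hV := by
    obtain ⟨M, _, _, _, j, hj⟩ := hfin hV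
    have : IsNoetherianRing Γ(X, V) := IsLocallyNoetherian.component_noetherian ⟨V, hV⟩
    exact Module.Finite.iff_fg.1 (Module.Finite.of_injective j hj)

section tensor
variable {F : X.Modules} (f : ∀ p, Γ(F, U p)) {S T}

/-- A tensor that represents the given sections. -/
def IsTensor (S : SubFam U) {V : X.Opens} (t : S.sec V ⊗[Γ(X, V)] Γ(F, V)) : Prop :=
  ∀ p ∈ S.supp, contr (S.proj p) (F.resₛₗ inf_le_right) t = F.res inf_le_left (f p)

variable (F) in
/-- The restriction of tensors. -/
def tensorRes (S : SubFam U) {V V' : X.Opens} (h : V' ≤ V) :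
    S.sec V ⊗[Γ(X, V)] Γ(F, V) →+ S.sec V' ⊗[Γ(X, V')] Γ(F, V') :=
  mapSemi (S.res h) (F.resₛₗ h)

/-- Locally the given sections are represented by tensors. -/
def HasTensor (S : SubFam U) : Prop :=
  ∀ x : X, ∃ V : X.Opens, x ∈ V ∧ IsAffineOpen V ∧
    ∃ t : S.sec V ⊗[Γ(X, V)] Γ(F, V), S.IsTensor f t

variable {f}

lemma IsTensor.res {V V' : X.Opens} {t : S.sec V ⊗[Γ(X, V)] Γ(F, V)} (ht : S.IsTensor f t)
    (h : V' ≤ V) : S.IsTensor f (S.tensorRes F h t) := by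
  intro p hp
  refine (contr_eq_map_contr (S.proj p) (F.resₛₗ inf_le_right) (S.proj p) (F.resₛₗ inf_le_right)
    (S.tensorRes F h) (F.res (inf_le_inf_left (U p) h)) (fun a n ↦ ?_) t).trans ?_
  · rw [Modules.res_smul, Modules.resₛₗ_apply, Modules.res_res]
    have h1 : F.res (inf_le_right : U p ⊓ V' ≤ V') (F.res h n) =
      F.res (inf_le_right.trans h) n := Modules.res_res F _ _ n
    exact congrArg (S.proj p (S.res h a) • ·) h1
  · rw [ht p hp, Modules.res_res]

lemma IsTensor.rTensor {V : X.Opens} {t : T.sec V ⊗[Γ(X, V)] Γ(F, V)} (ht : T.IsTensor f t)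
    (hST : S.supp ⊆ T.supp) (g : T.sec V →ₗ[Γ(X, V)] S.sec V)
    (hg : ∀ e, ∀ p ∈ S.supp, (g e).1 p = e.1 p) : S.IsTensor f (g.rTensor _ t) := by
  intro p hp
  rw [contr_rTensor (S.proj p) (F.resₛₗ inf_le_right) g (T.proj p) (fun e ↦ (hg e p hp).symm),
    ht p (hST hp)]

lemma IsTensor.truncMap {V : X.Opens} {t : T.sec V ⊗[Γ(X, V)] Γ(F, V)} (ht : T.IsTensor f t)
    (h : S ≤ T) : S.IsTensor f ((truncMap h V).rTensor _ t) :=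
  ht.rTensor h.1 _ fun _ _ hp ↦ SecFam.trunc_apply_of_mem hp _

lemma HasTensor.exists_le (hS : S.HasTensor f) {V : X.Opens} {x : X} (hx : x ∈ V) :
    ∃ V' : X.Opens, V' ≤ V ∧ x ∈ V' ∧ IsAffineOpen V' ∧
      ∃ t : S.sec V' ⊗[Γ(X, V')] Γ(F, V'), S.IsTensor f t := by
  obtain ⟨V₁, hx₁, -, t, ht⟩ := hS x
  obtain ⟨V', hV', hxV', hle⟩ := exists_isAffineOpen_mem_and_subset (U := V ⊓ V₁) ⟨hx, hx₁⟩
  exact ⟨V', hle.trans inf_le_left, hxV', hV', _, ht.res (hle.trans inf_le_right)⟩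

variable [IsNoetherian X] [F.IsQuasicoherent] (hF : F.IsFlat)
include hF

lemma IsTensor.unique {V : X.Opens} (hV : IsAffineOpen V) {t t' : S.sec V ⊗[Γ(X, V)] Γ(F, V)}
    (ht : S.IsTensor f t) (ht' : S.IsTensor f t') : t = t' := by
  have h0 (p : S.supp) : contr (S.proj p.1) (F.resₛₗ inf_le_right) (t - t') = 0 := by
    rw [map_sub, ht p.1 p.2, ht' p.1 p.2, sub_self]
  have h1 (e : S.sec V) (he : ∀ p : S.supp, S.proj p.1 e = 0) : e = 0 := by
    refine Subtype.ext (SecFam.ext fun p ↦ ?_)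
    by_cases hp : p ∈ S.supp
    · exact he ⟨p, hp⟩
    · exact S.eq_zero e.2 p hp
  obtain ⟨y, hy⟩ := Modules.exists_rTensor_eq_of_contr_res hF hV (ι := S.supp)
    (fun p ↦ U p.1 ⊓ V) (fun p ↦ inf_le_right)
    (fun p ↦ TopologicalSpace.NoetherianSpace.isCompact _)
    (fun p ↦ S.proj p.1) (0 : S.sec V →ₗ[Γ(X, V)] S.sec V)
    (fun e he ↦ ⟨0, (h1 e he).symm⟩) (t - t') h0
  rw [LinearMap.rTensor_zero, LinearMap.zero_apply] at hy
  exact sub_eq_zero.1 hy.symm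

/-- A finite family of homomorphisms that kills the given sections vanishes on a smaller
family. -/
lemma exists_le_of_contr_eq_zero (hS : S.HasTensor f) (g : Y ⟶ X) {ι : Type*} [Finite ι]
    (W : ι → Y.Opens) (hW : ∀ k V, IsAffineOpen V → IsCompact ((g ⁻¹ᵁ V ⊓ W k : Y.Opens) : Set Y))
    (a : ∀ k V, S.sec V →ₛₗ[pull g (inf_le_left : g ⁻¹ᵁ V ⊓ W k ≤ g ⁻¹ᵁ V)] Γ(Y, g ⁻¹ᵁ V ⊓ W k))
    (ha : ∀ k (V V' : X.Opens) (h : V' ≤ V) e,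
      a k V' (S.res h e) = Y.res (inf_le_inf_right _ (g.preimage_mono h)) (a k V e))
    (h0 : ∀ k V, IsAffineOpen V → ∀ t : S.sec V ⊗[Γ(X, V)] Γ(F, V), S.IsTensor f t →
      contr (a k V) (F.pullₛₗ g inf_le_left) t = 0) :
    ∃ T : SubFam U, T.HasTensor f ∧ S ≤ T ∧ T.supp = S.supp ∧
      ∀ V e, e ∈ T.sec V → ∃ he : e ∈ S.sec V, ∀ k, a k V ⟨e, he⟩ = 0 := by
  classical
  have := Fintype.ofFinite ι
  let N (V) : Submodule Γ(X, V) (S.sec V) := ⨅ k, LinearMap.ker (a k V)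
  have hN {V} (e : S.sec V) : e ∈ N V ↔ ∀ k, a k V e = 0 := by simp [N]
  let T : SubFam U := ofLE S.supp (fun V ↦ (N V).map (S.sec V).subtype) ?_ ?_ ?_ ?_ ?_
  · have hT : ∀ V e, e ∈ T.sec V → ∃ he : e ∈ S.sec V, ∀ k, a k V ⟨e, he⟩ = 0 := by
      rintro V _ ⟨e, he, rfl⟩
      exact ⟨e.2, (hN e).1 he⟩
    refine ⟨T, fun x ↦ ?_, ⟨subset_rfl, fun V e he ↦ ?_⟩, rfl, hT⟩
    · obtain ⟨V, hx, hV, t, ht⟩ := hS x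
      refine ⟨V, hx, hV, ?_⟩
      let j : T.sec V →ₗ[Γ(X, V)] S.sec V :=
        Submodule.inclusion (Submodule.map_subtype_le _ _)
      obtain ⟨y, rfl⟩ := Modules.exists_rTensor_eq_of_contr_pullSec hF hV g
        (fun k ↦ g ⁻¹ᵁ V ⊓ W k) (fun k ↦ inf_le_left) (fun k ↦ hW k V hV) (fun k ↦ a k V) j
        (fun e he ↦ ⟨⟨e.1, e, (hN e).2 he, rfl⟩, rfl⟩) t (fun k ↦ h0 k V hV t ht)
      refine ⟨y, fun p hp ↦ ?_⟩
      rw [← ht p hp, contr_rTensor (S.proj p) (F.resₛₗ inf_le_right) j (T.proj p) fun _ ↦ rfl]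
    · have := (hT V e he).1
      change SecFam.trunc S.supp e ∈ _
      rwa [SecFam.trunc_eq_self (S.eq_zero this)]
  · rintro V _ ⟨e, he, rfl⟩
    exact S.eq_zero e.2
  · rintro V V' h _ ⟨e, he, rfl⟩
    refine ⟨S.res h e, (hN _).2 fun k ↦ ?_, rfl⟩
    rw [ha, (hN e).1 he, map_zero]
  · intro V e h
    choose! V' hle hx e' he' hee using h
    have he : e ∈ S.sec V := S.mem_of_res_mem e fun x hx' ↦
      ⟨V' x, hle x hx', hx x hx', by rw [← hee x hx']; exact (e' x).2⟩
    refine ⟨⟨e, he⟩, (hN _).2 fun k ↦ ?_, rfl⟩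
    refine Scheme.eq_of_res_eq (ι := {x // x ∈ V}) (fun x ↦ g ⁻¹ᵁ (V' x) ⊓ W k)
      (fun x ↦ inf_le_inf_right _ (g.preimage_mono (hle x x.2)))
      (fun y hy ↦ TopologicalSpace.Opens.mem_iSup.2 ⟨⟨g y, hy.1⟩, hx _ hy.1, hy.2⟩) _ _ fun x ↦ ?_
    rw [map_zero, ← ha k V (V' x) (hle x x.2)]
    have : S.res (hle x x.2) ⟨e, he⟩ = e' x := Subtype.ext (hee x x.2).symm
    rw [this]
    exact (hN _).1 (he' x x.2) k
  · rintro V hV b e hK ⟨e', he', hee⟩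
    have hmem : SecFam.res (X.basicOpen_le b) e ∈ S.sec _ := by rw [← hee]; exact e'.2
    obtain ⟨n, hn⟩ := S.exists_pow_smul_mem hV b e hK hmem
    have key (k) : ∃ m : ℕ, pull g inf_le_left b ^ m * a k V ⟨_, hn⟩ = 0 := by
      refine exists_pow_mul_eq_zero_of_res_basicOpen_eq_zero_of_isCompact Y (hW k V hV) _ _ ?_
      have h1 : Y.basicOpen (pull g (inf_le_left : g ⁻¹ᵁ V ⊓ W k ≤ g ⁻¹ᵁ V) b) ≤
          g ⁻¹ᵁ (X.basicOpen b) ⊓ W k := by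
        refine le_inf ?_ ((Y.basicOpen_le _).trans inf_le_right)
        have h2 : pull g (inf_le_left : g ⁻¹ᵁ V ⊓ W k ≤ g ⁻¹ᵁ V) b =
            Y.res inf_le_left (g.app V b) := by rw [pull_app, res_pull]
        rw [Scheme.preimage_basicOpen, h2]
        exact (Y.basicOpen_res (g.app V b)
          (homOfLE (inf_le_left : g ⁻¹ᵁ V ⊓ W k ≤ g ⁻¹ᵁ V)).op).le.trans inf_le_right
      refine (Y.res_res h1 (inf_le_inf_right _ (g.preimage_mono (X.basicOpen_le b))) _).symm.trans ?_
      refine (congrArg (Y.res h1) ((ha k V _ (X.basicOpen_le b) _).symm.trans ?_)).trans (map_zero _)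
      have : S.res (X.basicOpen_le b) ⟨_, hn⟩ = X.res (X.basicOpen_le b) b ^ n • e' := by
        refine Subtype.ext ?_
        rw [coe_res, map_smulₛₗ, map_pow]
        exact congrArg (_ • ·) hee.symm
      rw [this, map_smulₛₗ, (hN e').1 he', smul_zero]
    choose m hm using key
    refine ⟨∑ k, m k + n, ⟨b ^ (∑ k, m k) • ⟨_, hn⟩, (hN _).2 fun k ↦ ?_, ?_⟩⟩
    · obtain ⟨l, hl⟩ := Nat.exists_eq_add_of_le
        (Finset.single_le_sum (f := m) (fun _ _ ↦ Nat.zero_le _) (Finset.mem_univ k))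
      rw [map_smulₛₗ, map_pow, hl, pow_add, smul_eq_mul, mul_right_comm, hm, zero_mul]
    · change b ^ (∑ k, m k) • b ^ n • e = _
      rw [← mul_smul, ← pow_add]
  · intro V hV
    have : Module.Finite Γ(X, V) (S.sec V) := Module.Finite.iff_fg.2 (S.fg hV)
    exact ⟨S.sec V, inferInstance, inferInstance, this,
      Submodule.inclusion (Submodule.map_subtype_le _ _), Submodule.inclusion_injective _⟩

end tensor
end AlgebraicGeometry.Scheme.SubFam

lemma TensorProduct.contr_zero {R B A N N' : Type*} [CommRing R] [CommRing B] [AddCommGroup A]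
    [Module R A] [AddCommGroup N] [Module R N] [AddCommGroup N'] [Module B N'] {ρ : R →+* B}
    (u : N →ₛₗ[ρ] N') (x : TensorProduct R A N) : contr (0 : A →ₛₗ[ρ] B) u x = 0 := by
  induction x with
  | zero => simp
  | add x y hx hy => rw [map_add, hx, hy, add_zero]
  | tmul a n => simp

namespace AlgebraicGeometry.Scheme

lemma SecFam.eq_of_res_eq {X : Scheme.{u}} {P : Type u} {U : P → X.Opens} {V : X.Opens}
    {e e' : SecFam U V} (h : ∀ x ∈ V, ∃ (V' : X.Opens) (h : V' ≤ V), x ∈ V' ∧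
      SecFam.res h e = SecFam.res h e') : e = e' := by
  choose V' hle hx he using h
  refine SecFam.ext fun p ↦ ?_
  exact Scheme.eq_of_res_eq (ι := {x // x ∈ V}) (fun x ↦ U p ⊓ V' x x.2)
    (fun x ↦ inf_le_inf_left _ (hle x x.2))
    (fun x hx' ↦ TopologicalSpace.Opens.mem_iSup.2 ⟨⟨x, hx'.2⟩, hx'.1, hx _ hx'.2⟩) _ _
    fun x ↦ congrFun (he x x.2) p

namespace SubFam
open TensorProduct
variable {X Y Y' : Scheme.{u}} {P : Type u} {U : P → X.Opens} {S T : SubFam U}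

open SecFam in
open Classical in
/-- Families whose truncations belong to two given families of submodules. -/
def sup [IsNoetherian X] (S T : SubFam U) : SubFam U :=
  ofLE (S.supp ∪ T.supp) (fun V ↦
    LinearMap.eqLocus (trunc (S.supp ∪ T.supp)) LinearMap.id ⊓ ((S.sec V).comap (trunc S.supp) ⊓
      (T.sec V).comap (trunc T.supp)))
    (fun he p hp ↦ by
      have := congrFun he.1 p
      rw [trunc_apply_of_notMem hp] at this
      exact this.symm)
    (fun h e he ↦ by
      refine ⟨(res_trunc _ _ _).symm.trans (congrArg (SecFam.res h) he.1), ?_, ?_⟩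
      · exact Submodule.mem_comap.2 <| (res_trunc _ h e) ▸ S.res_mem h he.2.1
      · exact Submodule.mem_comap.2 <| (res_trunc _ h e) ▸ T.res_mem h he.2.2)
    (fun e he ↦ by
      choose! V' hle hx he using he
      refine ⟨SecFam.eq_of_res_eq fun x hx' ↦ ⟨V' x, hle x hx', hx x hx', ?_⟩,
        S.mem_of_res_mem _ fun x hx' ↦ ⟨V' x, hle x hx', hx x hx', ?_⟩,
        T.mem_of_res_mem _ fun x hx' ↦ ⟨V' x, hle x hx', hx x hx', ?_⟩⟩
      · exact (res_trunc _ _ _).trans (he x hx').1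
      · exact (res_trunc _ _ e).symm ▸ (he x hx').2.1
      · exact (res_trunc _ _ e).symm ▸ (he x hx').2.2)
    (fun hV b e hK he ↦ by
      obtain ⟨n, hn⟩ := S.exists_pow_smul_mem hV b (trunc S.supp e)
        (fun p hp ↦ trunc_apply_of_notMem hp e) ((res_trunc _ _ e).symm ▸ he.2.1)
      obtain ⟨m, hm⟩ := T.exists_pow_smul_mem hV b (trunc T.supp e)
        (fun p hp ↦ trunc_apply_of_notMem hp e) ((res_trunc _ _ e).symm ▸ he.2.2)
      refine ⟨m + n, ?_, ?_, ?_⟩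
      · exact (map_smul _ _ _).trans (congrArg _ (trunc_eq_self hK))
      · refine Submodule.mem_comap.2 ?_
        rw [map_smul, pow_add, mul_smul]
        exact Submodule.smul_mem _ _ hn
      · refine Submodule.mem_comap.2 ?_
        rw [map_smul, add_comm, pow_add, mul_smul]
        exact Submodule.smul_mem _ _ hm)
    (fun {V} hV ↦ by
      have : Module.Finite Γ(X, V) (S.sec V) := Module.Finite.iff_fg.2 (S.fg hV)
      have : Module.Finite Γ(X, V) (T.sec V) := Module.Finite.iff_fg.2 (T.fg hV)
      refine ⟨S.sec V × T.sec V, inferInstance, inferInstance, inferInstance,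
        LinearMap.prod
          ((trunc S.supp).restrict fun e he ↦ he.2.1) ((trunc T.supp).restrict fun e he ↦ he.2.2),
        fun e e' h ↦ Subtype.ext (SecFam.ext fun p ↦ ?_)⟩
      have h1 := congrFun (congrArg Subtype.val (congrArg Prod.fst h)) p
      have h2 := congrFun (congrArg Subtype.val (congrArg Prod.snd h)) p
      by_cases hS : p ∈ S.supp
      · exact (trunc_apply_of_mem hS e.1).symm.trans (h1.trans (trunc_apply_of_mem hS e'.1))
      by_cases hT : p ∈ T.supp
      · exact (trunc_apply_of_mem hT e.1).symm.trans (h2.trans (trunc_apply_of_mem hT e'.1))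
      have hp : p ∉ S.supp ∪ T.supp := by simp [hS, hT]
      rw [← show trunc _ e.1 = e.1 from e.2.1, ← show trunc _ e'.1 = e'.1 from e'.2.1,
        trunc_apply_of_notMem hp, trunc_apply_of_notMem hp])

section
variable [IsNoetherian X]

open Classical in
lemma mem_sup_sec {V : X.Opens} {e : SecFam U V} : e ∈ (sup S T).sec V ↔
    SecFam.trunc (S.supp ∪ T.supp) e = e ∧ SecFam.trunc S.supp e ∈ S.sec V ∧
      SecFam.trunc T.supp e ∈ T.sec V :=
  Iff.rfl

open Classical in
lemma sup_supp : (sup S T).supp = S.supp ∪ T.supp := rfl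

lemma le_sup_left : S ≤ sup S T := by
  classical exact ⟨sup_supp (S := S) ▸ Finset.subset_union_left, fun V e he ↦ (mem_sup_sec.1 he).2.1⟩

lemma le_sup_right : T ≤ sup S T := by
  classical exact ⟨sup_supp (S := S) ▸ Finset.subset_union_right, fun V e he ↦ (mem_sup_sec.1 he).2.2⟩

variable {F : X.Modules} {f : ∀ p, Γ(F, U p)} [F.IsQuasicoherent] (hF : F.IsFlat)

include hF in
lemma HasTensor.sup (hS : S.HasTensor f) (hT : T.HasTensor f) : (S.sup T).HasTensor f := by
  classical
  intro x
  obtain ⟨V₁, hx₁, -, t₁, ht₁⟩ := hS x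
  obtain ⟨V, hle, hx, hV, t', ht'⟩ := hT.exists_le hx₁
  have ht := ht₁.res hle
  set t := S.tensorRes F hle t₁
  refine ⟨V, hx, hV, ?_⟩
  let π₁ (p : P) : (S.sec V × T.sec V) →ₛₗ[X.res (inf_le_right : U p ⊓ V ≤ V)] Γ(X, U p ⊓ V) :=
    (S.proj p).comp (LinearMap.fst Γ(X, V) (S.sec V) (T.sec V))
  let π₂ (p : P) : (S.sec V × T.sec V) →ₛₗ[X.res (inf_le_right : U p ⊓ V ≤ V)] Γ(X, U p ⊓ V) :=
    (T.proj p).comp (LinearMap.snd Γ(X, V) (S.sec V) (T.sec V))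
  let g : (S.sup T).sec V →ₗ[Γ(X, V)] S.sec V × T.sec V :=
    (truncMap le_sup_left V).prod (truncMap le_sup_right V)
  let z := (LinearMap.inl Γ(X, V) (S.sec V) (T.sec V)).rTensor Γ(F, V) t +
    (LinearMap.inr Γ(X, V) (S.sec V) (T.sec V)).rTensor Γ(F, V) t'
  have h1 (p) (hp : p ∈ S.supp) : contr (π₁ p) (F.resₛₗ inf_le_right) z =
      F.res inf_le_left (f p) := by
    rw [map_add, contr_rTensor _ _ _ (S.proj p) fun _ ↦ rfl,
      contr_rTensor _ _ _ 0 fun _ ↦ rfl, contr_zero, add_zero, ht p hp]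
  have h2 (p) (hp : p ∈ T.supp) : contr (π₂ p) (F.resₛₗ inf_le_right) z =
      F.res inf_le_left (f p) := by
    rw [map_add, contr_rTensor _ _ _ 0 fun _ ↦ rfl,
      contr_rTensor _ _ _ (T.proj p) fun _ ↦ rfl, contr_zero, zero_add, ht' p hp]
  have h3 (p) : ∀ z, contr (π₁ p - π₂ p) (F.resₛₗ inf_le_right) z =
      contr (π₁ p) (F.resₛₗ inf_le_right) z - contr (π₂ p) (F.resₛₗ inf_le_right) z := fun z ↦ by
    induction z with
    | zero => simp
    | add x y hx hy => simp only [map_add, hx, hy]; abel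
    | tmul a n => simp [sub_smul]
  have h4 (e : S.sec V × T.sec V) (he : ∀ p : ↥(S.supp ∩ T.supp), (π₁ p.1 - π₂ p.1) e = 0) :
      e ∈ LinearMap.range g := by
    let m : SecFam U V := SecFam.mk fun p ↦ if p ∈ S.supp then e.1.1 p else e.2.1 p
    have hm1 : SecFam.trunc S.supp m = e.1.1 := by
      ext p
      by_cases hp : p ∈ S.supp
      · rw [SecFam.trunc_apply_of_mem hp]
        exact if_pos hp
      · rw [SecFam.trunc_apply_of_notMem hp, S.eq_zero e.1.2 p hp]
    have hm2 : SecFam.trunc T.supp m = e.2.1 := by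
      ext p
      by_cases hp : p ∈ T.supp
      · rw [SecFam.trunc_apply_of_mem hp]
        by_cases hp' : p ∈ S.supp
        · exact (if_pos hp').trans (sub_eq_zero.1 (he ⟨p, Finset.mem_inter.2 ⟨hp', hp⟩⟩))
        · exact if_neg hp'
      · rw [SecFam.trunc_apply_of_notMem hp, T.eq_zero e.2.2 p hp]
    refine ⟨⟨m, mem_sup_sec.2 ⟨SecFam.trunc_eq_self fun p hp ↦ ?_, ?_, ?_⟩⟩,
      Prod.ext (Subtype.ext hm1) (Subtype.ext hm2)⟩
    · rw [Finset.mem_union, not_or] at hp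
      exact (if_neg hp.1).trans (T.eq_zero e.2.2 p hp.2)
    · rw [hm1]; exact e.1.2
    · rw [hm2]; exact e.2.2
  obtain ⟨y, hy⟩ := Modules.exists_rTensor_eq_of_contr_res hF hV (ι := ↥(S.supp ∩ T.supp))
    (fun p ↦ U p.1 ⊓ V) (fun p ↦ inf_le_right)
    (fun p ↦ TopologicalSpace.NoetherianSpace.isCompact _)
    (fun p ↦ π₁ p.1 - π₂ p.1) g h4 z (fun p ↦ by
      rw [h3, h1 p.1 (Finset.mem_inter.1 p.2).1, h2 p.1 (Finset.mem_inter.1 p.2).2, sub_self])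
  refine ⟨y, fun p hp ↦ ?_⟩
  rcases Finset.mem_union.1 (sup_supp (S := S) ▸ hp) with hp | hp
  · rw [← h1 p hp, ← hy, contr_rTensor (π₁ p) (F.resₛₗ inf_le_right) g ((S.sup T).proj p)]
    exact fun e ↦ (SecFam.trunc_apply_of_mem hp _).symm
  · rw [← h2 p hp, ← hy, contr_rTensor (π₂ p) (F.resₛₗ inf_le_right) g ((S.sup T).proj p)]
    exact fun e ↦ (SecFam.trunc_apply_of_mem hp _).symm

end

section contraction
variable {F : X.Modules} (f : ∀ p, Γ(F, U p)) {g : Y ⟶ X}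

/-- The effect of a homomorphism on sections. -/
def pushApp (a : S.sheaf.PushHom g) (V : X.Opens) :
    S.sec V →ₛₗ[pull g (le_rfl : g ⁻¹ᵁ V ≤ g ⁻¹ᵁ V)] Γ(Y, g ⁻¹ᵁ V) where
  toFun e := a.app V (S.toSheaf V e)
  map_add' _ _ := map_add (a.app V) _ _
  map_smul' r e := (map_smulₛₗ (a.app V) r (S.toSheaf V e)).trans
    (congrArg (· * _) (pull_app g V r))

lemma pushApp_res (a : S.sheaf.PushHom g) {V V' : X.Opens} (h : V' ≤ V) (e : S.sec V) :
    pushApp a V' (S.res h e) = Y.res (g.preimage_mono h) (pushApp a V e) :=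
  a.app_res h (S.toSheaf V e)

lemma contr_tensorRes (a : S.sheaf.PushHom g) {V V' : X.Opens} (h : V' ≤ V)
    (t : S.sec V ⊗[Γ(X, V)] Γ(F, V)) :
    contr (pushApp a V') (F.pullₛₗ g le_rfl) (S.tensorRes F h t) =
      ((Modules.pullback g).obj F).res (g.preimage_mono h)
        (contr (pushApp a V) (F.pullₛₗ g le_rfl) t) := by
  refine contr_eq_map_contr _ _ _ _ (S.tensorRes F h)
    (((Modules.pullback g).obj F).res (g.preimage_mono h)) (fun e n ↦ ?_) t
  rw [Modules.res_smul, Modules.pullₛₗ_apply, Modules.res_pullSec, ← pushApp_res]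
  exact congrArg (pushApp a V' (S.res h e) • ·) (F.pullSec_res g h le_rfl n)

/-- The section obtained by contraction with tensors. -/
def IsContr (a : S.sheaf.PushHom g) (y : Γ((Modules.pullback g).obj F, ⊤)) : Prop :=
  ∀ V : X.Opens, IsAffineOpen V → ∀ t : S.sec V ⊗[Γ(X, V)] Γ(F, V), S.IsTensor f t →
    ((Modules.pullback g).obj F).res le_top y = contr (pushApp a V) (F.pullₛₗ g le_rfl) t

variable {f}

lemma IsContr.unique (hS : S.HasTensor f) {a : S.sheaf.PushHom g}
    {y y' : Γ((Modules.pullback g).obj F, ⊤)} (h : IsContr f a y) (h' : IsContr f a y') :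
    y = y' := by
  choose V hx hV t ht using hS
  refine Modules.eq_of_res_eq (fun x ↦ g ⁻¹ᵁ (V x)) (fun _ ↦ le_top)
    (fun y _ ↦ TopologicalSpace.Opens.mem_iSup.2 ⟨g y, hx (g y)⟩) _ _ _ fun x ↦ ?_
  rw [h _ (hV x) _ (ht x), h' _ (hV x) _ (ht x)]

lemma exists_isContr [IsNoetherian X] [F.IsQuasicoherent] (hF : F.IsFlat) (hS : S.HasTensor f)
    (a : S.sheaf.PushHom g) : ∃ y, IsContr f a y := by
  have key {V V' : X.Opens} {t : S.sec V ⊗[Γ(X, V)] Γ(F, V)} (ht : S.IsTensor f t)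
      {t' : S.sec V' ⊗[Γ(X, V')] Γ(F, V')} (ht' : S.IsTensor f t') :
      ((Modules.pullback g).obj F).res (inf_le_left : g ⁻¹ᵁ V ⊓ g ⁻¹ᵁ V' ≤ _)
        (contr (pushApp a V) (F.pullₛₗ g le_rfl) t) =
      ((Modules.pullback g).obj F).res inf_le_right
        (contr (pushApp a V') (F.pullₛₗ g le_rfl) t') := by
    have (x : {x // x ∈ V ⊓ V'}) : ∃ W : X.Opens, W ≤ V ⊓ V' ∧ x.1 ∈ W ∧ IsAffineOpen W := by
      obtain ⟨W, hW, hx, hle⟩ := exists_isAffineOpen_mem_and_subset x.2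
      exact ⟨W, hle, hx, hW⟩
    choose W hle hx hW using this
    refine Modules.eq_of_res_eq (V := g ⁻¹ᵁ V ⊓ g ⁻¹ᵁ V') (fun x ↦ g ⁻¹ᵁ (W x))
      (fun x ↦ le_inf (g.preimage_mono ((hle x).trans inf_le_left))
        (g.preimage_mono ((hle x).trans inf_le_right)))
      (fun y hy ↦ TopologicalSpace.Opens.mem_iSup.2 ⟨⟨g y, hy⟩, hx ⟨g y, hy⟩⟩) _ _ _ fun x ↦ ?_
    rw [Modules.res_res, Modules.res_res, ← contr_tensorRes a ((hle x).trans inf_le_left),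
      ← contr_tensorRes a ((hle x).trans inf_le_right),
      IsTensor.unique hF (hW x) (ht.res ((hle x).trans inf_le_left))
        (ht'.res ((hle x).trans inf_le_right))]
  choose V hx hV t ht using hS
  have hcov (O : Y.Opens) : O ≤ ⨆ x, g ⁻¹ᵁ V x ⊓ O := fun y hy ↦
    TopologicalSpace.Opens.mem_iSup.2 ⟨g y, hx (g y), hy⟩
  obtain ⟨y, hy⟩ := Modules.exists_res_eq (V := ⊤) (fun x ↦ g ⁻¹ᵁ (V x)) (fun _ ↦ le_top)
    (fun y _ ↦ TopologicalSpace.Opens.mem_iSup.2 ⟨g y, hx (g y)⟩) ((Modules.pullback g).obj F)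
    (fun x ↦ contr (pushApp a (V x)) (F.pullₛₗ g le_rfl) (t x)) (fun x x' ↦ key (ht x) (ht x'))
  refine ⟨y, fun V' hV' t' ht' ↦ ?_⟩
  refine Modules.eq_of_res_eq (fun x ↦ g ⁻¹ᵁ V x ⊓ g ⁻¹ᵁ V') (fun x ↦ inf_le_right)
    (hcov _) _ _ _ fun x ↦ ?_
  rw [← key (ht x) ht', ← hy x, Modules.res_res, Modules.res_res]

lemma IsContr.add {a b : S.sheaf.PushHom g} {y z : Γ((Modules.pullback g).obj F, ⊤)}
    (ha : IsContr f a y) (hb : IsContr f b z) : IsContr f (a + b) (y + z) := by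
  intro V hV t ht
  rw [map_add, ha V hV t ht, hb V hV t ht]
  clear ht
  induction t with
  | zero => simp
  | add x y hx hy => rw [map_add, map_add, map_add, ← hx, ← hy]; abel
  | tmul e n => exact (add_smul _ _ _).symm

lemma IsContr.smul {a : S.sheaf.PushHom g} {y : Γ((Modules.pullback g).obj F, ⊤)}
    (ha : IsContr f a y) (r : Γ(Y, ⊤)) : IsContr f (r • a) (r • y) := by
  intro V hV t ht
  rw [Modules.res_smul, ha V hV t ht]
  clear ht
  induction t with
  | zero => simp
  | add x y hx hy => rw [map_add, map_add, smul_add, ← hx, ← hy]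
  | tmul e n => exact (mul_smul _ _ _).symm

lemma IsContr.restrict {a : S.sheaf.PushHom g} {y : Γ((Modules.pullback g).obj F, ⊤)}
    (ha : IsContr f a y) (k : Y' ⟶ Y) {g' : Y' ⟶ X} (w : k ≫ g = g') :
    IsContr f (a.restrict k w) (Modules.pushApp (F.transition k w) ⊤ y) := by
  intro V hV t ht
  have h1 := congrArg (Modules.pushApp (F.transition k w) (g ⁻¹ᵁ V)) (ha V hV t ht)
  rw [Modules.pushApp_res] at h1
  have h2 : g' ⁻¹ᵁ V ≤ k ⁻¹ᵁ (g ⁻¹ᵁ V) := by rw [← w]; rfl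
  have h3 := congrArg (((Modules.pullback g').obj F).res h2) h1
  rw [Modules.res_res] at h3
  refine h3.trans ?_
  clear ht h1 h3
  induction t with
  | zero => simp
  | add x y hx hy => rw [map_add, map_add, map_add, map_add, hx, hy]
  | tmul e n =>
    rw [contr_tmul, contr_tmul, Modules.pushApp_smul, Modules.pullₛₗ_apply, Modules.transition_pullSec, Modules.res_smul,
      Modules.res_pullSec]
    refine congrArg (· • _) ?_
    rw [pull_app, res_pull]
    rfl

lemma IsContr.precomp {a : S.sheaf.PushHom g} {y : Γ((Modules.pullback g).obj F, ⊤)}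
    (ha : IsContr f a y) (h : S ≤ T) : IsContr f (a.precomp (truncHom h)) y := by
  intro V hV t ht
  rw [ha V hV _ (ht.truncMap h)]
  exact contr_rTensor _ _ _ _ (fun _ ↦ rfl) t

lemma IsContr.exists_precomp_eq_zero [IsNoetherian X] [F.IsQuasicoherent] (hF : F.IsFlat)
    (hS : S.HasTensor f) (hc : ∀ V, IsAffineOpen V → IsCompact ((g ⁻¹ᵁ V : Y.Opens) : Set Y))
    {a : S.sheaf.PushHom g} (ha : IsContr f a 0) :
    ∃ (T : SubFam U) (_ : T.HasTensor f) (h : S ≤ T), a.precomp (truncHom h) = 0 := by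
  let b (V : X.Opens) : S.sec V →ₛₗ[pull g (inf_le_left : g ⁻¹ᵁ V ⊓ ⊤ ≤ g ⁻¹ᵁ V)]
      Γ(Y, g ⁻¹ᵁ V ⊓ ⊤) :=
    { toFun e := Y.res inf_le_left (pushApp a V e)
      map_add' e e' := by rw [map_add, map_add]
      map_smul' r e := by rw [map_smulₛₗ, smul_eq_mul, map_mul, res_pull, smul_eq_mul] }
  obtain ⟨T, hT, hle, hsupp, h⟩ := exists_le_of_contr_eq_zero hF hS g (ι := Unit) (fun _ ↦ ⊤)
    (fun _ V hV ↦ by rw [inf_top_eq]; exact hc V hV) (fun _ ↦ b) (fun _ V V' h e ↦ by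
      change Y.res _ (pushApp a V' (S.res h e)) = Y.res _ (Y.res _ (pushApp a V e))
      rw [pushApp_res, Scheme.res_res, Scheme.res_res]) (fun _ V hV t ht ↦ by
      have h1 := (ha V hV t ht).symm
      rw [map_zero] at h1
      have := contr_eq_map_contr (pushApp a V) (F.pullₛₗ g le_rfl) (b V) (F.pullₛₗ g inf_le_left)
        (.id _) (((Modules.pullback g).obj F).res inf_le_left) (fun e n ↦ by
          rw [Modules.res_smul, Modules.pullₛₗ_apply, Modules.res_pullSec]; rfl) t
      rw [h1, map_zero] at this
      exact this)
  refine ⟨T, hT, hle, ?_⟩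
  ext V e
  obtain ⟨e, rfl⟩ := (T.toSheaf V).surjective e
  obtain ⟨he, he0⟩ := h V e.1 e.2
  have h1 := congrArg (Y.res (by simp : g ⁻¹ᵁ V ≤ g ⁻¹ᵁ V ⊓ ⊤)) (he0 ())
  rw [map_zero] at h1
  refine Eq.trans ?_ h1
  change pushApp a V (truncMap hle V e) = Y.res _ (Y.res _ (pushApp a V ⟨e.1, he⟩))
  rw [Scheme.res_res, Scheme.res_self]
  exact congrArg (pushApp a V) (Subtype.ext (SecFam.trunc_eq_self (S.eq_zero he)))

end contraction
end SubFam
end AlgebraicGeometry.Scheme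

namespace AlgebraicGeometry.Scheme
variable {X : Scheme.{u}}

/-- The functions on `W` whose product with `s` extends to `W`. -/
def extIdeal (O W : X.Opens) (s : Γ(X, O ⊓ W)) : Ideal Γ(X, W) where
  carrier := {c | ∃ r : Γ(X, W), X.res inf_le_right r = X.res (inf_le_right : O ⊓ W ≤ W) c * s}
  add_mem' := by
    rintro a b ⟨r, hr⟩ ⟨r', hr'⟩
    exact ⟨r + r', by rw [map_add, map_add, hr, hr', add_mul]⟩
  zero_mem' := ⟨0, by rw [map_zero, zero_mul]⟩
  smul_mem' := by
    rintro a b ⟨r, hr⟩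
    exact ⟨a * r, by rw [smul_eq_mul, map_mul, map_mul, hr, mul_assoc]⟩

lemma mem_extIdeal {O W : X.Opens} {s : Γ(X, O ⊓ W)} {c : Γ(X, W)} : c ∈ extIdeal O W s ↔
    ∃ r : Γ(X, W), X.res inf_le_right r = X.res (inf_le_right : O ⊓ W ≤ W) c * s :=
  Iff.rfl

lemma res_mem_extIdeal {O W W' : X.Opens} (h : W' ≤ W) {s : Γ(X, O ⊓ W)} {c : Γ(X, W)}
    (hc : c ∈ extIdeal O W s) : X.res h c ∈ extIdeal O W' (X.res (inf_le_inf_left O h) s) := by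
  obtain ⟨r, hr⟩ := hc
  refine ⟨X.res h r, ?_⟩
  have := congrArg (X.res (inf_le_inf_left O h)) hr
  simpa using this

lemma mul_mem_extIdeal {O W : X.Opens} {s : Γ(X, O ⊓ W)} {c d : Γ(X, W)} :
    d ∈ extIdeal O W (X.res inf_le_right c * s) ↔ d * c ∈ extIdeal O W s := by
  rw [mem_extIdeal, mem_extIdeal, map_mul]
  simp only [mul_assoc]

lemma exists_pow_mem_extIdeal {O W : X.Opens} (hW : IsCompact (W : Set X))
    (hW' : IsQuasiSeparated (W : Set X)) (hOW : IsCompact ((O ⊓ W : X.Opens) : Set X))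
    (s : Γ(X, O ⊓ W)) (b : Γ(X, W))
    (h : 1 ∈ extIdeal O (X.basicOpen b) (X.res (inf_le_inf_left O (X.basicOpen_le b)) s)) :
    ∃ n : ℕ, b ^ n ∈ extIdeal O W s := by
  obtain ⟨r, hr⟩ := h
  rw [map_one, one_mul] at hr
  obtain ⟨n, y, hy⟩ := exists_eq_pow_mul_of_isCompact_of_isQuasiSeparated X W hW hW' b r
  replace hy : X.res (X.basicOpen_le b) y = X.res (X.basicOpen_le b) b ^ n * r := hy
  let d := X.res (inf_le_right : O ⊓ W ≤ W) b ^ n * s - X.res inf_le_right y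
  have hd : ∃ m : ℕ, X.res (inf_le_right : O ⊓ W ≤ W) b ^ m * d = 0 := by
    refine exists_pow_mul_eq_zero_of_res_basicOpen_eq_zero_of_isCompact X hOW _ _ ?_
    have h1 : X.basicOpen (X.res (inf_le_right : O ⊓ W ≤ W) b) ≤ O ⊓ X.basicOpen b :=
      (X.basicOpen_res b (homOfLE (inf_le_right : O ⊓ W ≤ W)).op).le.trans
        (inf_le_inf_right _ inf_le_left)
    refine (X.res_res h1 (inf_le_inf_left _ (X.basicOpen_le b)) d).symm.trans ?_
    refine (congrArg (X.res h1) ?_).trans (map_zero _)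
    have h2 := congrArg (X.res (inf_le_right : O ⊓ X.basicOpen b ≤ _)) hy
    rw [map_mul, hr] at h2
    simp only [d, map_sub, map_mul, map_pow, Scheme.res_res] at h2 ⊢
    rw [h2, sub_self]
  obtain ⟨m, hm⟩ := hd
  refine ⟨m + n, b ^ m * y, ?_⟩
  rw [mul_sub, sub_eq_zero] at hm
  rw [map_mul, map_pow, map_pow, pow_add, mul_assoc, hm]

lemma one_mem_extIdeal [IsNoetherian X] {O W : X.Opens} (hW : IsAffineOpen W) (s : Γ(X, O ⊓ W))
    (h : ∀ x ∈ W, ∃ (W' : X.Opens) (h : W' ≤ W), x ∈ W' ∧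
      1 ∈ extIdeal O W' (X.res (inf_le_inf_left O h) s)) : 1 ∈ extIdeal O W s := by
  have hc (W : X.Opens) : IsCompact (W : Set X) :=
    TopologicalSpace.NoetherianSpace.isCompact (W : Set X)
  rw [← Ideal.eq_top_iff_one, ← Ideal.span_eq (extIdeal O W s), ← hW.iSup_basicOpen_eq_self_iff]
  refine le_antisymm (iSup_le fun b ↦ X.basicOpen_le _) fun x hx ↦ ?_
  obtain ⟨W', hle, hx', h1⟩ := h x hx
  obtain ⟨b, hb, hxb⟩ := hW.exists_basicOpen_le ⟨x, hx'⟩ hx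
  have h2 := res_mem_extIdeal hb h1
  rw [map_one, Scheme.res_res] at h2
  obtain ⟨n, hn⟩ := exists_pow_mem_extIdeal (hc _) (.of_quasiSeparatedSpace _) (hc _) s b h2
  refine TopologicalSpace.Opens.mem_iSup.2
    ⟨⟨b ^ (n + 1), by rw [pow_succ]; exact Ideal.mul_mem_right _ _ hn⟩, ?_⟩
  rwa [X.basicOpen_pow _ (Nat.succ_pos n)]

/-- The ideal sheaf of functions that vanish outside of an open subset. -/
def complIdeal (O : X.Opens) : X.IdealSheafData :=
  IdealSheafData.vanishingIdeal O.compl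

lemma mem_complIdeal {O W : X.Opens} (hW : IsAffineOpen W) {c : Γ(X, W)} :
    c ∈ (complIdeal O).ideal ⟨W, hW⟩ ↔ X.basicOpen c ≤ O := by
  rw [complIdeal, IdealSheafData.vanishingIdeal_ideal, PrimeSpectrum.mem_vanishingIdeal]
  rw [← hW.fromSpec_image_basicOpen c]
  constructor
  · rintro h _ ⟨x, hx, rfl⟩
    by_contra hO
    exact hx (h x hO)
  · intro h x hx
    by_contra hc
    exact hx (h ⟨x, hc, rfl⟩)

lemma map_complIdeal_pow {O W W' : X.Opens} (hW : IsAffineOpen W) (hW' : IsAffineOpen W')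
    (h : W' ≤ W) (n : ℕ) : ((complIdeal O).ideal ⟨W, hW⟩ ^ n).map (X.res h) =
      (complIdeal O).ideal ⟨W', hW'⟩ ^ n := by
  rw [Ideal.map_pow]
  exact congrArg (· ^ n) ((complIdeal O).map_ideal (U := ⟨W', hW'⟩) (V := ⟨W, hW⟩) h)

lemma complIdeal_pow_le_extIdeal_res {O W W' : X.Opens} (hW : IsAffineOpen W)
    (hW' : IsAffineOpen W') (h : W' ≤ W) {n : ℕ} {s : Γ(X, O ⊓ W)}
    (hs : (complIdeal O).ideal ⟨W, hW⟩ ^ n ≤ extIdeal O W s) :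
    (complIdeal O).ideal ⟨W', hW'⟩ ^ n ≤ extIdeal O W' (X.res (inf_le_inf_left O h) s) := by
  rw [← map_complIdeal_pow hW hW' h, Ideal.map_le_iff_le_comap]
  exact fun c hc ↦ res_mem_extIdeal h (hs hc)

lemma exists_complIdeal_pow_le_extIdeal [IsNoetherian X] {O W : X.Opens} (hW : IsAffineOpen W)
    (s : Γ(X, O ⊓ W)) : ∃ n, (complIdeal O).ideal ⟨W, hW⟩ ^ n ≤ extIdeal O W s := by
  have hc (W : X.Opens) : IsCompact (W : Set X) :=
    TopologicalSpace.NoetherianSpace.isCompact (W : Set X)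
  have : IsNoetherianRing Γ(X, W) := IsLocallyNoetherian.component_noetherian ⟨W, hW⟩
  refine Ideal.exists_pow_le_of_le_radical_of_fg (fun c hcI ↦ ?_) (IsNoetherian.noetherian _)
  rw [mem_complIdeal] at hcI
  refine exists_pow_mem_extIdeal (hc _) (.of_quasiSeparatedSpace _) (hc _) s c ?_
  refine ⟨X.res (le_inf hcI (X.basicOpen_le c)) s, ?_⟩
  rw [map_one, one_mul, Scheme.res_res]

lemma eq_zero_of_complIdeal_pow {O W : X.Opens} (hW : IsAffineOpen W) (n : ℕ) (s : Γ(X, O ⊓ W))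
    (h : ∀ c ∈ (complIdeal O).ideal ⟨W, hW⟩ ^ n, X.res inf_le_right c * s = 0) : s = 0 := by
  have (x : {x // x ∈ O ⊓ W}) : ∃ c : Γ(X, W), X.basicOpen c ≤ O ∧ x.1 ∈ X.basicOpen c := by
    obtain ⟨c, hc, hx⟩ := hW.exists_basicOpen_le ⟨x.1, x.2.1⟩ x.2.2
    exact ⟨c, hc, hx⟩
  choose c hc hx using this
  refine Scheme.eq_of_res_eq (fun x ↦ X.basicOpen (c x)) (fun x ↦ le_inf (hc x) (X.basicOpen_le _))
    (fun x hx' ↦ TopologicalSpace.Opens.mem_iSup.2 ⟨⟨x, hx'⟩, hx _⟩) _ _ fun x ↦ ?_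
  have h1 := congrArg (X.res (le_inf (hc x) (X.basicOpen_le _)))
    (h (c x ^ n) (Ideal.pow_mem_pow ((mem_complIdeal hW).2 (hc x)) n))
  rw [map_mul, Scheme.res_res, map_pow, map_zero] at h1
  have hu : IsUnit (X.res (X.basicOpen_le (c x)) (c x)) :=
    RingedSpace.isUnit_res_basicOpen X.toRingedSpace (c x)
  rw [map_zero]
  exact (hu.pow n).mul_right_eq_zero.1 h1

end AlgebraicGeometry.Scheme

namespace AlgebraicGeometry.Scheme.SubFam
open TensorProduct
variable {X : Scheme.{u}} {P : Type u} (U : P → X.Opens)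

/-- The families supported on `K` that are extendable after multiplication by the `n`th power
of the ideal of the complement. -/
def poleSec (K : Finset P) (n : ℕ) (V : X.Opens) : Submodule Γ(X, V) (SecFam U V) where
  carrier := {e | (∀ p ∉ K, e p = 0) ∧ ∀ p ∈ K, ∀ (W : X.Opens) (h : W ≤ V) (hW : IsAffineOpen W),
    (complIdeal (U p)).ideal ⟨W, hW⟩ ^ n ≤
      extIdeal (U p) W (X.res (inf_le_inf_left (U p) h) (e p))}
  add_mem' := by
    rintro e e' ⟨h1, h2⟩ ⟨h1', h2'⟩
    refine ⟨fun p hp ↦ by rw [SecFam.add_apply, h1 p hp, h1' p hp, add_zero],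
      fun p hp W h hW c hc ↦ ?_⟩
    obtain ⟨r, hr⟩ := h2 p hp W h hW hc
    obtain ⟨r', hr'⟩ := h2' p hp W h hW hc
    exact ⟨r + r', by rw [map_add, SecFam.add_apply, map_add, hr, hr', mul_add]⟩
  zero_mem' := ⟨fun _ _ ↦ rfl, fun p _ W h hW c hc ↦
    ⟨0, by rw [SecFam.zero_apply, map_zero, map_zero, mul_zero]⟩⟩
  smul_mem' := by
    rintro a e ⟨h1, h2⟩
    refine ⟨fun p hp ↦ by rw [SecFam.smul_apply, h1 p hp, mul_zero], fun p hp W h hW c hc ↦ ?_⟩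
    obtain ⟨r, hr⟩ := h2 p hp W h hW hc
    refine ⟨X.res h a * r, ?_⟩
    rw [map_mul, SecFam.smul_apply, map_mul, hr, Scheme.res_res, Scheme.res_res, mul_left_comm]

variable {U}

lemma mem_poleSec_of_isAffineOpen {K : Finset P} {n : ℕ} {V : X.Opens} (hV : IsAffineOpen V)
    {e : SecFam U V} (he : ∀ p ∉ K, e p = 0) (h : ∀ p ∈ K,
      (complIdeal (U p)).ideal ⟨V, hV⟩ ^ n ≤ extIdeal (U p) V (e p)) : e ∈ poleSec U K n V :=
  ⟨he, fun p hp _ hle hW ↦ complIdeal_pow_le_extIdeal_res hV hW hle (h p hp)⟩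

lemma poleSec_mono (K : Finset P) {n m : ℕ} (h : n ≤ m) (V : X.Opens) :
    poleSec U K n V ≤ poleSec U K m V :=
  fun _ he ↦ ⟨he.1, fun p hp W hW hle ↦ (Ideal.pow_le_pow_right h).trans (he.2 p hp W hW hle)⟩

variable [IsNoetherian X]

lemma exists_mem_poleSec {K : Finset P} {V : X.Opens} (hV : IsAffineOpen V)
    {e : SecFam U V} (he : ∀ p ∉ K, e p = 0) : ∃ n, e ∈ poleSec U K n V := by
  choose n hn using fun p ↦ exists_complIdeal_pow_le_extIdeal (O := U p) hV (e p)
  refine ⟨∑ p ∈ K, n p, mem_poleSec_of_isAffineOpen hV he fun p hp ↦ ?_⟩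
  exact (Ideal.pow_le_pow_right
    (Finset.single_le_sum (f := n) (fun _ _ ↦ Nat.zero_le _) hp)).trans (hn p)

lemma exists_pow_smul_mem_poleSec {K : Finset P} {n : ℕ} {V : X.Opens} (hV : IsAffineOpen V)
    (b : Γ(X, V)) (e : SecFam U V) (hK : ∀ p ∉ K, e p = 0)
    (he : SecFam.res (X.basicOpen_le b) e ∈ poleSec U K n (X.basicOpen b)) :
    ∃ N : ℕ, b ^ N • e ∈ poleSec U K n V := by
  have hc (W : X.Opens) : IsCompact (W : Set X) :=
    TopologicalSpace.NoetherianSpace.isCompact (W : Set X)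
  have : IsNoetherianRing Γ(X, V) := IsLocallyNoetherian.component_noetherian ⟨V, hV⟩
  have key (p : P) (c : Γ(X, V)) : ∃ N : ℕ, p ∈ K → c ∈ (complIdeal (U p)).ideal ⟨V, hV⟩ ^ n →
      b ^ N * c ∈ extIdeal (U p) V (e p) := by
    by_cases hpK : p ∈ K ∧ c ∈ (complIdeal (U p)).ideal ⟨V, hV⟩ ^ n
    · obtain ⟨N, hN⟩ := exists_pow_mem_extIdeal (O := U p) (hc _) (.of_quasiSeparatedSpace _) (hc _)
        (X.res inf_le_right c * e p) b (by
          have h1 : X.res (X.basicOpen_le b) c ∈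
              (complIdeal (U p)).ideal ⟨X.basicOpen b, hV.basicOpen b⟩ ^ n := by
            rw [← map_complIdeal_pow hV _ (X.basicOpen_le b)]
            exact Ideal.mem_map_of_mem _ hpK.2
          obtain ⟨r, hr⟩ := he.2 p hpK.1 _ le_rfl (hV.basicOpen b) h1
          refine ⟨r, ?_⟩
          rw [hr, map_one, one_mul, map_mul, SecFam.res_apply]
          simp only [Scheme.res_res])
      exact ⟨N, fun _ _ ↦ mul_mem_extIdeal.1 hN⟩
    · exact ⟨0, fun h1 h2 ↦ (hpK ⟨h1, h2⟩).elim⟩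
  choose N hN using key
  have hfg (p : P) : ((complIdeal (U p)).ideal ⟨V, hV⟩ ^ n).FG := IsNoetherian.noetherian _
  choose s hs using hfg
  refine ⟨∑ p ∈ K, ∑ c ∈ s p, N p c, mem_poleSec_of_isAffineOpen hV (fun p hp ↦ by
    rw [SecFam.smul_apply, hK p hp, mul_zero]) fun p hp ↦ ?_⟩
  rw [← hs p, SecFam.smul_apply, Submodule.span_le]
  intro c hcs
  refine mul_mem_extIdeal.2 ?_
  have h1 : N p c ≤ ∑ p ∈ K, ∑ c ∈ s p, N p c :=
    (Finset.single_le_sum (f := fun c ↦ N p c) (fun _ _ ↦ Nat.zero_le _) hcs).trans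
      (Finset.single_le_sum (f := fun p ↦ ∑ c ∈ s p, N p c) (fun _ _ ↦ Nat.zero_le _) hp)
  obtain ⟨k, hk⟩ := Nat.exists_eq_add_of_le h1
  rw [hk, pow_add, mul_comm (b ^ N p c), ← mul_assoc, mul_comm c, mul_assoc, mul_comm c]
  exact Ideal.mul_mem_left _ _ (hN p c hp (hs p ▸ Submodule.subset_span hcs))

lemma exists_injective_poleSec {K : Finset P} {n : ℕ} {V : X.Opens} (hV : IsAffineOpen V) :
    ∃ (M : Type u) (_ : AddCommGroup M) (_ : Module Γ(X, V) M) (_ : Module.Finite Γ(X, V) M)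
      (j : poleSec U K n V →ₗ[Γ(X, V)] M), Function.Injective j := by
  have : IsNoetherianRing Γ(X, V) := IsLocallyNoetherian.component_noetherian ⟨V, hV⟩
  have hfg (p : P) : ((complIdeal (U p)).ideal ⟨V, hV⟩ ^ n).FG := IsNoetherian.noetherian _
  choose s hs using hfg
  let κ := Σ p : K, s p
  let L : (κ → Γ(X, V)) →ₗ[Γ(X, V)] SecFam (fun k : κ ↦ U k.1) V :=
    { toFun r := SecFam.mk fun k ↦ X.res inf_le_right (r k)
      map_add' r r' := by ext k; simp
      map_smul' a r := SecFam.ext fun k ↦ by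
        rw [SecFam.smul_apply]
        exact map_mul _ _ _ }
  let j : SecFam U V →ₗ[Γ(X, V)] SecFam (fun k : κ ↦ U k.1) V :=
    { toFun e := SecFam.mk fun k ↦ X.res (inf_le_right : U k.1 ⊓ V ≤ V) k.2.1 * e k.1
      map_add' r r' := by ext k; simp [mul_add]
      map_smul' a r := SecFam.ext fun k ↦ by
        rw [SecFam.smul_apply, SecFam.mk_apply, SecFam.smul_apply]
        exact mul_left_comm _ _ _ }
  have hj (e : SecFam U V) (he : e ∈ poleSec U K n V) : j e ∈ LinearMap.range L := by
    have (k : κ) : ∃ r : Γ(X, V), X.res inf_le_right r =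
        X.res (inf_le_right : U k.1 ⊓ V ≤ V) k.2.1 * e k.1 := by
      have hk : k.2.1 ∈ (complIdeal (U k.1)).ideal ⟨V, hV⟩ ^ n :=
        hs k.1 ▸ Submodule.subset_span k.2.2
      obtain ⟨r, hr⟩ := he.2 k.1 k.1.2 V le_rfl hV hk
      exact ⟨r, by rw [hr, Scheme.res_self]⟩
    choose r hr using this
    exact ⟨r, SecFam.ext hr⟩
  refine ⟨LinearMap.range L, inferInstance, inferInstance, inferInstance, j.restrict hj, ?_⟩
  refine (injective_iff_map_eq_zero _).2 fun e he ↦ Subtype.ext (SecFam.ext fun p ↦ ?_)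
  by_cases hp : p ∈ K
  · refine eq_zero_of_complIdeal_pow hV n _ fun c hc ↦ ?_
    rw [← hs p] at hc
    induction hc using Submodule.span_induction with
    | mem c hc => exact congrFun (congrArg Subtype.val he) ⟨⟨p, hp⟩, ⟨c, hc⟩⟩
    | zero => rw [map_zero, zero_mul]
    | add c d _ _ hc hd => rw [map_add, add_mul, hc, hd, add_zero]
    | smul a c _ hc => rw [smul_eq_mul, map_mul, mul_assoc, hc, mul_zero]
  · exact e.2.1 p hp

variable (U) in
/-- The families supported on `K` with bounded poles. -/
def pole (K : Finset P) (n : ℕ) : SubFam U :=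
  ofLE K (poleSec U K n) (fun he ↦ he.1)
    (fun h e he ↦ ⟨fun p hp ↦ by rw [SecFam.res_apply, he.1 p hp, map_zero], fun p hp W hle hW ↦ by
      rw [SecFam.res_apply, Scheme.res_res]
      exact he.2 p hp W (hle.trans h) hW⟩)
    (fun {V} e he ↦ by
      choose! V' hle hx he using he
      refine ⟨fun p hp ↦ ?_, fun p hp W hWV hW (c : Γ(X, W)) hc ↦ ?_⟩
      · have : e = SecFam.trunc K e := SecFam.eq_of_res_eq fun x hx' ↦
          ⟨V' x, hle x hx', hx x hx', by
            rw [SecFam.res_trunc, SecFam.trunc_eq_self (he x hx').1]⟩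
        rw [this, SecFam.trunc_apply_of_notMem hp]
      · have := one_mem_extIdeal hW (X.res (inf_le_right : U p ⊓ W ≤ W) c *
          X.res (inf_le_inf_left _ hWV) (e p)) fun x hxW ↦ by
            obtain ⟨W', hW', hx', hle'⟩ := exists_isAffineOpen_mem_and_subset (U := W ⊓ V' x)
              ⟨hxW, hx x (hWV hxW)⟩
            have h1 : X.res (hle'.trans inf_le_left) c ∈ (complIdeal (U p)).ideal ⟨W', hW'⟩ ^ n := by
              rw [← map_complIdeal_pow hW hW' (hle'.trans inf_le_left)]
              exact Ideal.mem_map_of_mem _ hc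
            obtain ⟨r, hr⟩ := (he x (hWV hxW)).2 p hp W' (hle'.trans inf_le_right) hW' h1
            refine ⟨W', hle'.trans inf_le_left, hx', r, hr.trans ?_⟩
            rw [map_one, one_mul, map_mul, SecFam.res_apply, Scheme.res_res, Scheme.res_res,
              Scheme.res_res]
            exact congrArg (· * _) (X.res_res _ _ c)
        exact one_mul c ▸ mul_mem_extIdeal.1 this)
    (fun hV b e hK he ↦ exists_pow_smul_mem_poleSec hV b e hK he)
    (fun hV ↦ exists_injective_poleSec hV)

end AlgebraicGeometry.Scheme.SubFam

lemma TensorProduct.IsBaseChangeAlong.span_range_eq_top {R B N N' : Type*} [CommRing R]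
    [CommRing B] [AddCommGroup N] [Module R N] [AddCommGroup N'] [Module B N'] {ρ : R →+* B}
    {u : N →ₛₗ[ρ] N'} (hu : IsBaseChangeAlong u) : Submodule.span B (Set.range u) = ⊤ := by
  let _ : Algebra R B := ρ.toAlgebra
  let _ : Module R N' := Module.compHom _ ρ
  have : IsScalarTower R B N' := ⟨fun a b x ↦ SemigroupAction.mul_smul (ρ a) b x⟩
  let u' : N →ₗ[R] N' := { toFun := u, map_add' := map_add _, map_smul' := map_smulₛₗ u }
  refine eq_top_iff.2 fun y _ ↦ ?_
  induction y using (hu rfl u' fun _ ↦ rfl).inductionOn with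
  | zero => exact zero_mem _
  | tmul n => exact Submodule.subset_span ⟨n, rfl⟩
  | smul b y hy => exact Submodule.smul_mem _ _ (hy trivial)
  | add y z hy hz => exact add_mem (hy trivial) (hz trivial)

lemma TensorProduct.contr_sub {R B A N N' : Type*} [CommRing R] [CommRing B] [AddCommGroup A]
    [Module R A] [AddCommGroup N] [Module R N] [AddCommGroup N'] [Module B N'] {ρ : R →+* B}
    (φ ψ : A →ₛₗ[ρ] B) (u : N →ₛₗ[ρ] N') (x : TensorProduct R A N) :
    contr (φ - ψ) u x = contr φ u x - contr ψ u x := by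
  induction x with
  | zero => simp
  | add x y hx hy => simp only [map_add, hx, hy]; abel
  | tmul a n => simp [sub_smul]

namespace AlgebraicGeometry.Scheme.SecFam
open TensorProduct
variable {X : Scheme.{u}} {P : Type u} {U : P → X.Opens} {F : X.Modules} [F.IsQuasicoherent]
  {W : X.Opens}

lemma exists_contr_proj_eq_of_isAffineOpen [Finite P] (hW : IsAffineOpen W)
    (hU : ∀ p, IsAffineOpen (U p ⊓ W)) (y : ∀ p, Γ(F, U p ⊓ W)) :
    ∃ z : SecFam U W ⊗[Γ(X, W)] Γ(F, W),
      ∀ p, contr (SecFam.proj p) (F.resₛₗ inf_le_right) z = y p := by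
  classical
  have := Fintype.ofFinite P
  have key (p : P) (y : Γ(F, U p ⊓ W)) : ∃ z : SecFam U W ⊗[Γ(X, W)] Γ(F, W),
      contr (SecFam.proj p) (F.resₛₗ inf_le_right) z = y ∧
      ∀ q ≠ p, contr (SecFam.proj q) (F.resₛₗ inf_le_right) z = 0 := by
    have hy : y ∈ Submodule.span Γ(X, U p ⊓ W) (Set.range (F.resₛₗ (inf_le_right : U p ⊓ W ≤ W))) := by
      rw [IsBaseChangeAlong.span_range_eq_top
        (Modules.isBaseChangeAlong_resₛₗ F hW (hU p) inf_le_right)]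
      exact Submodule.mem_top
    obtain ⟨c, rfl⟩ := (Finsupp.mem_span_range_iff_exists_finsupp).1 hy
    refine ⟨∑ n ∈ c.support, SecFam.mk (Pi.single p (c n)) ⊗ₜ n, ?_, fun q hq ↦ ?_⟩
    · rw [map_sum]
      refine Finset.sum_congr rfl fun n _ ↦ ?_
      rw [contr_tmul, proj_apply, mk_apply, Pi.single_eq_same]
    · rw [map_sum]
      refine Finset.sum_eq_zero fun n _ ↦ ?_
      rw [contr_tmul, proj_apply, mk_apply, Pi.single_eq_of_ne hq, zero_smul]
  choose z hz hz' using fun p ↦ key p (y p)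
  refine ⟨∑ p, z p, fun p ↦ ?_⟩
  rw [map_sum, Finset.sum_eq_single p (fun q _ hq ↦ hz' q p hq.symm) (by simp), hz]

lemma exists_contr_proj_eq [IsNoetherian X] (hF : F.IsFlat) (hW : IsAffineOpen W) (K : Finset P)
    (y : ∀ p, Γ(F, U p ⊓ W)) : ∃ t : SecFam U W ⊗[Γ(X, W)] Γ(F, W),
      ∀ p ∈ K, contr (SecFam.proj p) (F.resₛₗ inf_le_right) t = y p := by
  choose s hs hsU using fun p : P ↦ exists_finite_affine_cover (C := U p ⊓ W)
    (TopologicalSpace.NoetherianSpace.isCompact _)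
  let κ := Σ p : K, s p
  let C (k : κ) : X.Opens := k.2.1
  have hCU (k : κ) : C k ⊓ W ≤ U k.1 ⊓ W := inf_le_left.trans (hs _ _ k.2.2).2
  have hCa (k : κ) : IsAffineOpen (C k ⊓ W) := by
    rw [inf_eq_left.2 ((hs _ _ k.2.2).2.trans inf_le_right)]
    exact (hs _ _ k.2.2).1
  obtain ⟨z, hz⟩ := exists_contr_proj_eq_of_isAffineOpen (U := C) hW hCa
    fun k ↦ F.res (hCU k) (y k.1)
  let g : SecFam U W →ₗ[Γ(X, W)] SecFam C W :=
    { toFun e := mk fun k ↦ X.res (hCU k) (e k.1)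
      map_add' e e' := by ext k; simp
      map_smul' r e := by ext k; simp }
  let k₁ (i : Σ p : K, s p × s p) : κ := ⟨i.1, i.2.1⟩
  let k₂ (i : Σ p : K, s p × s p) : κ := ⟨i.1, i.2.2⟩
  let D (i : Σ p : K, s p × s p) : X.Opens := (C (k₁ i) ⊓ W) ⊓ (C (k₂ i) ⊓ W)
  have hD (i) : D i ≤ W := inf_le_left.trans inf_le_right
  let ψ (i) (k : κ) (h : D i ≤ C k ⊓ W) : SecFam C W →ₛₗ[X.res (hD i)] Γ(X, D i) :=
    { toFun e := X.res h (e k)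
      map_add' e e' := by rw [add_apply, map_add]
      map_smul' r e := by rw [smul_apply, map_mul, Scheme.res_res, smul_eq_mul] }
  have hψ (i k h) : contr (ψ i k h) (F.resₛₗ (hD i)) z = F.res (h.trans (hCU k)) (y k.1) := by
    have := contr_eq_map_contr (proj k) (F.resₛₗ inf_le_right) (ψ i k h) (F.resₛₗ (hD i))
      (.id _) (F.res h) (fun e n ↦ by
        rw [AddMonoidHom.id_apply, contr_tmul, Modules.res_smul, Modules.resₛₗ_apply,
          Modules.resₛₗ_apply, Modules.res_res]
        rfl) z
    rw [AddMonoidHom.id_apply, hz, Modules.res_res] at this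
    exact this
  obtain ⟨t, rfl⟩ := Modules.exists_rTensor_eq_of_contr_res hF hW D hD
    (fun _ ↦ TopologicalSpace.NoetherianSpace.isCompact _)
    (fun i ↦ ψ i (k₁ i) inf_le_left - ψ i (k₂ i) inf_le_right) g (fun e he ↦ by
      have (p : P) : ∃ m : Γ(X, U p ⊓ W), ∀ (hp : p ∈ K) (k : s p),
          X.res (hCU ⟨⟨p, hp⟩, k⟩) m = e ⟨⟨p, hp⟩, k⟩ := by
        by_cases hp : p ∈ K
        · obtain ⟨m, hm⟩ := Scheme.exists_res_eq (fun k : s p ↦ k.1 ⊓ W)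
            (fun k ↦ hCU ⟨⟨p, hp⟩, k⟩) (fun x hx ↦ by
              obtain ⟨k, hk⟩ := TopologicalSpace.Opens.mem_iSup.1 (hsU p hx)
              exact TopologicalSpace.Opens.mem_iSup.2 ⟨k, hk, hx.2⟩)
            (fun k ↦ e ⟨⟨p, hp⟩, k⟩) (fun k k' ↦ sub_eq_zero.1 (he ⟨⟨p, hp⟩, k, k'⟩))
          exact ⟨m, fun _ k ↦ hm k⟩
        · exact ⟨0, fun h ↦ (hp h).elim⟩
      choose m hm using this
      exact ⟨mk m, SecFam.ext fun k ↦ hm k.1 k.1.2 k.2⟩) z (fun i ↦ by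
        rw [contr_sub, hψ, hψ, sub_self])
  refine ⟨t, fun p hp ↦ ?_⟩
  refine Modules.eq_of_res_eq (fun k : s p ↦ k.1 ⊓ W) (fun k ↦ hCU ⟨⟨p, hp⟩, k⟩)
    (fun x hx ↦ by
      obtain ⟨k, hk⟩ := TopologicalSpace.Opens.mem_iSup.1 (hsU p hx)
      exact TopologicalSpace.Opens.mem_iSup.2 ⟨k, hk, hx.2⟩) _ _ _ fun k ↦ ?_
  refine Eq.trans ?_ (hz ⟨⟨p, hp⟩, k⟩)
  refine (contr_eq_map_contr (proj p) (F.resₛₗ inf_le_right) (proj _) (F.resₛₗ inf_le_right)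
    (g.rTensor _).toAddMonoidHom (F.res (hCU ⟨⟨p, hp⟩, k⟩)) (fun e n ↦ ?_) t).symm
  refine Eq.trans ?_ (F.res_smul _ _ _).symm
  rw [Modules.resₛₗ_apply, Modules.res_res]
  rfl

end AlgebraicGeometry.Scheme.SecFam

namespace AlgebraicGeometry.Scheme.SubFam
open TensorProduct
variable {X : Scheme.{u}} {P : Type u} {U : P → X.Opens} {F : X.Modules} [IsNoetherian X]

lemma exists_rTensor_subtype_poleSec_eq {K : Finset P} {W : X.Opens} (hW : IsAffineOpen W)
    (t : SecFam U W ⊗[Γ(X, W)] Γ(F, W)) : ∃ n, ∀ m ≥ n, ∃ t' : poleSec U K m W ⊗[Γ(X, W)] Γ(F, W),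
      (poleSec U K m W).subtype.rTensor _ t' = (SecFam.trunc K).rTensor _ t := by
  induction t with
  | zero => exact ⟨0, fun m _ ↦ ⟨0, by simp⟩⟩
  | add x y hx hy =>
    obtain ⟨n, hn⟩ := hx
    obtain ⟨m, hm⟩ := hy
    refine ⟨n + m, fun k hk ↦ ?_⟩
    obtain ⟨x', hx⟩ := hn k (by omega)
    obtain ⟨y', hy⟩ := hm k (by omega)
    exact ⟨x' + y', by rw [map_add, map_add, hx, hy]⟩
  | tmul e n =>
    obtain ⟨m, hm⟩ := exists_mem_poleSec (K := K) hW (e := SecFam.trunc K e)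
      fun p hp ↦ SecFam.trunc_apply_of_notMem hp e
    exact ⟨m, fun k hk ↦ ⟨⟨_, poleSec_mono K hk W hm⟩ ⊗ₜ n, rfl⟩⟩

lemma exists_hasTensor_pole [F.IsQuasicoherent] (hF : F.IsFlat) (f : ∀ p, Γ(F, U p))
    (K : Finset P) : ∃ n, (pole U K n).HasTensor f := by
  obtain ⟨s, hs, hsX⟩ := exists_finite_affine_cover (C := (⊤ : X.Opens))
    (TopologicalSpace.NoetherianSpace.isCompact _)
  have (W : s) : ∃ n, ∀ m ≥ n, ∃ t : (pole U K m).sec W ⊗[Γ(X, W)] Γ(F, W),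
      (pole U K m).IsTensor f t := by
    obtain ⟨t, ht⟩ := SecFam.exists_contr_proj_eq hF (hs _ W.2).1 K
      fun p ↦ F.res (inf_le_left : U p ⊓ W ≤ _) (f p)
    obtain ⟨n, hn⟩ := exists_rTensor_subtype_poleSec_eq (K := K) (hs _ W.2).1 t
    refine ⟨n, fun m hm ↦ ?_⟩
    obtain ⟨t', ht'⟩ := hn m hm
    refine ⟨t', fun p hp ↦ (ht p hp).symm.trans ?_ |>.symm⟩
    have h1 := contr_rTensor (SecFam.proj p) (F.resₛₗ inf_le_right) (SecFam.trunc K)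
      (SecFam.proj (U := U) (V := W) p) (fun e ↦ (SecFam.trunc_apply_of_mem hp e).symm) t
    rw [← h1, ← ht']
    exact contr_rTensor _ _ _ _ (fun _ ↦ rfl) t'
  choose n hn using this
  refine ⟨∑ W, n W, fun x ↦ ?_⟩
  obtain ⟨W, hx⟩ := TopologicalSpace.Opens.mem_iSup.1 (hsX (TopologicalSpace.Opens.mem_top x))
  exact ⟨W, hx, (hs _ W.2).1,
    hn W _ (Finset.single_le_sum (f := n) (fun _ _ ↦ Nat.zero_le _) (Finset.mem_univ W))⟩

end AlgebraicGeometry.Scheme.SubFam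

namespace AlgebraicGeometry.Scheme.SubFam
open TensorProduct
variable {X Y : Scheme.{u}} {P : Type u} {U : P → X.Opens} {S T : SubFam U} {g : Y ⟶ X}

lemma exists_pushHom_of_res_eq {ι : Type*} (W : ι → Y.Opens) (hW : (⊤ : Y.Opens) ≤ ⨆ k, W k)
    (a : ∀ k V, S.sec V →ₛₗ[pull g (inf_le_left : g ⁻¹ᵁ V ⊓ W k ≤ g ⁻¹ᵁ V)] Γ(Y, g ⁻¹ᵁ V ⊓ W k))
    (ha : ∀ k (V V' : X.Opens) (h : V' ≤ V) e,
      a k V' (S.res h e) = Y.res (inf_le_inf_right _ (g.preimage_mono h)) (a k V e))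
    (hc : ∀ k l V e, Y.res (inf_le_left : (g ⁻¹ᵁ V ⊓ W k) ⊓ (g ⁻¹ᵁ V ⊓ W l) ≤ _) (a k V e) =
      Y.res inf_le_right (a l V e)) :
    ∃ b : S.sheaf.PushHom g, ∀ k V e, Y.res inf_le_left (pushApp b V e) = a k V e := by
  have hcov (V : X.Opens) : g ⁻¹ᵁ V ≤ ⨆ k, g ⁻¹ᵁ V ⊓ W k := fun y hy ↦ by
    obtain ⟨k, hk⟩ := TopologicalSpace.Opens.mem_iSup.1 (hW (TopologicalSpace.Opens.mem_top y))
    exact TopologicalSpace.Opens.mem_iSup.2 ⟨k, hy, hk⟩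
  have hu (V : X.Opens) (s t : Γ(Y, g ⁻¹ᵁ V))
      (h : ∀ k, Y.res (inf_le_left : g ⁻¹ᵁ V ⊓ W k ≤ _) s = Y.res inf_le_left t) : s = t :=
    Scheme.eq_of_res_eq (fun k ↦ g ⁻¹ᵁ V ⊓ W k) (fun _ ↦ inf_le_left) (hcov V) s t h
  have hb (V : X.Opens) (e : S.sec V) : ∃ s : Γ(Y, g ⁻¹ᵁ V), ∀ k, Y.res inf_le_left s = a k V e :=
    Scheme.exists_res_eq (fun k ↦ g ⁻¹ᵁ V ⊓ W k) (fun _ ↦ inf_le_left) (hcov V) _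
      fun k l ↦ hc k l V e
  choose b hb using hb
  refine ⟨⟨fun V ↦
    { toFun m := b V ((S.toSheaf V).symm m)
      map_add' m n := hu _ _ _ fun k ↦ ?_
      map_smul' r m := hu _ _ _ fun k ↦ ?_ }, fun V V' h m ↦ hu _ _ _ fun k ↦ ?_⟩,
      fun k V e ↦ hb V e k⟩
  · rw [map_add, hb, map_add, map_add, hb, hb]
  · rw [map_smul, hb, map_smulₛₗ, smul_eq_mul, smul_eq_mul, map_mul, hb]
    refine congrArg (· * _) ?_
    exact (congrArg (Y.res _) (pull_app g _ r)).trans (res_pull _ _ _ _) |>.symm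
  · refine (hb _ _ k).trans ?_
    refine (ha k _ _ h ((S.toSheaf _).symm m)).trans ?_
    rw [← hb, Scheme.res_res]
    exact (Y.res_res _ _ _).symm

variable {F : X.Modules} {f : ∀ p, Γ(F, U p)}

lemma exists_isContr_of_forall_contr_eq [IsNoetherian X] [F.IsQuasicoherent] (hF : F.IsFlat)
    (hS : S.HasTensor f) {ι : Type*} [Finite ι] (W : ι → Y.Opens)
    (hW : (⊤ : Y.Opens) ≤ ⨆ k, W k)
    (hWc : ∀ k l V, IsAffineOpen V → IsCompact ((g ⁻¹ᵁ V ⊓ (W k ⊓ W l) : Y.Opens) : Set Y))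
    (a : ∀ k V, S.sec V →ₛₗ[pull g (inf_le_left : g ⁻¹ᵁ V ⊓ W k ≤ g ⁻¹ᵁ V)] Γ(Y, g ⁻¹ᵁ V ⊓ W k))
    (ha : ∀ k (V V' : X.Opens) (h : V' ≤ V) e,
      a k V' (S.res h e) = Y.res (inf_le_inf_right _ (g.preimage_mono h)) (a k V e))
    (y : Γ((Modules.pullback g).obj F, ⊤))
    (hy : ∀ k V, IsAffineOpen V → ∀ t : S.sec V ⊗[Γ(X, V)] Γ(F, V), S.IsTensor f t →
      contr (a k V) (F.pullₛₗ g inf_le_left) t = ((Modules.pullback g).obj F).res le_top y) :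
    ∃ (T : SubFam U) (_ : T.HasTensor f) (b : T.sheaf.PushHom g), IsContr f b y := by
  let ψ (i : ι × ι) (k : ι) (V : X.Opens) (h : g ⁻¹ᵁ V ⊓ (W i.1 ⊓ W i.2) ≤ g ⁻¹ᵁ V ⊓ W k) :
      S.sec V →ₛₗ[pull g (inf_le_left : g ⁻¹ᵁ V ⊓ (W i.1 ⊓ W i.2) ≤ g ⁻¹ᵁ V)]
        Γ(Y, g ⁻¹ᵁ V ⊓ (W i.1 ⊓ W i.2)) :=
    { toFun e := Y.res h (a k V e)
      map_add' e e' := by rw [map_add, map_add]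
      map_smul' r e := by rw [map_smulₛₗ, smul_eq_mul, map_mul, res_pull, smul_eq_mul] }
  have hψ (i k V h) (hV : IsAffineOpen V) (t : S.sec V ⊗[Γ(X, V)] Γ(F, V)) (ht : S.IsTensor f t) :
      contr (ψ i k V h) (F.pullₛₗ g inf_le_left) t =
        ((Modules.pullback g).obj F).res le_top y := by
    have := contr_eq_map_contr (a k V) (F.pullₛₗ g inf_le_left) (ψ i k V h)
      (F.pullₛₗ g inf_le_left) (.id _) (((Modules.pullback g).obj F).res h) (fun e n ↦ by
        rw [AddMonoidHom.id_apply, contr_tmul, Modules.res_smul, Modules.pullₛₗ_apply,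
          Modules.pullₛₗ_apply, Modules.res_pullSec]
        rfl) t
    rw [AddMonoidHom.id_apply, hy k V hV t ht, Modules.res_res] at this
    exact this
  have hle (i : ι × ι) (V : X.Opens) : g ⁻¹ᵁ V ⊓ (W i.1 ⊓ W i.2) ≤ g ⁻¹ᵁ V ⊓ W i.1 :=
    inf_le_inf_left _ inf_le_left
  have hle' (i : ι × ι) (V : X.Opens) : g ⁻¹ᵁ V ⊓ (W i.1 ⊓ W i.2) ≤ g ⁻¹ᵁ V ⊓ W i.2 :=
    inf_le_inf_left _ inf_le_right
  obtain ⟨T, hT, hST, hsupp, h⟩ := exists_le_of_contr_eq_zero hF hS g (ι := ι × ι)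
    (fun i ↦ W i.1 ⊓ W i.2) (fun i ↦ hWc i.1 i.2)
    (fun i V ↦ ψ i i.1 V (hle i V) - ψ i i.2 V (hle' i V))
    (fun i V V' h e ↦ by
      change Y.res _ (a _ _ _) - Y.res _ (a _ _ _) = Y.res _ (Y.res _ _ - Y.res _ _)
      rw [ha, ha, map_sub, Scheme.res_res, Scheme.res_res, Scheme.res_res, Scheme.res_res])
    (fun i V hV t ht ↦ by rw [contr_sub, hψ _ _ _ _ hV t ht, hψ _ _ _ _ hV t ht, sub_self])
  have hmem (V) (e : T.sec V) : e.1 ∈ S.sec V := (h V e.1 e.2).1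
  let j (V) : T.sec V →ₗ[Γ(X, V)] S.sec V := Submodule.inclusion fun e he ↦ hmem V ⟨e, he⟩
  obtain ⟨b, hb⟩ := exists_pushHom_of_res_eq (S := T) W hW (fun k V ↦ (a k V).comp (j V))
    (fun k V V' h e ↦ ha k V V' h (j V e)) (fun k l V e ↦ by
      obtain ⟨he, h0⟩ := h V e.1 e.2
      have h1 := congrArg (Y.res (show (g ⁻¹ᵁ V ⊓ W k) ⊓ (g ⁻¹ᵁ V ⊓ W l) ≤
        g ⁻¹ᵁ V ⊓ (W k ⊓ W l) from le_inf (inf_le_left.trans inf_le_left)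
          (inf_le_inf inf_le_right inf_le_right))) (sub_eq_zero.1 (h0 (k, l)))
      exact (Y.res_res _ _ _).symm.trans (h1.trans (Y.res_res _ _ _)))
  refine ⟨T, hT, b, fun V hV t ht ↦ ?_⟩
  refine Modules.eq_of_res_eq (fun k ↦ g ⁻¹ᵁ V ⊓ W k) (fun _ ↦ inf_le_left) (fun y hy ↦ by
    obtain ⟨k, hk⟩ := TopologicalSpace.Opens.mem_iSup.1 (hW (TopologicalSpace.Opens.mem_top y))
    exact TopologicalSpace.Opens.mem_iSup.2 ⟨k, hy, hk⟩) _ _ _ fun k ↦ ?_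
  have h1 := hy k V hV _ (ht.rTensor hsupp.ge (j V) fun _ _ _ ↦ rfl)
  have h2 := contr_eq_map_contr (pushApp b V) (F.pullₛₗ g le_rfl) (a k V)
    (F.pullₛₗ g inf_le_left) ((j V).rTensor _).toAddMonoidHom
    (((Modules.pullback g).obj F).res inf_le_left) (fun e n ↦ by
      refine Eq.trans ?_ (((Modules.pullback g).obj F).res_smul _ _ _).symm
      rw [hb, Modules.pullₛₗ_apply, Modules.res_pullSec]
      rfl) t
  rw [Modules.res_res]
  exact h1.symm.trans h2

end AlgebraicGeometry.Scheme.SubFam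

namespace AlgebraicGeometry.Scheme.Modules
open TensorProduct
variable {X Y : Scheme.{u}} {F : X.Modules}

variable (F) in
/-- All sections over affine open subsets. -/
abbrev AffineSec : Type u := Σ V : X.affineOpens, Γ(F, V)

/-- The domain of definition of a section. -/
def AffineSec.dom (p : F.AffineSec) : X.Opens := p.1

/-- A section as an element of the group of sections. -/
def AffineSec.val (p : F.AffineSec) : Γ(F, p.dom) := p.2

open SubFam in
lemma exists_isContr_eq [IsNoetherian X] [F.IsQuasicoherent] (hF : F.IsFlat) [CompactSpace Y]
    [QuasiSeparatedSpace Y] (g : Y ⟶ X) (y : Γ((pullback g).obj F, ⊤)) :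
    ∃ (S : SubFam (AffineSec.dom (F := F))) (_ : S.HasTensor AffineSec.val)
      (a : S.sheaf.PushHom g), IsContr AffineSec.val a y := by
  classical
  have hc (V : X.Opens) : IsCompact ((g ⁻¹ᵁ V : Y.Opens) : Set Y) :=
    g.isCompact_preimage (TopologicalSpace.NoetherianSpace.isCompact (V : Set X))
  obtain ⟨s, hs, hsX⟩ := exists_finite_affine_cover (C := (⊤ : X.Opens))
    (TopologicalSpace.NoetherianSpace.isCompact _)
  choose s' hs' hsY using fun V : s ↦ exists_finite_affine_cover (hc V)
  let κ := Σ V : s, s' V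
  let V₀ (k : κ) : X.affineOpens := ⟨k.1, (hs _ k.1.2).1⟩
  let W (k : κ) : Y.Opens := k.2
  have hW (k : κ) : IsAffineOpen (W k) := (hs' _ _ k.2.2).1
  have hWV (k : κ) : W k ≤ g ⁻¹ᵁ (V₀ k) := (hs' _ _ k.2.2).2
  have hcov : (⊤ : Y.Opens) ≤ ⨆ k, W k := fun x _ ↦ by
    obtain ⟨V, hV⟩ := TopologicalSpace.Opens.mem_iSup.1 (hsX (TopologicalSpace.Opens.mem_top (g x)))
    obtain ⟨k, hk⟩ := TopologicalSpace.Opens.mem_iSup.1 (hsY V hV)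
    exact TopologicalSpace.Opens.mem_iSup.2 ⟨⟨V, k⟩, hk⟩
  have hy (k : κ) : ∃ c : Γ(F, V₀ k) →₀ Γ(Y, W k),
      (c.sum fun h r ↦ r • F.pullSec g (hWV k) h) = ((pullback g).obj F).res le_top y :=
    Finsupp.mem_span_range_iff_exists_finsupp.1
      (span_range_pullSec F g (V₀ k).2 (hW k) (hWV k) ▸ Submodule.mem_top)
  choose c hy using hy
  let p (k : κ) (h : Γ(F, V₀ k)) : F.AffineSec := ⟨V₀ k, h⟩
  let K : Finset F.AffineSec := Finset.univ.biUnion fun k ↦ (c k).support.image (p k)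
  obtain ⟨n, hn⟩ := exists_hasTensor_pole hF AffineSec.val K
  let S := pole AffineSec.dom K n
  have hle (k : κ) (V : X.Opens) (h : Γ(F, V₀ k)) : g ⁻¹ᵁ V ⊓ W k ≤ g ⁻¹ᵁ ((p k h).dom ⊓ V) :=
    le_inf (inf_le_right.trans (hWV k)) inf_le_left
  let a (k : κ) (V : X.Opens) :
      S.sec V →ₛₗ[pull g (inf_le_left : g ⁻¹ᵁ V ⊓ W k ≤ g ⁻¹ᵁ V)] Γ(Y, g ⁻¹ᵁ V ⊓ W k) :=
    { toFun e := ∑ h ∈ (c k).support, Y.res inf_le_right (c k h) *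
        pull g (hle k V h) (S.proj (p k h) e)
      map_add' e e' := by simp only [map_add, mul_add, Finset.sum_add_distrib]
      map_smul' r e := by
        rw [smul_eq_mul, Finset.mul_sum]
        refine Finset.sum_congr rfl fun h _ ↦ ?_
        rw [map_smulₛₗ, smul_eq_mul, map_mul, pull_res, mul_left_comm] }
  refine exists_isContr_of_forall_contr_eq hF hn W hcov (fun k l V hV ↦ ?_) a
    (fun k V V' h e ↦ ?_) y fun k V hV t ht ↦ ?_
  · rw [← inf_assoc]
    refine QuasiSeparatedSpace.inter_isCompact _ _ (_ : Y.Opens).2 ?_ (W l).2 (hW l).isCompact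
    exact QuasiSeparatedSpace.inter_isCompact _ _ (g ⁻¹ᵁ V).2 (hc V) (W k).2 (hW k).isCompact
  · refine Eq.trans ?_ (map_sum (Y.res _) _ _).symm
    refine Finset.sum_congr rfl fun q _ ↦ ?_
    rw [map_mul, Scheme.res_res, res_pull]
    refine congrArg (_ * ·) ?_
    exact pull_res _ _ _ _
  · have key (t : S.sec V ⊗[Γ(X, V)] Γ(F, V)) : contr (a k V) (F.pullₛₗ g inf_le_left) t =
        ∑ h ∈ (c k).support, Y.res (inf_le_right : g ⁻¹ᵁ V ⊓ W k ≤ W k) (c k h) • F.pullSec g (hle k V h)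
          (contr (S.proj (p k h)) (F.resₛₗ inf_le_right) t) := by
      induction t with
      | zero => simp
      | add x y hx hy => simp only [map_add, smul_add, Finset.sum_add_distrib, hx, hy]
      | tmul e m =>
        rw [contr_tmul]
        refine (Finset.sum_smul).trans (Finset.sum_congr rfl fun h _ ↦ ?_)
        rw [mul_smul, contr_tmul]
        refine congrArg (_ • ·) ?_
        refine Eq.trans ?_ (map_smulₛₗ (F.pullₛₗ g (hle k V h)) _ _).symm
        exact congrArg (_ • ·) (F.pullSec_res g _ _ m).symm
    rw [key, ← res_res _ inf_le_right le_top, ← hy k, Finsupp.sum, map_sum]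
    refine Finset.sum_congr rfl fun h hh ↦ ?_
    have hK : p k h ∈ S.supp :=
      Finset.mem_biUnion.2 ⟨k, Finset.mem_univ _, Finset.mem_image_of_mem _ hh⟩
    rw [ht _ hK, res_smul, res_pullSec, pullSec_res]
    rfl

end AlgebraicGeometry.Scheme.Modules

namespace PresheafOfModules
open Limits
variable {C : Type w} [Category.{w'} C] {R : Cᵒᵖ ⥤ RingCat.{u}}

/-- The universe lift of a morphism. -/
def liftMap {M N : PresheafOfModules.{v} R} (α : M ⟶ N) :
    lift.{v, v'} M ⟶ lift.{v, v'} N where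
  app Y := ModuleCat.ofHom
    { toFun := fun x : ULift.{v'} (M.obj Y) ↦ ULift.up.{v'} (α.app Y x.down)
      map_add' := fun x y ↦ congrArg ULift.up (map_add (α.app Y).hom x.down y.down)
      map_smul' := fun r x ↦ congrArg ULift.up (map_smul (α.app Y).hom r x.down) }
  naturality g := ModuleCat.hom_ext (LinearMap.ext fun x ↦
    congrArg ULift.up (naturality_apply α g x.down))

lemma liftMap_comp {M N L : PresheafOfModules.{v} R} (α : M ⟶ N) (β : N ⟶ L) :
    liftMap.{v, v'} (α ≫ β) = liftMap α ≫ liftMap β :=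
  rfl

lemma nonempty_iso_of_cocone {I : Type v} [SmallCategory I] [IsFiltered I]
    {R : Cᵒᵖ ⥤ RingCat.{u}}
    {D : I ⥤ PresheafOfModules.{v + 1} R} {c : Cocone D} (hc : IsColimit c) (s : Cocone D)
    (hsurj : ∀ (Y : Cᵒᵖ) (x : s.pt.obj Y), ∃ (i : I) (a : (D.obj i).obj Y),
      (s.ι.app i).app Y a = x)
    (hinj : ∀ (Y : Cᵒᵖ) (i : I) (a : (D.obj i).obj Y), (s.ι.app i).app Y a = 0 →
      ∃ (j : I) (f : i ⟶ j), (D.map f).app Y a = 0) : Nonempty (c.pt ≅ s.pt) := by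
  have hd (Y : Cᵒᵖ) (i : I) (a : (D.obj i).obj Y) :
      (hc.desc s).app Y ((c.ι.app i).app Y a) = (s.ι.app i).app Y a :=
    congr(($(hc.fac s i).app Y) a)
  refine nonempty_iso_of_bijective (hc.desc s) fun Y ↦
    ⟨(injective_iff_map_eq_zero ((hc.desc s).app Y).hom).2 fun x hx ↦ ?_, fun x ↦ ?_⟩
  · obtain ⟨i, a, rfl⟩ := exists_app_eq_of_isColimit hc Y x
    obtain ⟨j, f, hj⟩ := hinj Y i a ((hd Y i a).symm.trans hx)
    rw [← c.w f]
    exact (congrArg ((c.ι.app j).app Y) hj).trans (map_zero ((c.ι.app j).app Y).hom)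
  · obtain ⟨i, a, rfl⟩ := hsurj Y x
    exact ⟨(c.ι.app i).app Y a, hd Y i a⟩

end PresheafOfModules

namespace AlgebraicGeometry.Scheme
open Limits SubFam

variable {X : Scheme.{u}} {P : Type u} {U : P → X.Opens} {F : X.Modules} {f : ∀ p, Γ(F, U p)}

namespace SubFam
variable [IsNoetherian X] [F.IsQuasicoherent] (hF : F.IsFlat) {S : SubFam U} (hS : S.HasTensor f)

/-- The section obtained by contraction with the tensor that represents the given sections. -/
def contrSection {Y : Scheme.{u}} {g : Y ⟶ X} (a : S.sheaf.PushHom g) :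
    Γ((Modules.pullback g).obj F, ⊤) :=
  (exists_isContr hF hS a).choose

lemma isContr_contrSection {Y : Scheme.{u}} {g : Y ⟶ X} (a : S.sheaf.PushHom g) :
    IsContr f a (contrSection hF hS a) :=
  (exists_isContr hF hS a).choose_spec

/-- Contraction as a morphism of functors. -/
def contrHom : S.sheaf.dualFunctor ⟶ F.toFunctor where
  app _ := ModuleCat.ofHom
    { toFun := fun a ↦ contrSection hF hS a
      map_add' := fun a b ↦ IsContr.unique hS (isContr_contrSection hF hS _)
        ((isContr_contrSection hF hS a).add (isContr_contrSection hF hS b))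
      map_smul' := fun r a ↦ IsContr.unique hS (isContr_contrSection hF hS _)
        ((isContr_contrSection hF hS a).smul r) }
  naturality {_ _} g := ModuleCat.hom_ext (LinearMap.ext fun a ↦
    IsContr.unique hS (isContr_contrSection hF hS _)
      ((isContr_contrSection hF hS a).restrict g.unop.hom.left (Over.w g.unop.hom)))

lemma dualFunctorMap_truncHom_contrHom {T : SubFam U} (hT : T.HasTensor f) (h : S ≤ T) :
    Modules.dualFunctorMap (truncHom h) ≫ contrHom hF hT = contrHom hF hS := by
  refine PresheafOfModules.hom_ext fun _ ↦ ?_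
  refine ModuleCat.hom_ext (LinearMap.ext fun a ↦ ?_)
  exact IsContr.unique hT (isContr_contrSection hF hT _)
    ((isContr_contrSection hF hS a).precomp h)

variable (f) in
/-- The system of functors of homomorphisms. -/
def dualSystem : {S : SubFam U // S.HasTensor f} ⥤
    _root_.PresheafOfModules.{u + 1} (X.structureFunctor ⋙ forget₂ CommRingCat RingCat) where
  obj S := _root_.PresheafOfModules.lift.{u, u + 1} S.1.sheaf.dualFunctor
  map h := PresheafOfModules.liftMap (Modules.dualFunctorMap (truncHom (leOfHom h)))
  map_id S := by
    rw [truncHom_refl]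
    rfl
  map_comp h h' := by
    rw [← truncHom_comp (leOfHom h) (leOfHom h')]
    rfl

/-- The cocone given by contraction. -/
def dualCocone : Cocone (dualSystem f) where
  pt := _root_.PresheafOfModules.lift.{u, u + 1} F.toFunctor
  ι :=
    { app S := PresheafOfModules.liftMap (contrHom hF S.2)
      naturality S T h := by
        refine (PresheafOfModules.liftMap_comp _ _).symm.trans ?_
        rw [dualFunctorMap_truncHom_contrHom hF S.2 T.2 (leOfHom h)]
        rfl }

end SubFam

lemma isDirectLimitOfModuleVarieties_of_isFlat [IsNoetherian X] [F.IsQuasicoherent]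
    (hF : F.IsFlat) : IsDirectLimitOfModuleVarieties F.toFunctor := by
  let I := {S : SubFam (Modules.AffineSec.dom (F := F)) //
    S.HasTensor (F := F) Modules.AffineSec.val}
  have : IsDirectedOrder I := ⟨fun S T ↦ ⟨⟨S.1.sup T.1, S.2.sup hF T.2⟩,
    le_sup_left, le_sup_right⟩⟩
  have : Nonempty I := by
    obtain ⟨n, hn⟩ := exists_hasTensor_pole hF (Modules.AffineSec.val (F := F)) ∅
    exact ⟨⟨_, hn⟩⟩
  refine ⟨I, inferInstance, inferInstance, inferInstance, dualSystem _,
    colimit.cocone _, fun S ↦ ?_, ⟨colimit.isColimit _⟩, ?_⟩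
  · have hS : S.1.sheaf.IsCoherent := isCoherent_sheaf S.1
    have := hS.1
    obtain ⟨e⟩ := S.1.sheaf.nonempty_dual_iso
    exact ⟨S.1.sheaf, hS, ⟨e.symm⟩⟩
  · refine PresheafOfModules.nonempty_iso_of_cocone (colimit.isColimit _) (dualCocone hF)
      (fun Y x ↦ ?_) fun Y S a ha ↦ ?_
    · have := Y.unop.property.1
      have := Y.unop.property.2
      obtain ⟨S, hS, a, ha⟩ := Modules.exists_isContr_eq hF Y.unop.obj.hom (ULift.down x)
      refine ⟨⟨S, hS⟩, ULift.up a, ?_⟩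
      exact congrArg ULift.up (IsContr.unique hS (isContr_contrSection hF hS a) ha)
    · have h0 : contrSection hF S.2 (ULift.down a) = 0 := congrArg ULift.down ha
      obtain ⟨T, hT, h, h1⟩ := IsContr.exists_precomp_eq_zero hF S.2
        (fun V _ ↦ isCompact_preimage_of_isNoetherian Y.unop V)
        (h0 ▸ isContr_contrSection hF S.2 (ULift.down a))
      exact ⟨⟨T, hT⟩, homOfLE h, congrArg ULift.up h1⟩

end AlgebraicGeometry.Scheme

end

theorem mainTheorem11 (X : AlgebraicGeometry.Scheme.{u}) [AlgebraicGeometry.IsNoetherian X]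
    (F : X.Modules) [F.IsQuasicoherent] :
    F.IsFlat ↔
      AlgebraicGeometry.Scheme.IsDirectLimitOfModuleVarieties F.toFunctor := by
  exact ⟨Scheme.isDirectLimitOfModuleVarieties_of_isFlat,
    Scheme.Modules.isFlat_of_isDirectLimitOfModuleVarieties⟩
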